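/- Let $\mathcal C$ be a braided monoidal category with braiding $\Psi$ (associativity and unit isomorphisms are suppressed) that is rigid: every object $X$ has a dual $X^*$ with $\mathrm{ev}\colon X^*\otimes X\to \underline 1$ and $\mathrm{coev}\colon \underline 1\to X\otimes X^*$. A *braided group* in $\mathcal C$ is a Hopf algebra in $\mathcal C$ (algebra, coalgebra, $\Delta$ and $\varepsilon$ multiplicative with respect to the braided tensor product algebra, antipode $S$). **Reconstruction.** Let $F\colon\mathcal D\to\mathcal C$ be a monoidal functor, $H\in\mathcal C$, and $\beta_X\colon F(X)\to F(X)\otimes H$ a natural transformation. The pair $(H,\beta)$ satisfies the *representability condition* if for all $n\ge 0$ and all $V\in\mathcal C$ the map $$\theta_n\colon \mathrm{Mor}(H^{\otimes n},V)\to \mathrm{Nat}(F^n,F^n\otimes V),\qquad F^n(X_1,\dots,X_n)=F(X_1)\otimes\cdots\otimes F(X_n),$$ is bijective, where $\theta_n(\phi)$ applies $\beta_{X_1}\otimes\cdots\otimes\beta_{X_n}$, moves the copies of $H$ to the right past the $F(X_j)$ with $\Psi$, keeping their order, and then applies $\phi$. The braided group *reconstructed* from $F$ is then $H$ with the Hopf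 algebra structure (unique if it exists) for which every $\beta_X$ is a right coaction of $H$, $\beta_{\underline 1}$ is the trivial coaction given by the unit of $H$, and $\beta_{X\otimes Y}$ is the tensor product coaction $(\mathrm{id}\otimes\cdot)(\mathrm{id}\otimes\Psi_{H,F(Y)}\otimes\mathrm{id})(\beta_X\otimes\beta_Y)$. **Proposition.** Suppose that $A\in\mathcal C$ and $\beta_X\colon X\to X\otimes A$ satisfy the representability condition for the identity functor of $\mathcal C$. Then: 1. The reconstructed braided group structure on $A=\mathrm{Aut}(\mathcal C)$ exists. The morphisms $(\mathrm{ev}_X\otimes \mathrm{id})(\mathrm{id}\otimes\beta_X)\colon X^*\otimes X\to A$ exhibit $A$ as the coend $\int_X X^*\otimes X$, and the tautological coaction of $A$ on the object $A$ is the braided adjoint coaction, $$\beta_A=\mathrm{Ad}:=(\mathrm{id}\otimes\cdot)(\Psi_{A,A}\otimes\mathrm{id})(S\otimes\Delta)\Delta\colon A\to A\otimes A .$$ 2. Let $\mathcal C^{A}$ be the monoidal category of right $A$-comodules $(X,\rho)$ in $\mathcal C$. The object $A\otimes A$ with the natural transformation $(\beta_X\otimes\mathrm{id})\rho\colon X\to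 X\otimes A\otimes A$ satisfies the representability condition for the forgetful functor $\mathcal C^{A}\to\mathcal C$, and the braided group reconstructed from this functor exists. It is the cross coproduct $\mathrm{Aut}(\mathcal C)\blacktriangleright\!\!<\mathrm{Aut}(\mathcal C)$ by the braided adjoint coaction: the algebra is the braided tensor product algebra $(\cdot\otimes\cdot)(\mathrm{id}\otimes\Psi_{A,A}\otimes\mathrm{id})$ with unit $\eta\otimes\eta$, and the coalgebra has counit $\varepsilon\otimes\varepsilon$ and coproduct $$A\otimes A\xrightarrow{\ (\mathrm{id}^{\otimes 2}\otimes\mathrm{Ad}\otimes\mathrm{id})(\Delta\otimes\Delta)\ }A^{\otimes 5}\xrightarrow{\ \mathrm{id}\otimes\Psi_{A,A}\otimes\mathrm{id}^{\otimes2}\ }A^{\otimes5}\xrightarrow{\ \mathrm{id}^{\otimes2}\otimes\,\cdot\,\otimes\mathrm{id}\ }A^{\otimes 4}.$$ 3. The cross product $\mathrm{Aut}(\mathcal C)>\!\!\triangleleft\,\mathrm{Aut}(\mathcal C)$ by the braided adjoint action $\triangleright=\cdot\,(\mathrm{id}\otimes\cdot)(\mathrm{id}^{\otimes 2}\otimes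 S)(\mathrm{id}\otimes\Psi_{A,A})(\Delta\otimes\mathrm{id})\colon A\otimes A\to A$ is a braided group: it is $A\otimes A$ with unit $\eta\otimes\eta$, product $$A^{\otimes4}\xrightarrow{\ \mathrm{id}\otimes\Delta\otimes\mathrm{id}^{\otimes 2}\ }A^{\otimes5}\xrightarrow{\ \mathrm{id}^{\otimes2}\otimes\Psi_{A,A}\otimes\mathrm{id}\ }A^{\otimes5}\xrightarrow{\ \mathrm{id}\otimes\triangleright\otimes\mathrm{id}^{\otimes 2}\ }A^{\otimes4}\xrightarrow{\ \cdot\otimes\cdot\ }A^{\otimes 2},$$ and the braided tensor product coalgebra $(\mathrm{id}\otimes\Psi_{A,A}\otimes\mathrm{id})(\Delta\otimes\Delta)$, $\varepsilon\otimes\varepsilon$. There is an isomorphism of braided groups $$\mathrm{Aut}(\mathcal C)\blacktriangleright\!\!<\mathrm{Aut}(\mathcal C)\;\cong\;\mathrm{Aut}(\mathcal C)>\!\!\triangleleft\,\mathrm{Aut}(\mathcal C).$$ -/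

import Mathlib

open CategoryTheory MonoidalCategory Limits
open scoped MonObj ComonObj HopfObj

namespace BraidedReconstruction

universe v v' u u'

/-! ## Right comodules over a bialgebra in a braided category -/

section Comodules

variable {C : Type u} [Category.{v} C] [MonoidalCategory C]

section TensorCoaction

variable [BraidedCategory C] {B : C}

/-- The tensor product of coactions: coact on both factors, take the first copy of `B` past `Y`
with the braiding, and multiply the two copies of `B`. -/
def tensorCoact [MonObj B] {X Y : C} (r : X ⟶ X ⊗ B) (s : Y ⟶ Y ⊗ B) :
    X ⊗ Y ⟶ (X ⊗ Y) ⊗ B :=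
  (r ⊗ₘ s) ≫ tensorμ X B Y B ≫ (X ⊗ Y) ◁ μ[B]

/-- The trivial coaction on the unit object. -/
def unitCoact (B : C) [MonObj B] : 𝟙_ C ⟶ 𝟙_ C ⊗ B :=
  (λ_ (𝟙_ C)).inv ≫ 𝟙_ C ◁ η[B]

theorem tensorμ_whiskerLeft {X Y Z W Z' W' : C} (f : Z ⟶ Z') (g : W ⟶ W') :
    (X ◁ f ⊗ₘ Y ◁ g) ≫ tensorμ X Z' Y W' = tensorμ X Z Y W ≫ (X ⊗ Y) ◁ (f ⊗ₘ g) := by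
  simpa only [id_tensorHom, MonoidalCategory.whiskerLeft_id] using!
    tensorμ_natural (𝟙 X) f (𝟙 Y) g

theorem tensorμ_whiskerRight {X Y X' Y' Z W : C} (f : X ⟶ X') (g : Y ⟶ Y') :
    (f ▷ Z ⊗ₘ g ▷ W) ≫ tensorμ X' Z Y' W = tensorμ X Z Y W ≫ (f ⊗ₘ g) ▷ (Z ⊗ W) := by
  simpa only [tensorHom_id, MonoidalCategory.id_whiskerRight] using!
    tensorμ_natural f (𝟙 Z) g (𝟙 W)

theorem unitCoact_counit [BimonObj B] : unitCoact B ≫ 𝟙_ C ◁ ε[B] = (ρ_ (𝟙_ C)).inv := by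
  rw [unitCoact, Category.assoc, ← MonoidalCategory.whiskerLeft_comp, BimonObj.one_counit]
  simp [unitors_inv_equal]

theorem unitCoact_coassoc [BimonObj B] :
    unitCoact B ≫ unitCoact B ▷ B ≫ (α_ (𝟙_ C) B B).hom = unitCoact B ≫ 𝟙_ C ◁ Δ[B] := by
  have h := BimonObj.one_comul B
  rw [MonObj.tensorObj.one_def] at h
  simp only [unitCoact, Category.assoc]
  rw [← MonoidalCategory.whiskerLeft_comp, h, MonoidalCategory.tensorHom_def]
  simp only [MonoidalCategory.comp_whiskerRight, MonoidalCategory.whiskerLeft_comp,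
    Category.assoc]
  rw [associator_naturality_middle, whisker_exchange_assoc,
    ← MonoidalCategory.whiskerLeft_comp, ← whisker_exchange,
    associator_naturality_right_assoc, MonoidalCategory.whiskerLeft_comp]
  monoidal

theorem tensorCoact_counit [BimonObj B] {X Y : C} {r : X ⟶ X ⊗ B} {s : Y ⟶ Y ⊗ B}
    (hr : r ≫ X ◁ ε[B] = (ρ_ X).inv) (hs : s ≫ Y ◁ ε[B] = (ρ_ Y).inv) :
    tensorCoact r s ≫ (X ⊗ Y) ◁ ε[B] = (ρ_ (X ⊗ Y)).inv := by
  have h : (μ[B] ≫ ε[B]) = (ε[B] ⊗ₘ ε[B]) ≫ (λ_ (𝟙_ C)).hom := by simp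
  simp only [tensorCoact, Category.assoc]
  rw [← MonoidalCategory.whiskerLeft_comp, h, MonoidalCategory.whiskerLeft_comp]
  have h2 := tensorμ_whiskerLeft (X := X) (Y := Y) ε[B] ε[B]
  rw [← reassoc_of% h2, tensorHom_comp_tensorHom_assoc, hr, hs]
  have h3 := rightUnitor_monoidal X Y
  rw [← cancel_mono (ρ_ (X ⊗ Y)).hom]
  simp only [Category.assoc]
  rw [← h3]
  simp

theorem tensorCoact_coassoc [BimonObj B] {X Y : C} {r : X ⟶ X ⊗ B} {s : Y ⟶ Y ⊗ B}
    (hr : r ≫ r ▷ B ≫ (α_ X B B).hom = r ≫ X ◁ Δ[B])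
    (hs : s ≫ s ▷ B ≫ (α_ Y B B).hom = s ≫ Y ◁ Δ[B]) :
    tensorCoact r s ≫ tensorCoact r s ▷ B ≫ (α_ (X ⊗ Y) B B).hom =
      tensorCoact r s ≫ (X ⊗ Y) ◁ Δ[B] := by
  have h := BimonObj.mul_comul B
  simp only [tensorCoact, Category.assoc]
  rw [← MonoidalCategory.whiskerLeft_comp, h]
  simp only [MonoidalCategory.whiskerLeft_comp]
  have h2 := tensorμ_whiskerLeft (X := X) (Y := Y) Δ[B] Δ[B]
  rw [← reassoc_of% h2, tensorHom_comp_tensorHom_assoc, ← hr, ← hs]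
  have h3 := associator_monoidal X B B Y B B
  rw [← Category.assoc r, ← Category.assoc s, ← tensorHom_comp_tensorHom_assoc,
    ← reassoc_of% h3]
  have h4 := tensorμ_whiskerRight (Z := B) (W := B) r s
  rw [← tensorHom_comp_tensorHom_assoc, reassoc_of% h4]
  rw [MonoidalCategory.tensorHom_def' μ[B] μ[B]]
  simp only [MonoidalCategory.comp_whiskerRight, Category.assoc,
    MonoidalCategory.whiskerLeft_comp]
  congr 2
  rw [whisker_exchange_assoc, whisker_exchange_assoc, associator_naturality_middle,
    associator_naturality_right_assoc]

theorem tensorCoact_natural [MonObj B] {X Y X' Y' : C} {r : X ⟶ X ⊗ B} {s : Y ⟶ Y ⊗ B}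
    {r' : X' ⟶ X' ⊗ B} {s' : Y' ⟶ Y' ⊗ B} {f : X ⟶ X'} {g : Y ⟶ Y'}
    (hf : r ≫ f ▷ B = f ≫ r') (hg : s ≫ g ▷ B = g ≫ s') :
    tensorCoact r s ≫ (f ⊗ₘ g) ▷ B = (f ⊗ₘ g) ≫ tensorCoact r' s' := by
  have h := tensorμ_whiskerRight (Z := B) (W := B) f g
  simp only [tensorCoact, Category.assoc]
  rw [whisker_exchange, ← reassoc_of% h, tensorHom_comp_tensorHom_assoc,
    tensorHom_comp_tensorHom_assoc, hf, hg]

theorem tensorCoact_assoc [MonObj B] {X Y Z : C} (r : X ⟶ X ⊗ B) (s : Y ⟶ Y ⊗ B)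
    (t : Z ⟶ Z ⊗ B) :
    tensorCoact (tensorCoact r s) t ≫ (α_ X Y Z).hom ▷ B =
      (α_ X Y Z).hom ≫ tensorCoact r (tensorCoact s t) := by
  have h := tensor_associativity X B Y B Z B
  have h1 := tensorμ_whiskerLeft (X := X ⊗ Y) (Y := Z) μ[B] (𝟙 B)
  have h2 := tensorμ_whiskerLeft (X := X) (Y := Y ⊗ Z) (𝟙 B) μ[B]
  have e1 : (tensorCoact r s ⊗ₘ t) = ((r ⊗ₘ s) ⊗ₘ t) ≫ (tensorμ X B Y B ▷ (Z ⊗ B)) ≫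
      ((X ⊗ Y) ◁ μ[B] ⊗ₘ Z ◁ 𝟙 B) := by
    rw [tensorCoact, ← tensorHom_id (tensorμ X B Y B), tensorHom_comp_tensorHom,
      tensorHom_comp_tensorHom]
    simp
  have e2 : (r ⊗ₘ tensorCoact s t) = (r ⊗ₘ (s ⊗ₘ t)) ≫ ((X ⊗ B) ◁ tensorμ Y B Z B) ≫
      (X ◁ 𝟙 B ⊗ₘ (Y ⊗ Z) ◁ μ[B]) := by
    rw [tensorCoact, ← id_tensorHom _ (tensorμ Y B Z B), tensorHom_comp_tensorHom,
      tensorHom_comp_tensorHom]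
    simp
  rw [tensorCoact.eq_def (tensorCoact r s), tensorCoact.eq_def r (tensorCoact s t), e1, e2]
  simp only [Category.assoc]
  rw [reassoc_of% h1, reassoc_of% h2, ← associator_naturality_assoc, ← reassoc_of% h]
  have e3 : μ[B] ▷ B ≫ μ[B] = (α_ B B B).hom ≫ B ◁ μ[B] ≫ μ[B] := MonObj.mul_assoc B
  simp only [tensorHom_id, id_tensorHom, ← MonoidalCategory.whiskerLeft_comp_assoc,
    ← MonoidalCategory.whiskerLeft_comp, e3]
  simp only [MonoidalCategory.tensorHom_def', Category.assoc, MonoidalCategory.whiskerLeft_comp,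
    whisker_exchange, whisker_exchange_assoc]

theorem tensorCoact_unit_left [MonObj B] {X : C} (r : X ⟶ X ⊗ B) :
    tensorCoact (unitCoact B) r ≫ (λ_ X).hom ▷ B = (λ_ X).hom ≫ r := by
  have h := tensor_left_unitality X B
  have h1 := tensorμ_whiskerLeft (X := 𝟙_ C) (Y := X) η[B] (𝟙 B)
  have e1 : (unitCoact B ⊗ₘ r) = 𝟙_ C ◁ r ≫ (λ_ (𝟙_ C)).inv ▷ (X ⊗ B) ≫
      (𝟙_ C ◁ η[B] ⊗ₘ X ◁ 𝟙 B) := by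
    simp [unitCoact, MonoidalCategory.tensorHom_def']
  rw [tensorCoact, e1]
  simp only [Category.assoc]
  rw [reassoc_of% h1, ← leftUnitor_naturality, h]
  have e3 : η[B] ▷ B ≫ μ[B] = (λ_ B).hom := MonObj.one_mul B
  simp only [tensorHom_id, ← MonoidalCategory.whiskerLeft_comp_assoc, e3]
  rw [MonoidalCategory.tensorHom_def']

theorem tensorCoact_unit_right [MonObj B] {X : C} (r : X ⟶ X ⊗ B) :
    tensorCoact r (unitCoact B) ≫ (ρ_ X).hom ▷ B = (ρ_ X).hom ≫ r := by
  have h := tensor_right_unitality X B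
  have h1 := tensorμ_whiskerLeft (X := X) (Y := 𝟙_ C) (𝟙 B) η[B]
  have e1 : (r ⊗ₘ unitCoact B) = r ▷ 𝟙_ C ≫ (X ⊗ B) ◁ (λ_ (𝟙_ C)).inv ≫
      (X ◁ 𝟙 B ⊗ₘ 𝟙_ C ◁ η[B]) := by
    simp [unitCoact, MonoidalCategory.tensorHom_def]
  rw [tensorCoact, e1]
  simp only [Category.assoc]
  rw [reassoc_of% h1, ← rightUnitor_naturality, h]
  have e3 : B ◁ η[B] ≫ μ[B] = (ρ_ B).hom := MonObj.mul_one B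
  simp only [id_tensorHom, ← MonoidalCategory.whiskerLeft_comp_assoc, e3]
  rw [MonoidalCategory.tensorHom_def']

end TensorCoaction

/-- A right comodule `(X, coact : X ⟶ X ⊗ B)` of a coalgebra `B` in a monoidal category. -/
structure Comodule (B : C) [ComonObj B] where
  /-- The underlying object. -/
  X : C
  /-- The coaction. -/
  coact : X ⟶ X ⊗ B
  coact_counit : coact ≫ X ◁ ε[B] = (ρ_ X).inv
  coact_coassoc : coact ≫ coact ▷ B ≫ (α_ X B B).hom = coact ≫ X ◁ Δ[B]

namespace Comodule

/-- A morphism of comodules: a morphism in `C` that intertwines the coactions. -/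
@[ext]
structure Hom {B : C} [ComonObj B] (M N : Comodule B) where
  /-- The underlying morphism. -/
  hom : M.X ⟶ N.X
  comm : M.coact ≫ hom ▷ B = hom ≫ N.coact

instance {B : C} [ComonObj B] : Category (Comodule B) where
  Hom M N := Hom M N
  id M := ⟨𝟙 M.X, by simp⟩
  comp f g := ⟨f.hom ≫ g.hom, by
    rw [comp_whiskerRight, ← Category.assoc, f.comm, Category.assoc, g.comm, Category.assoc]⟩

@[ext]
theorem hom_ext {B : C} [ComonObj B] {M N : Comodule B} (f g : M ⟶ N) (h : f.hom = g.hom) :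
    f = g := Hom.ext h

@[simp]
theorem id_hom {B : C} [ComonObj B] (M : Comodule B) : Hom.hom (𝟙 M) = 𝟙 M.X := rfl

@[simp]
theorem comp_hom {B : C} [ComonObj B] {M N P : Comodule B} (f : M ⟶ N) (g : N ⟶ P) :
    (f ≫ g).hom = f.hom ≫ g.hom := rfl

/-- The forgetful functor from `B`-comodules in `C` to `C`. -/
@[simps]
def forget (B : C) [ComonObj B] : Comodule B ⥤ C where
  obj M := M.X
  map f := f.hom

instance (B : C) [ComonObj B] : (forget B).Faithful where
  map_injective h := hom_ext _ _ h

/-- An isomorphism in `C` that intertwines coactions is an isomorphism of comodules. -/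
@[simps]
def mkIso {B : C} [ComonObj B] {M N : Comodule B} (e : M.X ≅ N.X)
    (h : M.coact ≫ e.hom ▷ B = e.hom ≫ N.coact) : M ≅ N where
  hom := ⟨e.hom, h⟩
  inv := ⟨e.inv, by rw [Iso.eq_inv_comp, ← Category.assoc, ← h]; simp⟩
  hom_inv_id := by ext; simp
  inv_hom_id := by ext; simp

variable [BraidedCategory C] {B : C} [BimonObj B]

/-- The unit object with the trivial coaction. -/
@[simps]
def unit (B : C) [BimonObj B] : Comodule B where
  X := 𝟙_ C
  coact := unitCoact B
  coact_counit := unitCoact_counit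
  coact_coassoc := unitCoact_coassoc

/-- The tensor product of comodules. -/
@[simps]
def tensor (M N : Comodule B) : Comodule B where
  X := M.X ⊗ N.X
  coact := tensorCoact M.coact N.coact
  coact_counit := tensorCoact_counit M.coact_counit N.coact_counit
  coact_coassoc := tensorCoact_coassoc M.coact_coassoc N.coact_coassoc

/-- The tensor product of morphisms of comodules. -/
@[simps]
def tensorMap {M N M' N' : Comodule B} (f : M ⟶ M') (g : N ⟶ N') :
    tensor M N ⟶ tensor M' N' where
  hom := f.hom ⊗ₘ g.hom
  comm := tensorCoact_natural f.comm g.comm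

instance : MonoidalCategoryStruct (Comodule B) where
  tensorObj := tensor
  whiskerLeft M _ _ f := tensorMap (𝟙 M) f
  whiskerRight f N := tensorMap f (𝟙 N)
  tensorHom f g := tensorMap f g
  tensorUnit := unit B
  associator M N P := mkIso (α_ M.X N.X P.X) (tensorCoact_assoc M.coact N.coact P.coact)
  leftUnitor M := mkIso (λ_ M.X) (tensorCoact_unit_left M.coact)
  rightUnitor M := mkIso (ρ_ M.X) (tensorCoact_unit_right M.coact)

/-- The forgetful functor preserves the tensor product, its unit and the coherence isomorphisms
on the nose. -/
def forgetInducingData (B : C) [BimonObj B] : Monoidal.InducingFunctorData (forget B) where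
  μIso M N := Iso.refl (M.X ⊗ N.X)
  εIso := Iso.refl (𝟙_ C)
  whiskerLeft_eq M _ _ f := by
    change 𝟙 M.X ⊗ₘ f.hom = 𝟙 _ ≫ (M.X ◁ f.hom) ≫ 𝟙 _
    simp
  whiskerRight_eq f N := by
    change f.hom ⊗ₘ 𝟙 N.X = 𝟙 _ ≫ (f.hom ▷ N.X) ≫ 𝟙 _
    simp
  tensorHom_eq f g := by
    change f.hom ⊗ₘ g.hom = 𝟙 _ ≫ (f.hom ⊗ₘ g.hom) ≫ 𝟙 _
    simp
  associator_eq M N P := by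
    change (α_ M.X N.X P.X).hom = (𝟙 _ ≫ (𝟙 _ ⊗ₘ 𝟙 _)) ≫ (α_ M.X N.X P.X).hom ≫
      (𝟙 _ ⊗ₘ 𝟙 _) ≫ 𝟙 _
    simp
  leftUnitor_eq M := by
    change (λ_ M.X).hom = (𝟙 _ ≫ (𝟙 _ ⊗ₘ 𝟙 _)) ≫ (λ_ M.X).hom
    simp
  rightUnitor_eq M := by
    change (ρ_ M.X).hom = (𝟙 _ ≫ (𝟙 _ ⊗ₘ 𝟙 _)) ≫ (ρ_ M.X).hom
    simp

instance : MonoidalCategory (Comodule B) := Monoidal.induced (forget B) (forgetInducingData B)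

instance (B : C) [BimonObj B] : (forget B).Monoidal :=
  (Monoidal.fromInducedCoreMonoidal (forget B) (forgetInducingData B)).toMonoidal

end Comodule

end Comodules

/-! ## Reconstruction from a monoidal functor -/

section Reconstruction

variable {C : Type u} [Category.{v} C] [MonoidalCategory C]
variable {D : Type u'} [Category.{v'} D]

/-- The `n`-fold tensor product `X 0 ⊗ (X 1 ⊗ ( ⋯ ⊗ 𝟙_ C))`. -/
def tensorFamily : (n : ℕ) → (Fin n → C) → C
  | 0, _ => 𝟙_ C
  | n + 1, X => X 0 ⊗ tensorFamily n (fun i => X i.succ)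

/-- The `n`-fold tensor product of morphisms. -/
def tensorFamilyMap : (n : ℕ) → {X Y : Fin n → C} → (∀ i, X i ⟶ Y i) →
    (tensorFamily n X ⟶ tensorFamily n Y)
  | 0, _, _, _ => 𝟙 (𝟙_ C)
  | n + 1, _, _, f => f 0 ⊗ₘ tensorFamilyMap n (fun i => f i.succ)

theorem tensorFamilyMap_id : ∀ (n : ℕ) (X : Fin n → C),
    tensorFamilyMap n (fun i => 𝟙 (X i)) = 𝟙 (tensorFamily n X)
  | 0, _ => rfl
  | n + 1, X => by
    simp only [tensorFamilyMap, tensorFamilyMap_id n, id_tensorHom_id]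
    rfl

theorem tensorFamilyMap_comp : ∀ (n : ℕ) {X Y Z : Fin n → C} (f : ∀ i, X i ⟶ Y i)
    (g : ∀ i, Y i ⟶ Z i),
    tensorFamilyMap n (fun i => f i ≫ g i) = tensorFamilyMap n f ≫ tensorFamilyMap n g
  | 0, _, _, _, _, _ => (Category.comp_id _).symm
  | n + 1, _, _, _, f, g => by
    simp only [tensorFamilyMap, tensorFamilyMap_comp n]
    exact (tensorHom_comp_tensorHom _ _ _ _).symm

/-- The functor `Fⁿ : Dⁿ ⥤ C`, `(X₁, …, Xₙ) ↦ F X₁ ⊗ ⋯ ⊗ F Xₙ`. -/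
@[simps]
def tensorPower (F : D ⥤ C) (n : ℕ) : (Fin n → D) ⥤ C where
  obj X := tensorFamily n (fun i => F.obj (X i))
  map f := tensorFamilyMap n (fun i => F.map (f i))
  map_id X := by
    simp only [Pi.id_apply, F.map_id, tensorFamilyMap_id]
  map_comp f g := by
    simp only [Pi.comp_apply, F.map_comp, tensorFamilyMap_comp]

/-- The `n`-th tensor power `Aⁿ` of an object. -/
def objPower (A : C) (n : ℕ) : C := tensorFamily n (fun _ => A)

variable [BraidedCategory C]

/-- The component `F X₁ ⊗ ⋯ ⊗ F Xₙ ⟶ (F X₁ ⊗ ⋯ ⊗ F Xₙ) ⊗ Aⁿ` obtained by applying `β` to each factor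
and moving the copies of `A` to the right, in order, with the braiding. -/
def coactPowerApp {F : D ⥤ C} {A : C} (β : F ⟶ F ⋙ tensorRight A) : (n : ℕ) → (X : Fin n → D) →
    (tensorFamily n (fun i => F.obj (X i)) ⟶
      tensorFamily n (fun i => F.obj (X i)) ⊗ objPower A n)
  | 0, _ => (λ_ (𝟙_ C)).inv
  | n + 1, X => (β.app (X 0) ⊗ₘ coactPowerApp β n (fun i => X i.succ)) ≫
      tensorμ (F.obj (X 0)) A (tensorFamily n (fun i => F.obj (X i.succ))) (objPower A n)

theorem coactPowerApp_natural {F : D ⥤ C} {A : C} (β : F ⟶ F ⋙ tensorRight A) :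
    ∀ (n : ℕ) {X Y : Fin n → D} (f : ∀ i, X i ⟶ Y i),
    tensorFamilyMap n (fun i => F.map (f i)) ≫ coactPowerApp β n Y =
      coactPowerApp β n X ≫ tensorFamilyMap n (fun i => F.map (f i)) ▷ objPower A n
  | 0, X, Y, f => by
    change 𝟙 (𝟙_ C) ≫ (λ_ (𝟙_ C)).inv = (λ_ (𝟙_ C)).inv ≫ 𝟙 (𝟙_ C) ▷ 𝟙_ C
    simp
  | n + 1, X, Y, f => by
    have h := coactPowerApp_natural β n (fun i => f i.succ)
    have h0 : F.map (f 0) ≫ β.app (Y 0) = β.app (X 0) ≫ F.map (f 0) ▷ A := β.naturality (f 0)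
    have h1 := tensorμ_whiskerRight (Z := A) (W := objPower A n) (F.map (f 0))
      (tensorFamilyMap n (fun i => F.map (f i.succ)))
    have h2 := tensorHom_comp_tensorHom (F.map (f 0)) (tensorFamilyMap n fun i => F.map (f i.succ))
      (β.app (Y 0)) (coactPowerApp β n fun i => Y i.succ)
    rw [h] at h2
    refine (Category.assoc _ _ _).symm.trans ?_
    refine (congrArg (· ≫ tensorμ _ _ _ _) (h2.trans (congrArg (· ⊗ₘ _) h0))).trans ?_
    refine (congrArg (· ≫ tensorμ _ _ _ _) (tensorHom_comp_tensorHom _ _ _ _).symm).trans ?_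
    refine (Category.assoc _ _ _).trans ?_
    refine (congrArg ((β.app (X 0) ⊗ₘ coactPowerApp β n fun i => X i.succ) ≫ ·) h1).trans ?_
    exact (Category.assoc _ _ _).symm

/-- The natural transformation `Fⁿ ⟶ Fⁿ ⊗ Aⁿ` induced by `β`. -/
def coactPower {F : D ⥤ C} {A : C} (β : F ⟶ F ⋙ tensorRight A) (n : ℕ) :
    tensorPower F n ⟶ tensorPower F n ⋙ tensorRight (objPower A n) where
  app X := coactPowerApp β n X
  naturality _ _ f := coactPowerApp_natural β n f

/-- The map `θₙ : Mor(Aⁿ, V) → Nat(Fⁿ, Fⁿ ⊗ V)`, `φ ↦ (id ⊗ φ) ∘ (Fⁿ ⟶ Fⁿ ⊗ Aⁿ)`. -/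
def theta {F : D ⥤ C} {A : C} (β : F ⟶ F ⋙ tensorRight A) (n : ℕ) (V : C)
    (φ : objPower A n ⟶ V) : tensorPower F n ⟶ tensorPower F n ⋙ tensorRight V :=
  coactPower β n ≫ Functor.whiskerLeft (tensorPower F n) ((curriedTensor C).flip.map φ)

/-- The representability condition for comodules: `(A, β)` is such that all the maps
`θₙ : Mor(Aⁿ, V) → Nat(Fⁿ, Fⁿ ⊗ V)` are bijections. -/
def IsRepresentable {F : D ⥤ C} {A : C} (β : F ⟶ F ⋙ tensorRight A) : Prop :=
  ∀ (n : ℕ) (V : C), Function.Bijective (theta β n V)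

/-- The Hopf algebra `H` in the braided category `C` (with the natural transformation
`β : F ⟶ F ⊗ H`) is the one reconstructed from the monoidal functor `F : D ⥤ C`:
the pair `(H, β)` satisfies the representability condition, and the structure maps of `H` are
the ones that correspond to the composite coactions under the bijections `θₙ`, that is,
every `β_X` is a coaction of the coalgebra `H`, and the coaction on a tensor product (on the unit)
is obtained from the product (the unit) of `H`. By the bijectivity of `θₙ`
these equations determine the bialgebra structure, and the antipode of a bialgebra is unique. -/
structure IsReconstruction [MonoidalCategory D] (F : D ⥤ C) [F.Monoidal] (H : Hopf C)
    (β : F ⟶ F ⋙ tensorRight H.X) : Prop where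
  representable : IsRepresentable β
  coact_comul (X : D) :
    β.app X ≫ β.app X ▷ H.X ≫ (α_ (F.obj X) H.X H.X).hom = β.app X ≫ F.obj X ◁ Δ[H.X]
  coact_counit (X : D) : β.app X ≫ F.obj X ◁ ε[H.X] = (ρ_ (F.obj X)).inv
  coact_mul (X Y : D) :
    Functor.LaxMonoidal.μ F X Y ≫ β.app (X ⊗ Y) =
      tensorCoact (β.app X) (β.app Y) ≫ Functor.LaxMonoidal.μ F X Y ▷ H.X
  coact_one :
    Functor.LaxMonoidal.ε F ≫ β.app (𝟙_ D) = unitCoact H.X ≫ Functor.LaxMonoidal.ε F ▷ H.X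

end Reconstruction

/-! ## Tautological coactions and the coend -/

section Tautological

variable {C : Type u} [Category.{v} C] [MonoidalCategory C]

/-- For `β_X : X ⟶ X ⊗ A` natural in the object `X` of `C` and a coalgebra `B` in `C`, the natural
transformation `X ⟶ X ⊗ B ⟶ (X ⊗ A) ⊗ B ≅ X ⊗ (A ⊗ B)` on comodules `X` of `B`. -/
def comoduleCoact {A : C} (β : 𝟭 C ⟶ 𝟭 C ⋙ tensorRight A) (B : C) [ComonObj B] :
    Comodule.forget B ⟶ Comodule.forget B ⋙ tensorRight (A ⊗ B) where
  app M := M.coact ≫ β.app M.X ▷ B ≫ (α_ M.X A B).hom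
  naturality M N f := by
    have h : f.hom ≫ β.app N.X = β.app M.X ≫ f.hom ▷ A := β.naturality f.hom
    change f.hom ≫ N.coact ≫ β.app N.X ▷ B ≫ (α_ N.X A B).hom =
      (M.coact ≫ β.app M.X ▷ B ≫ (α_ M.X A B).hom) ≫ f.hom ▷ (A ⊗ B)
    rw [← reassoc_of% f.comm, ← MonoidalCategory.comp_whiskerRight_assoc, h]
    simp

variable [RightRigidCategory C]

/-- The functor `X ↦ X*` on a rigid category. -/
@[simps]
def dualFunctor (C : Type u) [Category.{v} C] [MonoidalCategory C] [RightRigidCategory C] :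
    Cᵒᵖ ⥤ C where
  obj X := (X.unop)ᘁ
  map f := (f.unop)ᘁ
  map_id _ := rightAdjointMate_id
  map_comp _ _ := comp_rightAdjointMate

/-- The morphism `X* ⊗ X ⟶ X* ⊗ X ⊗ A ⟶ A` given by `b : X ⟶ X ⊗ A` and the evaluation. -/
def matrixCoeff {A X : C} (b : X ⟶ X ⊗ A) : Xᘁ ⊗ X ⟶ A :=
  Xᘁ ◁ b ≫ (α_ (Xᘁ) X A).inv ≫ ε_ X (Xᘁ) ▷ A ≫ (λ_ A).hom

theorem matrixCoeff_dinatural {A X Y : C} {b : X ⟶ X ⊗ A} {b' : Y ⟶ Y ⊗ A} {f : X ⟶ Y}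
    (h : f ≫ b' = b ≫ f ▷ A) : fᘁ ▷ X ≫ matrixCoeff b = Yᘁ ◁ f ≫ matrixCoeff b' := by
  have h1 := rightAdjointMate_comp_evaluation f
  rw [matrixCoeff, matrixCoeff, ← MonoidalCategory.whiskerLeft_comp_assoc, h,
    ← whisker_exchange_assoc, associator_inv_naturality_left_assoc,
    ← MonoidalCategory.comp_whiskerRight_assoc, h1]
  simp

/-- The cowedge `X* ⊗ X ⟶ A` of matrix coefficients of the coactions `β_X : X ⟶ X ⊗ A`. -/
def tautologicalCowedge {A : C} (β : 𝟭 C ⟶ 𝟭 C ⋙ tensorRight A) :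
    Cowedge (dualFunctor C ⋙ curriedTensor C) :=
  Cowedge.mk A (fun X => matrixCoeff (β.app X))
    (fun _ _ f => matrixCoeff_dinatural (β.naturality f))

end Tautological

/-! ## Adjoint (co)actions, cross products and cross coproducts -/

section Cross

variable {C : Type u} [Category.{v} C] [MonoidalCategory C] [BraidedCategory C]

/-- The braided right adjoint coaction `H ⟶ H ⊗ H`, `h ↦ h₂ ⊗ S(h₁) h₃`, where `S(h₁)` is taken
past `h₂` with the braiding. -/
def adjointCoaction (H : C) [HopfObj H] : H ⟶ H ⊗ H :=
  Δ[H] ≫ 𝒮[H] ▷ H ≫ H ◁ Δ[H] ≫ (α_ H H H).inv ≫ (β_ H H).hom ▷ H ≫ (α_ H H H).hom ≫ H ◁ μ[H]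

/-- The braided left adjoint action `H ⊗ H ⟶ H`, `h ⊗ g ↦ h₁ g S(h₂)`, where `h₂` is taken past
`g` with the braiding. -/
def adjointAction (H : C) [HopfObj H] : H ⊗ H ⟶ H :=
  Δ[H] ▷ H ≫ (α_ H H H).hom ≫ H ◁ (β_ H H).hom ≫ H ◁ H ◁ 𝒮[H] ≫ H ◁ μ[H] ≫ μ[H]

/-- The braided tensor product algebra structure maps on `A ⊗ B`. -/
def braidedTensorMul (A B : C) [MonObj A] [MonObj B] : (A ⊗ B) ⊗ (A ⊗ B) ⟶ A ⊗ B :=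
  tensorμ A B A B ≫ (μ[A] ⊗ₘ μ[B])

/-- The unit `η ⊗ η` on `A ⊗ B`. -/
def tensorOne (A B : C) [MonObj A] [MonObj B] : 𝟙_ C ⟶ A ⊗ B :=
  (λ_ (𝟙_ C)).inv ≫ (η[A] ⊗ₘ η[B])

/-- The braided tensor product coalgebra structure on `A ⊗ B`. -/
def braidedTensorComul (A B : C) [ComonObj A] [ComonObj B] : A ⊗ B ⟶ (A ⊗ B) ⊗ (A ⊗ B) :=
  (Δ[A] ⊗ₘ Δ[B]) ≫ tensorμ A A B B

/-- The counit `ε ⊗ ε` on `A ⊗ B`. -/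
def tensorCounit (A B : C) [ComonObj A] [ComonObj B] : A ⊗ B ⟶ 𝟙_ C :=
  (ε[A] ⊗ₘ ε[B]) ≫ (λ_ (𝟙_ C)).hom

/-- The cross coproduct by a right coaction `r` of `A` on `B`:
`a ⊗ b ↦ a₁ ⊗ (b₁)⁽⁰⁾ ⊗ a₂ (b₁)⁽¹⁾ ⊗ b₂`, where `a₂` is taken past `(b₁)⁽⁰⁾` with the braiding. -/
def crossComul (A B : C) [MonObj A] [ComonObj A] [ComonObj B] (r : B ⟶ B ⊗ A) :
    A ⊗ B ⟶ (A ⊗ B) ⊗ (A ⊗ B) :=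
  (Δ[A] ⊗ₘ (Δ[B] ≫ r ▷ B ≫ (α_ B A B).hom)) ≫ tensorμ A A B (A ⊗ B) ≫
    (A ⊗ B) ◁ ((α_ A A B).inv ≫ μ[A] ▷ B)

/-- The cross product by a left action `l` of `B` on `A`:
`(a ⊗ b) ⊗ (c ⊗ d) ↦ a (b₁ ▹ c) ⊗ b₂ d`, where `b₂` is taken past `c` with the braiding. -/
def crossMul (A B : C) [MonObj A] [MonObj B] [ComonObj B] (l : B ⊗ A ⟶ A) :
    (A ⊗ B) ⊗ (A ⊗ B) ⟶ A ⊗ B :=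
  (A ◁ Δ[B] ≫ (α_ A B B).inv) ▷ (A ⊗ B) ≫ tensorμ (A ⊗ B) B A B ≫
    (((α_ A B A).hom ≫ A ◁ l ≫ μ[A]) ⊗ₘ μ[B])

/-- The Hopf algebra structure `h` on `A ⊗ B` is the cross coproduct by the right coaction `r` of
`A` on `B`, with the braided tensor product algebra. -/
structure IsCrossCoproduct {A B : C} [HopfObj A] [HopfObj B] (r : B ⟶ B ⊗ A)
    (h : HopfObj (A ⊗ B)) : Prop where
  mul : h.mul = braidedTensorMul A B
  one : h.one = tensorOne A B
  comul : h.comul = crossComul A B r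
  counit : h.counit = tensorCounit A B

/-- The Hopf algebra structure `h` on `A ⊗ B` is the cross product by the left action `l` of
`B` on `A`, with the braided tensor product coalgebra. -/
structure IsCrossProduct {A B : C} [HopfObj A] [HopfObj B] (l : B ⊗ A ⟶ A)
    (h : HopfObj (A ⊗ B)) : Prop where
  mul : h.mul = crossMul A B l
  one : h.one = tensorOne A B
  comul : h.comul = braidedTensorComul A B
  counit : h.counit = tensorCounit A B

end Cross

end BraidedReconstruction

/-!
Everything is read off from the naturality of `β`. A morphism out of `Aⁿ` is the same as a natural
family `⨂ᵢ F Xᵢ ⟶ (⨂ᵢ F Xᵢ) ⊗ V`, so structure maps on `A` are defined, and their axioms checked,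
on natural families (`IsCompatible`, `IsCompatible.bimonObj`). Applying `β` twice gives the
coproduct, and `β` of a tensor product gives the product. For an antipode it is enough that each
`β_X` is invertible for the composition `kleisli` of morphisms `X ⟶ Y ⊗ A` that multiplies the
coefficients, because pointwise inverses of a natural family are again natural
(`IsCompatible.exists_hopfObj`). For the identity functor of a rigid category the inverse of `β_X`
is the transpose of the coaction of the dual of `X`: evaluation and coevaluation are morphisms of
`C`, so `β` is natural with respect to them (`kleisli_transpose_left`, `kleisli_transpose_right`).
The coend property is the case `n = 1` of representability, transposed along the duality.

Naturality of `β` with respect to its own components `β_X : X ⟶ X ⊗ A` says that `β_{X ⊗ A}` after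
`β_X` is `β_X` followed by the coproduct; cancelling the first tensor factor with the antipode shows
that `β_A` is the adjoint coaction (`IsCompatible.taut_self`).

For the forgetful functor of `A`-comodules, the cofree comodules reduce natural families to natural
families `⨂ᵢ Xᵢ ⊗ Aⁿ ⟶ ⨂ᵢ Xᵢ ⊗ V` over `C`, and duality moves `Aⁿ` to the other side, where
representability of `β` for the object `V ⊗ (Aⁿ)*` applies (`IsRepresentable.comoduleCoact`). The
structure maps on `A ⊗ A` are then found as before. In the coproduct, a coaction of `A` on a
comodule `M` has to be moved past `β_M`; by naturality this costs one copy of `β_A`, the adjoint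
coaction (`iter_comoduleCoact`). The antipode exists because both `β_M` and the coaction of `M` are
invertible for `kleisli`.

The isomorphism with the cross product is `a ⊗ b ↦ a b₁ ⊗ b₂`, with inverse `a ⊗ b ↦ a S(b₁) ⊗ b₂`
(`mulComulIso`). That it respects products and coproducts comes down to `(b₁ ▹ c) b₂ = b c` and its
dual, with the appropriate braidings (`adjointAction_mul`, `comul_adjointCoaction`). The Hopf
algebra axioms of the cross product need no separate proof: they are transported from the cross
coproduct (`hopfObjOfIso`).
-/

namespace BraidedReconstruction
universe v v' u u'

/-! ### Iterates and tensor products of coactions -/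

section Calculus

variable {C : Type u} [Category.{v} C] [MonoidalCategory C]

/-- The composite of two coaction-like morphisms: `s` is applied first, then `r`, and the new factor
`P` is placed directly to the right of `X`. -/
def iter {X P Q : C} (r : X ⟶ X ⊗ P) (s : X ⟶ X ⊗ Q) : X ⟶ X ⊗ (P ⊗ Q) :=
  s ≫ r ▷ Q ≫ (α_ X P Q).hom

theorem tensorHom_comp_whiskerLeft {X T P P' V : C} (f : X ⟶ T) (p : P ⟶ P') (φ : P' ⟶ V) :
    (f ⊗ₘ p) ≫ T ◁ φ = X ◁ (p ≫ φ) ≫ f ▷ V := by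
  rw [MonoidalCategory.tensorHom_def', Category.assoc, ← whisker_exchange,
    MonoidalCategory.whiskerLeft_comp_assoc]

theorem tensorHom_comp_whiskerLeft_assoc {X T P P' V Z : C} (f : X ⟶ T) (p : P ⟶ P')
    (φ : P' ⟶ V) (h : T ⊗ V ⟶ Z) :
    (f ⊗ₘ p) ≫ T ◁ φ ≫ h = X ◁ (p ≫ φ) ≫ f ▷ V ≫ h := by
  rw [← Category.assoc, tensorHom_comp_whiskerLeft, Category.assoc]

theorem iter_whiskerLeft {X P Q P' Q' : C} (r : X ⟶ X ⊗ P) (s : X ⟶ X ⊗ Q) (f : P ⟶ P')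
    (g : Q ⟶ Q') : iter (r ≫ X ◁ f) (s ≫ X ◁ g) = iter r s ≫ X ◁ (f ⊗ₘ g) := by
  simp only [iter, Category.assoc, MonoidalCategory.comp_whiskerRight]
  rw [whisker_exchange_assoc, whisker_exchange_assoc, MonoidalCategory.tensorHom_def,
    MonoidalCategory.whiskerLeft_comp]
  simp

theorem iter_whiskerLeft_left {X P Q P' : C} (r : X ⟶ X ⊗ P) (s : X ⟶ X ⊗ Q) (f : P ⟶ P') :
    iter (r ≫ X ◁ f) s = iter r s ≫ X ◁ f ▷ Q := by
  simpa using iter_whiskerLeft r s f (𝟙 Q)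

theorem iter_whiskerLeft_right {X P Q Q' : C} (r : X ⟶ X ⊗ P) (s : X ⟶ X ⊗ Q) (g : Q ⟶ Q') :
    iter r (s ≫ X ◁ g) = iter r s ≫ X ◁ P ◁ g := by
  simpa using iter_whiskerLeft r s (𝟙 P) g

theorem iter_assoc {X P Q R : C} (r : X ⟶ X ⊗ P) (s : X ⟶ X ⊗ Q) (t : X ⟶ X ⊗ R) :
    iter (iter r s) t ≫ X ◁ (α_ P Q R).hom = iter r (iter s t) := by
  simp [iter]

theorem iter_rightUnitor_inv_left {X Q : C} (s : X ⟶ X ⊗ Q) :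
    iter (ρ_ X).inv s = s ≫ X ◁ (λ_ Q).inv := by
  simp [iter]

theorem iter_rightUnitor_inv_right {X P : C} (r : X ⟶ X ⊗ P) :
    iter r (ρ_ X).inv = r ≫ X ◁ (ρ_ P).inv := by
  simp [iter]

theorem iter_natural {X Y P Q : C} {r : X ⟶ X ⊗ P} {s : X ⟶ X ⊗ Q} {r' : Y ⟶ Y ⊗ P}
    {s' : Y ⟶ Y ⊗ Q} {f : X ⟶ Y} (hr : f ≫ r' = r ≫ f ▷ P) (hs : f ≫ s' = s ≫ f ▷ Q) :
    f ≫ iter r' s' = iter r s ≫ f ▷ (P ⊗ Q) := by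
  simp only [iter, Category.assoc]
  rw [reassoc_of% hs, ← MonoidalCategory.comp_whiskerRight_assoc, hr]
  simp

variable [BraidedCategory C]

/-- Two coaction-like morphisms side by side, with `P` moved past `Y` by the braiding. -/
def tens {X Y P Q : C} (r : X ⟶ X ⊗ P) (s : Y ⟶ Y ⊗ Q) : X ⊗ Y ⟶ (X ⊗ Y) ⊗ (P ⊗ Q) :=
  (r ⊗ₘ s) ≫ tensorμ X P Y Q

theorem tensorCoact_eq_tens {B X Y : C} [MonObj B] (r : X ⟶ X ⊗ B) (s : Y ⟶ Y ⊗ B) :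
    tensorCoact r s = tens r s ≫ (X ⊗ Y) ◁ μ[B] := by
  simp [tensorCoact, tens]

theorem tens_natural {X Y X' Y' P Q P' Q' : C} {r : X ⟶ X ⊗ P} {s : Y ⟶ Y ⊗ Q}
    {r' : X' ⟶ X' ⊗ P'} {s' : Y' ⟶ Y' ⊗ Q'} {f : X ⟶ X'} {g : Y ⟶ Y'} {a : P ⟶ P'} {b : Q ⟶ Q'}
    (hr : f ≫ r' = r ≫ (f ⊗ₘ a)) (hs : g ≫ s' = s ≫ (g ⊗ₘ b)) :
    (f ⊗ₘ g) ≫ tens r' s' = tens r s ≫ ((f ⊗ₘ g) ⊗ₘ (a ⊗ₘ b)) := by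
  simp only [tens, Category.assoc]
  rw [← tensorμ_natural, tensorHom_comp_tensorHom_assoc, tensorHom_comp_tensorHom_assoc, hr, hs]

theorem tens_whiskerLeft {X Y P Q P' Q' : C} (r : X ⟶ X ⊗ P) (s : Y ⟶ Y ⊗ Q) (f : P ⟶ P')
    (g : Q ⟶ Q') : tens (r ≫ X ◁ f) (s ≫ Y ◁ g) = tens r s ≫ (X ⊗ Y) ◁ (f ⊗ₘ g) := by
  have := tens_natural (r := r) (s := s) (r' := r ≫ X ◁ f) (s' := s ≫ Y ◁ g) (f := 𝟙 X) (g := 𝟙 Y)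
    (a := f) (b := g) (by simp) (by simp)
  simpa using this

/-- Iterating commutes with the tensor product, up to the braided interchange of the
coefficients. -/
theorem tens_iter {X Y P Q P' Q' : C} (r : X ⟶ X ⊗ P) (r' : X ⟶ X ⊗ P') (s : Y ⟶ Y ⊗ Q)
    (s' : Y ⟶ Y ⊗ Q') :
    tens (iter r r') (iter s s') ≫ (X ⊗ Y) ◁ tensorμ P P' Q Q' =
      iter (tens r s) (tens r' s') := by
  have h := associator_monoidal X P P' Y Q Q'
  have h4 := tensorμ_whiskerRight (Z := P') (W := Q') r s
  simp only [tens, iter, Category.assoc, MonoidalCategory.comp_whiskerRight]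
  rw [← reassoc_of% h4, h, ← Category.assoc r', ← Category.assoc s',
    ← tensorHom_comp_tensorHom_assoc, ← tensorHom_comp_tensorHom_assoc]

theorem tens_assoc {X Y Z P Q R : C} (r : X ⟶ X ⊗ P) (s : Y ⟶ Y ⊗ Q) (t : Z ⟶ Z ⊗ R) :
    tens (tens r s) t ≫ ((α_ X Y Z).hom ⊗ₘ (α_ P Q R).hom) =
      (α_ X Y Z).hom ≫ tens r (tens s t) := by
  have h := tensor_associativity X P Y Q Z R
  have e1 : (tens r s ⊗ₘ t) = ((r ⊗ₘ s) ⊗ₘ t) ≫ (tensorμ X P Y Q ▷ (Z ⊗ R)) := by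
    rw [tens, ← tensorHom_id (tensorμ X P Y Q), tensorHom_comp_tensorHom]
    simp
  have e2 : (r ⊗ₘ tens s t) = (r ⊗ₘ (s ⊗ₘ t)) ≫ ((X ⊗ P) ◁ tensorμ Y Q Z R) := by
    rw [tens, ← id_tensorHom _ (tensorμ Y Q Z R), tensorHom_comp_tensorHom]
    simp
  rw [tens.eq_def (tens r s), tens.eq_def r (tens s t), e1, e2]
  simp only [Category.assoc]
  rw [h, ← associator_naturality_assoc]

/-- The trivial coaction-like morphism of the unit object is a right unit for `tens`. -/
theorem tens_unit_right {X P : C} (r : X ⟶ X ⊗ P) :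
    tens r (λ_ (𝟙_ C)).inv = (ρ_ X).hom ≫ r ≫ ((ρ_ X).inv ⊗ₘ (ρ_ P).inv) := by
  have h := tensor_right_unitality X P
  rw [tens, MonoidalCategory.tensorHom_def, Category.assoc,
    ← cancel_mono ((ρ_ X).hom ⊗ₘ (ρ_ P).hom)]
  simp only [Category.assoc]
  rw [← h]
  simp

theorem tens_unit_left {X P : C} (r : X ⟶ X ⊗ P) :
    tens (λ_ (𝟙_ C)).inv r = (λ_ X).hom ≫ r ≫ ((λ_ X).inv ⊗ₘ (λ_ P).inv) := by
  have h := tensor_left_unitality X P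
  rw [tens, MonoidalCategory.tensorHom_def', Category.assoc,
    ← cancel_mono ((λ_ X).hom ⊗ₘ (λ_ P).hom)]
  simp only [Category.assoc]
  rw [← h]
  simp

end Calculus

/-! ### The representability condition for small powers -/

section Representability

variable {C : Type u} [Category.{v} C] [MonoidalCategory C]

/-- The one-fold tensor product is the object itself. -/
def tensorFamilyOne (X : Fin 1 → C) : tensorFamily 1 X ≅ X 0 := ρ_ (X 0)

/-- The two-fold tensor product without the trailing unit object. -/
def tensorFamilyTwo (X : Fin 2 → C) : tensorFamily 2 X ≅ X 0 ⊗ X 1 :=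
  whiskerLeftIso (X 0) (tensorFamilyOne (fun i => X i.succ))

/-- The three-fold tensor product without the trailing unit object. -/
def tensorFamilyThree (X : Fin 3 → C) : tensorFamily 3 X ≅ X 0 ⊗ (X 1 ⊗ X 2) :=
  whiskerLeftIso (X 0) (tensorFamilyTwo (fun i => X i.succ))

theorem tensorFamilyMap_one {X Y : Fin 1 → C} (f : ∀ i, X i ⟶ Y i) :
    tensorFamilyMap 1 f = (tensorFamilyOne X).hom ≫ f 0 ≫ (tensorFamilyOne Y).inv := by
  change f 0 ⊗ₘ 𝟙 (𝟙_ C) = (ρ_ (X 0)).hom ≫ f 0 ≫ (ρ_ (Y 0)).inv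
  simp

theorem tensorFamilyMap_two {X Y : Fin 2 → C} (f : ∀ i, X i ⟶ Y i) :
    tensorFamilyMap 2 f =
      (tensorFamilyTwo X).hom ≫ (f 0 ⊗ₘ f 1) ≫ (tensorFamilyTwo Y).inv := by
  have h := tensorFamilyMap_one (fun i : Fin 1 => f i.succ)
  change f 0 ⊗ₘ tensorFamilyMap 1 (fun i : Fin 1 => f i.succ) =
    X 0 ◁ (tensorFamilyOne (fun i : Fin 1 => X i.succ)).hom ≫ (f 0 ⊗ₘ f 1) ≫
      Y 0 ◁ (tensorFamilyOne (fun i : Fin 1 => Y i.succ)).inv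
  rw [h, ← id_tensorHom, ← id_tensorHom, tensorHom_comp_tensorHom, tensorHom_comp_tensorHom,
    Category.id_comp, Category.comp_id]
  rfl

/-- Compare `theta` on the iterated tensor product, which has a trailing unit object, with its
analogue on the isomorphic object `X`. -/
theorem conj_whiskerLeft {T X P' P V : C} (e : T ≅ X) (p : P' ≅ P) (r : X ⟶ X ⊗ P) (φ : P ⟶ V) :
    (e.hom ≫ r ≫ (e.inv ⊗ₘ p.inv)) ≫ T ◁ (p.hom ≫ φ) = e.hom ≫ (r ≫ X ◁ φ) ≫ e.inv ▷ V := by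
  simp only [Category.assoc]
  rw [← id_tensorHom, tensorHom_comp_tensorHom, Category.comp_id, Iso.inv_hom_id_assoc,
    MonoidalCategory.tensorHom_def']

theorem conj_cancel {T X V : C} (e : T ≅ X) {f g : X ⟶ X ⊗ V}
    (h : e.hom ≫ f ≫ e.inv ▷ V = e.hom ≫ g ≫ e.inv ▷ V) : f = g :=
  (cancel_mono (whiskerRightIso e.symm V).hom).1 ((cancel_epi e.hom).1 h)

theorem conj_natural {T X T' X' V : C} (e : T ≅ X) (e' : T' ≅ X') {f : X ⟶ X'} {a : X ⟶ X ⊗ V}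
    {a' : X' ⟶ X' ⊗ V} (h : f ≫ a' = a ≫ f ▷ V) :
    (e.hom ≫ f ≫ e'.inv) ≫ e'.hom ≫ a' ≫ e'.inv ▷ V =
      (e.hom ≫ a ≫ e.inv ▷ V) ≫ (e.hom ≫ f ≫ e'.inv) ▷ V := by
  simp [reassoc_of% h]

/-- The power `A¹` is `A`. -/
def objPowerOne (A : C) : objPower A 1 ≅ A := tensorFamilyOne fun _ => A

/-- The power `A²` is `A ⊗ A`. -/
def objPowerTwo (A : C) : objPower A 2 ≅ A ⊗ A := tensorFamilyTwo fun _ => A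

/-- The power `A³` is `A ⊗ (A ⊗ A)`. -/
def objPowerThree (A : C) : objPower A 3 ≅ A ⊗ (A ⊗ A) := tensorFamilyThree fun _ => A

variable {D : Type u'} [Category.{v'} D] {F : D ⥤ C} {H : C}

/-- The component `F X ⟶ F X ⊗ H` of a natural transformation `F ⟶ F ⊗ H`. -/
def coactAt (β : F ⟶ F ⋙ tensorRight H) (X : D) : F.obj X ⟶ F.obj X ⊗ H := β.app X

theorem coactAt_natural (β : F ⟶ F ⋙ tensorRight H) {X Y : D} (f : X ⟶ Y) :
    F.map f ≫ coactAt β Y = coactAt β X ≫ F.map f ▷ H := β.naturality f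

variable [BraidedCategory C] {β : F ⟶ F ⋙ tensorRight H}

theorem coactPowerApp_one (X : Fin 1 → D) :
    coactPowerApp β 1 X = (tensorFamilyOne fun i => F.obj (X i)).hom ≫ coactAt β (X 0) ≫
      ((tensorFamilyOne fun i => F.obj (X i)).inv ⊗ₘ (objPowerOne H).inv) :=
  tens_unit_right (coactAt β (X 0))

theorem coactPowerApp_two (X : Fin 2 → D) :
    coactPowerApp β 2 X = (tensorFamilyTwo fun i => F.obj (X i)).hom ≫
      tens (coactAt β (X 0)) (coactAt β (X 1)) ≫
      ((tensorFamilyTwo fun i => F.obj (X i)).inv ⊗ₘ (objPowerTwo H).inv) := by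
  rw [← Iso.inv_comp_eq]
  have h := tens_natural (r := coactAt β (X 0)) (s := coactAt β (X 1)) (r' := coactAt β (X 0))
    (s' := coactPowerApp β 1 (fun i => X i.succ)) (f := 𝟙 _)
    (g := (tensorFamilyOne (fun i : Fin 1 => F.obj (X i.succ))).inv)
    (a := 𝟙 _) (b := (objPowerOne H).inv) (by simp)
    (by rw [coactPowerApp_one]; exact Iso.inv_hom_id_assoc _ _)
  rw [id_tensorHom, id_tensorHom] at h
  exact h

theorem coactPowerApp_three (X : Fin 3 → D) :
    coactPowerApp β 3 X = (tensorFamilyThree fun i => F.obj (X i)).hom ≫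
      tens (coactAt β (X 0)) (tens (coactAt β (X 1)) (coactAt β (X 2))) ≫
      ((tensorFamilyThree fun i => F.obj (X i)).inv ⊗ₘ (objPowerThree H).inv) := by
  rw [← Iso.inv_comp_eq]
  have h := tens_natural (r := coactAt β (X 0)) (s := tens (coactAt β (X 1)) (coactAt β (X 2)))
    (r' := coactAt β (X 0)) (s' := coactPowerApp β 2 (fun i => X i.succ)) (f := 𝟙 _)
    (g := (tensorFamilyTwo (fun i : Fin 2 => F.obj (X i.succ))).inv)
    (a := 𝟙 _) (b := (objPowerTwo H).inv) (by simp)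
    (by rw [coactPowerApp_two]; exact Iso.inv_hom_id_assoc _ _)
  rw [id_tensorHom, id_tensorHom] at h
  exact h

theorem theta_app (n : ℕ) {V : C} (φ : objPower H n ⟶ V) (X : Fin n → D) :
    (theta β n V φ).app X = coactPowerApp β n X ≫ tensorFamily n (fun i => F.obj (X i)) ◁ φ := rfl

theorem theta_one_app {V : C} (φ : H ⟶ V) (X : Fin 1 → D) :
    (theta β 1 V ((objPowerOne H).hom ≫ φ)).app X =
      (tensorFamilyOne fun i => F.obj (X i)).hom ≫ (coactAt β (X 0) ≫ F.obj (X 0) ◁ φ) ≫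
        (tensorFamilyOne fun i => F.obj (X i)).inv ▷ V := by
  rw [theta_app, coactPowerApp_one]
  exact conj_whiskerLeft _ _ _ _

theorem theta_two_app {V : C} (φ : H ⊗ H ⟶ V) (X : Fin 2 → D) :
    (theta β 2 V ((objPowerTwo H).hom ≫ φ)).app X =
      (tensorFamilyTwo fun i => F.obj (X i)).hom ≫ (tens (coactAt β (X 0)) (coactAt β (X 1)) ≫
        (F.obj (X 0) ⊗ F.obj (X 1)) ◁ φ) ≫ (tensorFamilyTwo fun i => F.obj (X i)).inv ▷ V := by
  rw [theta_app, coactPowerApp_two]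
  exact conj_whiskerLeft _ _ _ _

theorem theta_three_app {V : C} (φ : H ⊗ (H ⊗ H) ⟶ V) (X : Fin 3 → D) :
    (theta β 3 V ((objPowerThree H).hom ≫ φ)).app X =
      (tensorFamilyThree fun i => F.obj (X i)).hom ≫
        (tens (coactAt β (X 0)) (tens (coactAt β (X 1)) (coactAt β (X 2))) ≫
          (F.obj (X 0) ⊗ (F.obj (X 1) ⊗ F.obj (X 2))) ◁ φ) ≫
            (tensorFamilyThree fun i => F.obj (X i)).inv ▷ V := by
  rw [theta_app, coactPowerApp_three]
  exact conj_whiskerLeft _ _ _ _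

namespace IsRepresentable

/-- A morphism out of `H` is determined by its composites with the `β_X`. -/
theorem hom_ext (hβ : IsRepresentable β) {V : C} {φ ψ : H ⟶ V}
    (h : ∀ X, coactAt β X ≫ F.obj X ◁ φ = coactAt β X ≫ F.obj X ◁ ψ) : φ = ψ := by
  refine (cancel_epi (objPowerOne H).hom).1 ((hβ 1 V).1 ?_)
  ext X
  rw [theta_one_app, theta_one_app, h]

theorem hom_ext₂ (hβ : IsRepresentable β) {V : C} {φ ψ : H ⊗ H ⟶ V}
    (h : ∀ X Y, tens (coactAt β X) (coactAt β Y) ≫ (F.obj X ⊗ F.obj Y) ◁ φ =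
      tens (coactAt β X) (coactAt β Y) ≫ (F.obj X ⊗ F.obj Y) ◁ ψ) : φ = ψ := by
  refine (cancel_epi (objPowerTwo H).hom).1 ((hβ 2 V).1 ?_)
  ext X
  rw [theta_two_app, theta_two_app, h]

theorem hom_ext₃ (hβ : IsRepresentable β) {V : C} {φ ψ : H ⊗ (H ⊗ H) ⟶ V}
    (h : ∀ X Y Z, tens (coactAt β X) (tens (coactAt β Y) (coactAt β Z)) ≫
        (F.obj X ⊗ (F.obj Y ⊗ F.obj Z)) ◁ φ =
      tens (coactAt β X) (tens (coactAt β Y) (coactAt β Z)) ≫ (F.obj X ⊗ (F.obj Y ⊗ F.obj Z)) ◁ ψ) :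
    φ = ψ := by
  refine (cancel_epi (objPowerThree H).hom).1 ((hβ 3 V).1 ?_)
  ext X
  rw [theta_three_app, theta_three_app, h]

/-- Every natural family `F X ⟶ F X ⊗ V` comes from a morphism `H ⟶ V`. -/
theorem exists_hom (hβ : IsRepresentable β) {V : C} (τ : ∀ X, F.obj X ⟶ F.obj X ⊗ V)
    (hτ : ∀ {X Y : D} (f : X ⟶ Y), F.map f ≫ τ Y = τ X ≫ F.map f ▷ V) :
    ∃ φ : H ⟶ V, ∀ X, coactAt β X ≫ F.obj X ◁ φ = τ X := by
  obtain ⟨φ, hφ⟩ := (hβ 1 V).2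
    { app := fun X => (tensorFamilyOne (fun i => F.obj (X i))).hom ≫ τ (X 0) ≫
        (tensorFamilyOne (fun i => F.obj (X i))).inv ▷ V
      naturality := fun X Y f => by
        change tensorFamilyMap 1 (fun i => F.map (f i)) ≫ _ =
          _ ≫ tensorFamilyMap 1 (fun i => F.map (f i)) ▷ V
        rw [tensorFamilyMap_one]
        exact conj_natural _ _ (hτ (f 0)) }
  refine ⟨(objPowerOne H).inv ≫ φ, fun X => ?_⟩
  have h := congrArg (fun t => NatTrans.app t (fun _ => X)) hφ
  rw [← Iso.hom_inv_id_assoc (objPowerOne H) φ] at h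
  exact conj_cancel _ ((theta_one_app _ _).symm.trans h)

/-- Every natural family `F X ⊗ F Y ⟶ (F X ⊗ F Y) ⊗ V` comes from a morphism `H ⊗ H ⟶ V`. -/
theorem exists_hom₂ (hβ : IsRepresentable β) {V : C}
    (τ : ∀ X Y, F.obj X ⊗ F.obj Y ⟶ (F.obj X ⊗ F.obj Y) ⊗ V)
    (hτ : ∀ {X Y X' Y' : D} (f : X ⟶ X') (g : Y ⟶ Y'), (F.map f ⊗ₘ F.map g) ≫ τ X' Y' =
      τ X Y ≫ (F.map f ⊗ₘ F.map g) ▷ V) :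
    ∃ φ : H ⊗ H ⟶ V, ∀ X Y, tens (coactAt β X) (coactAt β Y) ≫ (F.obj X ⊗ F.obj Y) ◁ φ = τ X Y := by
  obtain ⟨φ, hφ⟩ := (hβ 2 V).2
    { app := fun X => (tensorFamilyTwo (fun i => F.obj (X i))).hom ≫ τ (X 0) (X 1) ≫
        (tensorFamilyTwo (fun i => F.obj (X i))).inv ▷ V
      naturality := fun X Y f => by
        change tensorFamilyMap 2 (fun i => F.map (f i)) ≫ _ =
          _ ≫ tensorFamilyMap 2 (fun i => F.map (f i)) ▷ V
        rw [tensorFamilyMap_two]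
        exact conj_natural _ _ (hτ (f 0) (f 1)) }
  refine ⟨(objPowerTwo H).inv ≫ φ, fun X Y => ?_⟩
  have h := congrArg (fun t => NatTrans.app t (![X, Y])) hφ
  rw [← Iso.hom_inv_id_assoc (objPowerTwo H) φ] at h
  exact conj_cancel _ ((theta_two_app _ _).symm.trans h)

end IsRepresentable
end Representability

/-! ### The bialgebra structure on a representing object -/

section Bialgebra

variable {C : Type u} [Category.{v} C] [MonoidalCategory C] [BraidedCategory C]
variable {D : Type u'} [Category.{v'} D] [MonoidalCategory D] {F : D ⥤ C} [F.Monoidal] {H : C}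
  {β : F ⟶ F ⋙ tensorRight H}

theorem tens_mul_natural {X Y X' Y' : C} {r : X ⟶ X ⊗ H} {s : Y ⟶ Y ⊗ H}
    {r' : X' ⟶ X' ⊗ H} {s' : Y' ⟶ Y' ⊗ H} {f : X ⟶ X'} {g : Y ⟶ Y'}
    (hr : f ≫ r' = r ≫ f ▷ H) (hs : g ≫ s' = s ≫ g ▷ H) (m : H ⊗ H ⟶ H) :
    (f ⊗ₘ g) ≫ (tens r' s' ≫ (X' ⊗ Y') ◁ m) = (tens r s ≫ (X ⊗ Y) ◁ m) ≫ (f ⊗ₘ g) ▷ H := by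
  rw [← Category.assoc, tens_natural (r := r) (s := s) (a := 𝟙 _) (b := 𝟙 _) (by simpa using hr)
    (by simpa using hs)]
  rw [id_tensorHom_id, tensorHom_id, Category.assoc, Category.assoc, whisker_exchange]

/-- Structure maps on `H` that are compatible with `β` in the way required of a reconstructed
bialgebra; no axioms are imposed on the structure maps themselves. -/
structure IsCompatible (β : F ⟶ F ⋙ tensorRight H) (m : H ⊗ H ⟶ H) (u : 𝟙_ C ⟶ H)
    (d : H ⟶ H ⊗ H) (e : H ⟶ 𝟙_ C) : Prop where
  comul (X : D) : iter (coactAt β X) (coactAt β X) = coactAt β X ≫ F.obj X ◁ d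
  counit (X : D) : coactAt β X ≫ F.obj X ◁ e = (ρ_ (F.obj X)).inv
  mul (X Y : D) : Functor.LaxMonoidal.μ F X Y ≫ coactAt β (X ⊗ Y) =
    (tens (coactAt β X) (coactAt β Y) ≫ (F.obj X ⊗ F.obj Y) ◁ m) ≫ Functor.LaxMonoidal.μ F X Y ▷ H
  one : Functor.LaxMonoidal.ε F ≫ coactAt β (𝟙_ D) =
    ((λ_ (𝟙_ C)).inv ≫ 𝟙_ C ◁ u) ≫ Functor.LaxMonoidal.ε F ▷ H

namespace IsCompatible

variable {m : H ⊗ H ⟶ H} {u : 𝟙_ C ⟶ H} {d : H ⟶ H ⊗ H} {e : H ⟶ 𝟙_ C}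

/-- Both sides represent `β` on a threefold tensor product, and `β` is natural with respect to the
associator. -/
theorem mul_assoc (hβ : IsRepresentable β) (h : IsCompatible β m u d e) :
    m ▷ H ≫ m = (α_ H H H).hom ≫ H ◁ m ≫ m := by
  rw [← cancel_epi (α_ H H H).inv, Iso.inv_hom_id_assoc]
  refine hβ.hom_ext₃ fun X Y Z => ?_
  have e1 := tens_mul_natural (h.mul X Y) (f := Functor.LaxMonoidal.μ F X Y) (g := 𝟙 (F.obj Z))
    (s := coactAt β Z) (s' := coactAt β Z) (by simp) m
  have e2 := tens_mul_natural (f := 𝟙 (F.obj X)) (r := coactAt β X) (r' := coactAt β X) (by simp)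
    (h.mul Y Z) (g := Functor.LaxMonoidal.μ F Y Z) m
  have h1 := h.mul (X ⊗ Y) Z
  have h2 := h.mul X (Y ⊗ Z)
  have ha := Functor.LaxMonoidal.associativity F X Y Z
  have hn := coactAt_natural β (α_ X Y Z).hom
  rw [tensorHom_id] at e1
  rw [id_tensorHom] at e2
  have k1 := Functor.LaxMonoidal.μ F X Y ▷ F.obj Z ≫= h1
  have k2 := F.obj X ◁ Functor.LaxMonoidal.μ F Y Z ≫= h2
  simp only [Category.assoc] at e1 e2
  rw [Category.assoc, reassoc_of% e1] at k1
  rw [Category.assoc, reassoc_of% e2] at k2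
  have k3 : (tens (tens (coactAt β X) (coactAt β Y) ≫ (F.obj X ⊗ F.obj Y) ◁ m) (coactAt β Z) ≫
      ((F.obj X ⊗ F.obj Y) ⊗ F.obj Z) ◁ m) ≫ (α_ _ _ _).hom ▷ H =
      (α_ _ _ _).hom ≫ (tens (coactAt β X) (tens (coactAt β Y) (coactAt β Z) ≫
        (F.obj Y ⊗ F.obj Z) ◁ m) ≫ (F.obj X ⊗ (F.obj Y ⊗ F.obj Z)) ◁ m) := by
    have k1' := k1 =≫ (F.map (α_ X Y Z).hom ▷ H)
    simp only [Category.assoc] at k1'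
    rw [← hn, reassoc_of% ha, k2] at k1'
    rw [← cancel_mono ((F.obj X ◁ Functor.LaxMonoidal.μ F Y Z) ▷ H),
      ← cancel_mono (Functor.LaxMonoidal.μ F X (Y ⊗ Z) ▷ H)]
    have ha' := congrArg (· ▷ H) ha
    simp only [MonoidalCategory.comp_whiskerRight] at ha'
    simp only [Category.assoc] at k1' ⊢
    rw [k1', ← ha']
  have e3 := tens_assoc (coactAt β X) (coactAt β Y) (coactAt β Z)
  have e4 := tens_whiskerLeft (tens (coactAt β X) (coactAt β Y)) (coactAt β Z) m (𝟙 H)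
  have e5 := tens_whiskerLeft (coactAt β X) (tens (coactAt β Y) (coactAt β Z)) (𝟙 H) m
  rw [MonoidalCategory.whiskerLeft_id, Category.comp_id, tensorHom_id] at e4
  rw [MonoidalCategory.whiskerLeft_id, Category.comp_id, id_tensorHom] at e5
  rw [e4, e5] at k3
  rw [← cancel_epi (α_ _ _ _).hom, ← reassoc_of% e3]
  simp only [Category.assoc] at k3 ⊢
  rw [← MonoidalCategory.whiskerLeft_comp, ← MonoidalCategory.whiskerLeft_comp_assoc] at k3
  rw [← k3, tensorHom_comp_whiskerLeft, Iso.hom_inv_id_assoc]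

theorem one_mul (hβ : IsRepresentable β) (h : IsCompatible β m u d e) :
    u ▷ H ≫ m = (λ_ H).hom := by
  rw [← cancel_epi (λ_ H).inv, Iso.inv_hom_id]
  refine hβ.hom_ext fun X => ?_
  have e1 := tens_mul_natural h.one (g := 𝟙 (F.obj X)) (s := coactAt β X)
    (s' := coactAt β X) (by simp) m
  have hn := coactAt_natural β (λ_ X).hom
  have ha := Functor.LaxMonoidal.left_unitality F X
  have e2 := tens_whiskerLeft (λ_ (𝟙_ C)).inv (coactAt β X) u (𝟙 H)
  rw [MonoidalCategory.whiskerLeft_id, Category.comp_id, tensorHom_id, tens_unit_left] at e2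
  rw [e2, tensorHom_id] at e1
  have k := (Functor.LaxMonoidal.ε F ▷ F.obj X ≫ Functor.LaxMonoidal.μ F (𝟙_ D) X) ≫= hn
  simp only [Category.assoc] at k
  rw [← reassoc_of% ha, reassoc_of% (h.mul (𝟙_ D) X)] at k
  have ha' := congrArg (· ▷ H) ha
  simp only [MonoidalCategory.comp_whiskerRight] at ha'
  simp only [Category.assoc] at e1 k
  rw [reassoc_of% e1, ← ha'] at k
  rw [← MonoidalCategory.whiskerLeft_comp_assoc, tensorHom_comp_whiskerLeft_assoc,
    inv_hom_whiskerRight, Category.comp_id] at k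
  rw [← cancel_epi (λ_ (F.obj X)).hom, MonoidalCategory.whiskerLeft_id, Category.comp_id, ← k]

theorem mul_one (hβ : IsRepresentable β) (h : IsCompatible β m u d e) :
    H ◁ u ≫ m = (ρ_ H).hom := by
  rw [← cancel_epi (ρ_ H).inv, Iso.inv_hom_id]
  refine hβ.hom_ext fun X => ?_
  have e1 := tens_mul_natural (f := 𝟙 (F.obj X)) (r := coactAt β X)
    (r' := coactAt β X) (by simp) h.one m
  have hn := coactAt_natural β (ρ_ X).hom
  have ha := Functor.LaxMonoidal.right_unitality F X
  have e2 := tens_whiskerLeft (coactAt β X) (λ_ (𝟙_ C)).inv (𝟙 H) u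
  rw [MonoidalCategory.whiskerLeft_id, Category.comp_id, id_tensorHom, tens_unit_right] at e2
  rw [e2, id_tensorHom] at e1
  have k := (F.obj X ◁ Functor.LaxMonoidal.ε F ≫ Functor.LaxMonoidal.μ F X (𝟙_ D)) ≫= hn
  simp only [Category.assoc] at k
  rw [← reassoc_of% ha, reassoc_of% (h.mul X (𝟙_ D))] at k
  have ha' := congrArg (· ▷ H) ha
  simp only [MonoidalCategory.comp_whiskerRight] at ha'
  simp only [Category.assoc] at e1 k
  rw [reassoc_of% e1, ← ha'] at k
  rw [← MonoidalCategory.whiskerLeft_comp_assoc, tensorHom_comp_whiskerLeft_assoc,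
    inv_hom_whiskerRight, Category.comp_id] at k
  rw [← cancel_epi (ρ_ (F.obj X)).hom, MonoidalCategory.whiskerLeft_id, Category.comp_id, ← k]

theorem counit_comul (hβ : IsRepresentable β) (h : IsCompatible β m u d e) :
    d ≫ e ▷ H = (λ_ H).inv := by
  refine hβ.hom_ext fun X => ?_
  rw [MonoidalCategory.whiskerLeft_comp, ← Category.assoc, ← h.comul, ← iter_whiskerLeft_left,
    h.counit, iter_rightUnitor_inv_left]

theorem comul_counit (hβ : IsRepresentable β) (h : IsCompatible β m u d e) :
    d ≫ H ◁ e = (ρ_ H).inv := by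
  refine hβ.hom_ext fun X => ?_
  rw [MonoidalCategory.whiskerLeft_comp, ← Category.assoc, ← h.comul, ← iter_whiskerLeft_right,
    h.counit, iter_rightUnitor_inv_right]

theorem comul_assoc (hβ : IsRepresentable β) (h : IsCompatible β m u d e) :
    d ≫ H ◁ d = d ≫ d ▷ H ≫ (α_ H H H).hom := by
  refine hβ.hom_ext fun X => ?_
  simp only [MonoidalCategory.whiskerLeft_comp]
  rw [← reassoc_of% (h.comul X), ← reassoc_of% (h.comul X), ← iter_whiskerLeft_right,
    ← Category.assoc, ← iter_whiskerLeft_left, ← h.comul, iter_assoc]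

theorem mul_counit (hβ : IsRepresentable β) (h : IsCompatible β m u d e) :
    m ≫ e = (e ⊗ₘ e) ≫ (λ_ (𝟙_ C)).hom := by
  refine hβ.hom_ext₂ fun X Y => ?_
  have k := h.mul X Y =≫ (F.obj (X ⊗ Y) ◁ e)
  rw [Category.assoc, h.counit, Category.assoc, ← whisker_exchange] at k
  rw [← cancel_mono (Functor.LaxMonoidal.μ F X Y ▷ 𝟙_ C)]
  simp only [MonoidalCategory.whiskerLeft_comp, Category.assoc] at k ⊢
  rw [← k, ← Category.assoc, ← tens_whiskerLeft, h.counit, h.counit, tens,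
    ← cancel_mono (ρ_ (F.obj (X ⊗ Y))).hom]
  simp only [Category.assoc, rightUnitor_naturality]
  rw [← reassoc_of% (rightUnitor_monoidal (F.obj X) (F.obj Y))]
  simp

theorem one_counit (h : IsCompatible β m u d e) : u ≫ e = 𝟙 (𝟙_ C) := by
  have k := h.one =≫ (F.obj (𝟙_ D) ◁ e)
  rw [Category.assoc, h.counit, Category.assoc, ← whisker_exchange] at k
  simp only [Category.assoc, ← MonoidalCategory.whiskerLeft_comp_assoc] at k
  rw [rightUnitor_inv_naturality, ← Category.assoc, cancel_mono, ← leftUnitor_inv_naturality,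
    ← unitors_inv_equal] at k
  rw [← cancel_mono (λ_ (𝟙_ C)).inv, ← k, Category.id_comp]

/-- Both sides represent the coproduct of the coefficients of `β_{X ⊗ Y}`. -/
theorem mul_comul (hβ : IsRepresentable β) (h : IsCompatible β m u d e) :
    m ≫ d = (d ⊗ₘ d) ≫ tensorμ H H H H ≫ (m ⊗ₘ m) := by
  refine hβ.hom_ext₂ fun X Y => ?_
  have k := h.mul X Y =≫ (F.obj (X ⊗ Y) ◁ d)
  have k2 := iter_natural (h.mul X Y) (h.mul X Y)
  rw [Category.assoc, ← h.comul, k2, iter_whiskerLeft] at k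
  simp only [Category.assoc] at k
  rw [← whisker_exchange] at k
  rw [← cancel_mono (Functor.LaxMonoidal.μ F X Y ▷ _)]
  simp only [MonoidalCategory.whiskerLeft_comp, Category.assoc] at k ⊢
  rw [← k]
  simp only [← Category.assoc]
  rw [← tens_whiskerLeft, ← h.comul, ← h.comul, tens_iter]

theorem one_comul (h : IsCompatible β m u d e) :
    u ≫ d = (λ_ (𝟙_ C)).inv ≫ (u ⊗ₘ u) := by
  have k := h.one =≫ (F.obj (𝟙_ D) ◁ d)
  have k2 := iter_natural h.one h.one
  rw [Category.assoc, ← h.comul, k2, iter_whiskerLeft] at k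
  simp only [Category.assoc] at k
  rw [← whisker_exchange] at k
  have k3 : iter (λ_ (𝟙_ C)).inv (λ_ (𝟙_ C)).inv = (λ_ (𝟙_ C)).inv ≫ 𝟙_ C ◁ (λ_ (𝟙_ C)).inv := by
    simp [iter, unitors_inv_equal]
  rw [← MonoidalCategory.whiskerLeft_comp_assoc, k3, Category.assoc,
    ← MonoidalCategory.whiskerLeft_comp_assoc, ← Category.assoc, ← Category.assoc, cancel_mono,
    ← leftUnitor_inv_naturality, ← leftUnitor_inv_naturality, cancel_mono] at k
  exact k.symm

/-- The bialgebra structure on a representing object. -/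
abbrev bimonObj (hβ : IsRepresentable β) (h : IsCompatible β m u d e) : BimonObj H where
  mul := m
  one := u
  comul := d
  counit := e
  one_mul := h.one_mul hβ
  mul_one := h.mul_one hβ
  mul_assoc := h.mul_assoc hβ
  counit_comul := h.counit_comul hβ
  comul_counit := h.comul_counit hβ
  comul_assoc := h.comul_assoc hβ
  mul_comul := h.mul_comul hβ
  one_comul := h.one_comul
  mul_counit := h.mul_counit hβ
  one_counit := h.one_counit

end IsCompatible
end Bialgebra

/-! ### Invertible coactions -/

section Kleisli

variable {C : Type u} [Category.{v} C] [MonoidalCategory C] {A : C} [MonObj A]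

/-- Composition of `f : X ⟶ Y ⊗ A` and `g : Y ⟶ Z ⊗ A` in the Kleisli category of the monad
`- ⊗ A`. -/
def kleisli {X Y Z : C} (g : Y ⟶ Z ⊗ A) (f : X ⟶ Y ⊗ A) : X ⟶ Z ⊗ A :=
  f ≫ g ▷ A ≫ (α_ Z A A).hom ≫ Z ◁ μ[A]

/-- The identity of `X` in the Kleisli category of the monad `- ⊗ A`. -/
def kleisliId (A : C) [MonObj A] (X : C) : X ⟶ X ⊗ A := (ρ_ X).inv ≫ X ◁ η[A]

theorem kleisli_eq_iter {X : C} (r s : X ⟶ X ⊗ A) : kleisli r s = iter r s ≫ X ◁ μ[A] := by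
  simp [kleisli, iter]

theorem kleisli_assoc {W X Y Z : C} (h : Y ⟶ Z ⊗ A) (g : X ⟶ Y ⊗ A) (f : W ⟶ X ⊗ A) :
    kleisli (kleisli h g) f = kleisli h (kleisli g f) := by
  simp only [kleisli, MonoidalCategory.comp_whiskerRight, Category.assoc]
  have e : (Z ◁ μ[A]) ▷ A ≫ (α_ Z A A).hom ≫ Z ◁ μ[A] =
      (α_ Z (A ⊗ A) A).hom ≫ Z ◁ (α_ A A A).hom ≫ Z ◁ A ◁ μ[A] ≫ Z ◁ μ[A] := by
    rw [associator_naturality_middle_assoc, ← MonoidalCategory.whiskerLeft_comp, MonObj.mul_assoc]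
    simp
  rw [e, whisker_exchange_assoc]
  simp

@[simp]
theorem kleisli_id_left {X Y : C} (f : X ⟶ Y ⊗ A) : kleisli (kleisliId A Y) f = f := by
  simp only [kleisli, kleisliId, MonoidalCategory.comp_whiskerRight, Category.assoc]
  rw [associator_naturality_middle_assoc, ← MonoidalCategory.whiskerLeft_comp, MonObj.one_mul]
  simp

@[simp]
theorem kleisli_id_right {X Y : C} (f : X ⟶ Y ⊗ A) : kleisli f (kleisliId A X) = f := by
  simp only [kleisli, kleisliId, Category.assoc]
  rw [whisker_exchange_assoc, associator_naturality_right_assoc,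
    ← MonoidalCategory.whiskerLeft_comp, MonObj.mul_one]
  simp

theorem kleisli_pure_left {X Y Z : C} (f : X ⟶ Y ⊗ A) (g : Y ⟶ Z) :
    kleisli (g ≫ kleisliId A Z) f = f ≫ g ▷ A := by
  have h := kleisli_id_left (f ≫ g ▷ A)
  simp only [kleisli, MonoidalCategory.comp_whiskerRight, Category.assoc] at h ⊢
  exact h

theorem kleisli_pure_right {X Y Z : C} (g : Y ⟶ Z ⊗ A) (f : X ⟶ Y) :
    kleisli g (f ≫ kleisliId A Y) = f ≫ g := by
  have h := kleisli_id_right g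
  simp only [kleisli, Category.assoc] at h ⊢
  rw [h]

/-- Pointwise inverses of a natural family for the Kleisli composition form a natural family. -/
theorem natural_of_kleisli_inverse {X Y : C} {f : X ⟶ Y} {r s : X ⟶ X ⊗ A} {r' s' : Y ⟶ Y ⊗ A}
    (h : f ≫ r' = r ≫ f ▷ A) (hs : kleisli r s = kleisliId A X)
    (hs' : kleisli s' r' = kleisliId A Y) : f ≫ s' = s ≫ f ▷ A := by
  rw [← kleisli_pure_left, ← kleisli_pure_right] at *
  calc kleisli s' (f ≫ kleisliId A Y)
      = kleisli s' (kleisli (f ≫ kleisliId A Y) (kleisli r s)) := by rw [hs, kleisli_id_right]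
    _ = kleisli (kleisli s' r') (kleisli (f ≫ kleisliId A Y) s) := by
      rw [← kleisli_assoc (f ≫ _), ← h, kleisli_assoc, kleisli_assoc]
    _ = _ := by rw [hs', kleisli_id_left]

end Kleisli

section DualInverse

variable {C : Type u} [Category.{v} C] [MonoidalCategory C] [BraidedCategory C] {A : C} [MonObj A]

/-- The transpose of `s : Y ⟶ Y ⊗ A` to the dual object `X` of `Y`. -/
def transpose {X Y : C} [ExactPairing X Y] (s : Y ⟶ Y ⊗ A) : X ⟶ X ⊗ A :=
  𝟙 _ ⊗≫ η_ X Y ▷ X ⊗≫ X ◁ s ▷ X ⊗≫ X ◁ Y ◁ (β_ A X).hom ⊗≫ X ◁ ε_ X Y ▷ A ⊗≫ 𝟙 _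

/-- If the evaluation intertwines the coactions, the transpose is a left Kleisli inverse. -/
theorem kleisli_transpose_left {X Y : C} [ExactPairing X Y] {r : X ⟶ X ⊗ A} {s : Y ⟶ Y ⊗ A}
    (h : tensorCoact s r ≫ ε_ X Y ▷ A = ε_ X Y ≫ unitCoact A) :
    kleisli (transpose s) r = kleisliId A X := by
  calc kleisli (transpose s) r
      = 𝟙 _ ⊗≫ ((𝟙_ C) ◁ r ≫ η_ X Y ▷ (X ⊗ A)) ⊗≫ X ◁ s ▷ X ▷ A ⊗≫
          X ◁ Y ◁ (β_ A X).hom ▷ A ⊗≫ (X ◁ (ε_ X Y ▷ (A ⊗ A) ≫ 𝟙_ C ◁ μ[A])) ⊗≫ 𝟙 _ := by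
        simp only [kleisli, transpose]; monoidal
    _ = 𝟙 _ ⊗≫ η_ X Y ▷ X ⊗≫ X ◁ ((Y ◁ r ≫ s ▷ (X ⊗ A)) ⊗≫
          Y ◁ (β_ A X).hom ▷ A ⊗≫ (Y ⊗ X) ◁ μ[A] ≫ ε_ X Y ▷ A) ⊗≫ 𝟙 _ := by
        rw [whisker_exchange, ← whisker_exchange (ε_ X Y)]; monoidal
    _ = 𝟙 _ ⊗≫ η_ X Y ▷ X ⊗≫ X ◁ (tensorCoact s r ≫ ε_ X Y ▷ A) ⊗≫ 𝟙 _ := by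
        rw [tensorCoact, MonoidalCategory.tensorHom_def']; simp only [tensorμ]; monoidal
    _ = 𝟙 _ ⊗≫ (η_ X Y ▷ X ⊗≫ X ◁ ε_ X Y) ⊗≫ X ◁ η[A] ⊗≫ 𝟙 _ := by
        rw [h, unitCoact]; monoidal
    _ = kleisliId A X := by
        rw [ExactPairing.evaluation_coevaluation'', kleisliId]; monoidal

/-- If the coevaluation intertwines the coactions, the transpose is a right Kleisli inverse. -/
theorem kleisli_transpose_right {X Y : C} [ExactPairing X Y] {r : X ⟶ X ⊗ A} {s : Y ⟶ Y ⊗ A}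
    (h : η_ X Y ≫ tensorCoact r s = unitCoact A ≫ η_ X Y ▷ A) :
    kleisli r (transpose s) = kleisliId A X := by
  have hε := BraidedCategory.braiding_naturality_right A (ε_ X Y)
  calc kleisli r (transpose s)
      = 𝟙 _ ⊗≫ η_ X Y ▷ X ⊗≫ X ◁ s ▷ X ⊗≫ X ◁ Y ◁ (β_ A X).hom ⊗≫
          (X ◁ ε_ X Y ≫ r ▷ 𝟙_ C) ▷ A ⊗≫ X ◁ μ[A] ⊗≫ 𝟙 _ := by
        simp only [kleisli, transpose]; monoidal
    _ = 𝟙 _ ⊗≫ η_ X Y ▷ X ⊗≫ X ◁ s ▷ X ⊗≫ (X ◁ (Y ◁ (β_ A X).hom) ≫ r ▷ (Y ⊗ (X ⊗ A))) ⊗≫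
          (X ⊗ A) ◁ ε_ X Y ▷ A ⊗≫ X ◁ μ[A] ⊗≫ 𝟙 _ := by
        rw [whisker_exchange]; monoidal
    _ = 𝟙 _ ⊗≫ η_ X Y ▷ X ⊗≫ (X ◁ s ≫ r ▷ (Y ⊗ A)) ▷ X ⊗≫ (X ⊗ A) ◁ (Y ◁ (β_ A X).hom) ⊗≫
          X ◁ ((A ◁ ε_ X Y) ≫ (β_ A (𝟙_ C)).hom) ▷ A ⊗≫ X ◁ μ[A] ⊗≫ 𝟙 _ := by
        rw [whisker_exchange, braiding_tensorUnit_right]; monoidal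
    _ = 𝟙 _ ⊗≫ η_ X Y ▷ X ⊗≫ (X ◁ s ≫ r ▷ (Y ⊗ A)) ▷ X ⊗≫
          X ◁ (A ◁ (Y ◁ (β_ A X).hom) ⊗≫ (β_ A Y).hom ▷ (X ⊗ A)) ⊗≫
          X ◁ Y ◁ (β_ A X).hom ▷ A ⊗≫ X ◁ (ε_ X Y ▷ (A ⊗ A) ≫ 𝟙_ C ◁ μ[A]) ⊗≫ 𝟙 _ := by
        rw [hε, BraidedCategory.braiding_tensor_right_hom]; monoidal
    _ = 𝟙 _ ⊗≫ η_ X Y ▷ X ⊗≫ (X ◁ s ≫ r ▷ (Y ⊗ A)) ▷ X ⊗≫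
          X ◁ ((A ⊗ Y) ◁ (β_ A X).hom ≫ (β_ A Y).hom ▷ (X ⊗ A)) ⊗≫
          X ◁ Y ◁ (β_ A X).hom ▷ A ⊗≫ X ◁ ((Y ⊗ X) ◁ μ[A] ≫ ε_ X Y ▷ A) ⊗≫ 𝟙 _ := by
        rw [whisker_exchange (ε_ X Y)]; monoidal
    _ = 𝟙 _ ⊗≫ η_ X Y ▷ X ⊗≫ (X ◁ s ≫ r ▷ (Y ⊗ A)) ▷ X ⊗≫
          X ◁ (β_ A Y).hom ▷ A ▷ X ⊗≫
          X ◁ Y ◁ ((β_ (A ⊗ A) X).hom ≫ X ◁ μ[A]) ⊗≫ X ◁ ε_ X Y ▷ A ⊗≫ 𝟙 _ := by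
        rw [whisker_exchange (β_ A Y).hom, BraidedCategory.braiding_tensor_left_hom]; monoidal
    _ = 𝟙 _ ⊗≫ (η_ X Y ≫ tensorCoact r s) ▷ X ⊗≫ X ◁ Y ◁ (β_ A X).hom ⊗≫
          X ◁ ε_ X Y ▷ A ⊗≫ 𝟙 _ := by
        rw [← BraidedCategory.braiding_naturality_left, tensorCoact,
          MonoidalCategory.tensorHom_def']
        simp only [tensorμ]; monoidal
    _ = 𝟙 _ ⊗≫ ((𝟙_ C) ◁ η[A] ≫ η_ X Y ▷ A) ▷ X ⊗≫ X ◁ Y ◁ (β_ A X).hom ⊗≫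
          X ◁ ε_ X Y ▷ A ⊗≫ 𝟙 _ := by
        rw [h, unitCoact]; monoidal
    _ = 𝟙 _ ⊗≫ η_ X Y ▷ X ⊗≫ X ◁ Y ◁ (η[A] ▷ X ≫ (β_ A X).hom) ⊗≫
          X ◁ ε_ X Y ▷ A ⊗≫ 𝟙 _ := by
        rw [whisker_exchange]; monoidal
    _ = 𝟙 _ ⊗≫ η_ X Y ▷ X ⊗≫ X ◁ ((Y ⊗ X) ◁ η[A] ≫ ε_ X Y ▷ A) ⊗≫ 𝟙 _ := by
        rw [BraidedCategory.braiding_naturality_left, braiding_tensorUnit_left]; monoidal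
    _ = 𝟙 _ ⊗≫ (η_ X Y ▷ X ⊗≫ X ◁ ε_ X Y) ⊗≫ X ◁ η[A] ⊗≫ 𝟙 _ := by
        rw [whisker_exchange]; monoidal
    _ = kleisliId A X := by
        rw [ExactPairing.evaluation_coevaluation'', kleisliId]; monoidal

end DualInverse

/-! ### Reconstruction from the identity functor -/

section HopfReconstruction

variable {C : Type u} [Category.{v} C] [MonoidalCategory C] [BraidedCategory C]
variable {D : Type u'} [Category.{v'} D] [MonoidalCategory D] {F : D ⥤ C} [F.Monoidal] {H : C}
  {β : F ⟶ F ⋙ tensorRight H}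

/-- A reconstructed bialgebra has an antipode as soon as the coactions `β_X` are invertible for the
Kleisli composition: the inverses form a natural family, which is represented by the antipode. -/
theorem IsCompatible.exists_hopfObj (hβ : IsRepresentable β) [b : BimonObj H]
    (h : IsCompatible β μ[H] η[H] Δ[H] ε[H]) (σ : ∀ X, F.obj X ⟶ F.obj X ⊗ H)
    (hl : ∀ X, kleisli (σ X) (coactAt β X) = kleisliId H (F.obj X))
    (hr : ∀ X, kleisli (coactAt β X) (σ X) = kleisliId H (F.obj X)) :
    ∃ hH : HopfObj H, hH.toBimonObj = b := by
  obtain ⟨s, hs⟩ := hβ.exists_hom σ fun f =>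
    natural_of_kleisli_inverse (coactAt_natural β f) (hr _) (hl _)
  have h1 : ∀ X, kleisliId H (F.obj X) = coactAt β X ≫ F.obj X ◁ (ε[H] ≫ η[H]) := fun X => by
    rw [MonoidalCategory.whiskerLeft_comp, reassoc_of% h.counit X, kleisliId]
  refine ⟨{ b with antipode := s, antipode_left := ?_, antipode_right := ?_ }, rfl⟩
  · refine hβ.hom_ext fun X => ?_
    rw [← h1, ← hl, kleisli_eq_iter, ← hs, iter_whiskerLeft_left, h.comul]
    simp only [MonoidalCategory.whiskerLeft_comp, Category.assoc]
  · refine hβ.hom_ext fun X => ?_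
    rw [← h1, ← hr, kleisli_eq_iter, ← hs, iter_whiskerLeft_right, h.comul]
    simp only [MonoidalCategory.whiskerLeft_comp, Category.assoc]

theorem IsCompatible.isReconstruction (hβ : IsRepresentable β) [HopfObj H]
    (h : IsCompatible β μ[H] η[H] Δ[H] ε[H]) : IsReconstruction F (Hopf.mk H) β where
  representable := hβ
  coact_comul := h.comul
  coact_counit := h.counit
  coact_mul X Y := by
    rw [tensorCoact_eq_tens]
    exact h.mul X Y
  coact_one := h.one

end HopfReconstruction

section Identity

variable {C : Type u} [Category.{v} C] [MonoidalCategory C] {A : C}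

/-- The component of `β` at `X`, as a morphism `X ⟶ X ⊗ A`. -/
def taut (β : 𝟭 C ⟶ 𝟭 C ⋙ tensorRight A) (X : C) : X ⟶ X ⊗ A := β.app X

theorem taut_natural (β : 𝟭 C ⟶ 𝟭 C ⋙ tensorRight A) {X Y : C} (f : X ⟶ Y) :
    f ≫ taut β Y = taut β X ≫ f ▷ A := β.naturality f

variable [BraidedCategory C] {β : 𝟭 C ⟶ 𝟭 C ⋙ tensorRight A}

/-- For the identity functor the structure maps exist: they represent the natural families
`iter β_X β_X`, `(ρ_ X).inv` and `β_{X ⊗ Y}`, and the unit is `β` at the unit object. -/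
theorem IsRepresentable.exists_isCompatible (hβ : IsRepresentable β) :
    ∃ m u d e, IsCompatible β m u d e := by
  obtain ⟨d, hd⟩ := hβ.exists_hom (fun X => iter (taut β X) (taut β X)) fun f =>
    iter_natural (taut_natural β f) (taut_natural β f)
  obtain ⟨e, he⟩ := hβ.exists_hom (V := 𝟙_ C) (fun X => (ρ_ X).inv) fun f =>
    rightUnitor_inv_naturality f
  obtain ⟨m, hm⟩ := hβ.exists_hom₂ (fun X Y => taut β (X ⊗ Y)) fun f g =>
    taut_natural β (f ⊗ₘ g)
  refine ⟨m, taut β (𝟙_ C) ≫ (λ_ A).hom, d, e, fun X => (hd X).symm, he, fun X Y => ?_, ?_⟩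
  · rw [hm]
    change 𝟙 _ ≫ taut β _ = taut β _ ≫ 𝟙 _ ▷ A
    simp
  · change 𝟙 _ ≫ taut β _ = ((λ_ (𝟙_ C)).inv ≫ 𝟙_ C ◁ (taut β (𝟙_ C) ≫ (λ_ A).hom)) ≫ 𝟙 _ ▷ A
    rw [← leftUnitor_inv_naturality]
    simp

section

variable [BimonObj A] (h : IsCompatible β μ[A] η[A] Δ[A] ε[A])
include h

theorem IsCompatible.taut_comul (X : C) :
    taut β X ≫ taut β X ▷ A ≫ (α_ X A A).hom = taut β X ≫ X ◁ Δ[A] := h.comul X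

theorem IsCompatible.taut_counit (X : C) : taut β X ≫ X ◁ ε[A] = (ρ_ X).inv := h.counit X

theorem IsCompatible.taut_tensor (X Y : C) :
    taut β (X ⊗ Y) = tensorCoact (taut β X) (taut β Y) := by
  have k : 𝟙 _ ≫ taut β (X ⊗ Y) = (tens (taut β X) (taut β Y) ≫ (X ⊗ Y) ◁ μ[A]) ≫ 𝟙 _ ▷ A :=
    h.mul X Y
  rw [tensorCoact_eq_tens]
  simpa using k

theorem IsCompatible.taut_unit : taut β (𝟙_ C) = unitCoact A := by
  have k : 𝟙 _ ≫ taut β (𝟙_ C) = ((λ_ (𝟙_ C)).inv ≫ 𝟙_ C ◁ η[A]) ≫ 𝟙 _ ▷ A := h.one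
  rw [unitCoact]
  simpa using k

/-- In a rigid category the inverse of `β_X` is the transpose of `β` at the dual of `X`: by
naturality, `β` is compatible with evaluation and coevaluation. -/
theorem IsCompatible.exists_hopfObj_id [RightRigidCategory C] (hβ : IsRepresentable β) :
    ∃ hH : HopfObj A, hH.toBimonObj = ‹BimonObj A› := by
  have hl : ∀ X : C, kleisli (transpose (X := X) (taut β Xᘁ)) (taut β X) = kleisliId A X :=
    fun X => kleisli_transpose_left (by rw [← h.taut_tensor, ← taut_natural, h.taut_unit])
  have hr : ∀ X : C, kleisli (taut β X) (transpose (X := X) (taut β Xᘁ)) = kleisliId A X :=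
    fun X => kleisli_transpose_right (by rw [← h.taut_tensor, taut_natural, h.taut_unit])
  exact h.exists_hopfObj hβ _ hl hr

end

theorem IsRepresentable.exists_hopfObj [RightRigidCategory C] (hβ : IsRepresentable β) :
    ∃ _ : HopfObj A, IsCompatible β μ[A] η[A] Δ[A] ε[A] := by
  obtain ⟨m, u, d, e, h⟩ := hβ.exists_isCompatible
  let _ := h.bimonObj hβ
  obtain ⟨hH, e⟩ := IsCompatible.exists_hopfObj_id (A := A) h hβ
  refine ⟨hH, ?_⟩
  rw [e]
  exact h

end Identity

section Coend

variable {C : Type u} [Category.{v} C] [MonoidalCategory C]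

theorem tensorLeftHomEquiv_symm_whiskerLeft {X Y V W : C} [ExactPairing X Y] (b : X ⟶ X ⊗ V)
    (φ : V ⟶ W) :
    (tensorLeftHomEquiv X X Y V).symm b ≫ φ = (tensorLeftHomEquiv X X Y W).symm (b ≫ X ◁ φ) := by
  rw [Equiv.eq_symm_apply, tensorLeftHomEquiv_naturality, Equiv.apply_symm_apply]

variable [RightRigidCategory C]

theorem matrixCoeff_eq {A X : C} (b : X ⟶ X ⊗ A) :
    matrixCoeff b = (tensorLeftHomEquiv X X Xᘁ A).symm b := rfl

theorem whiskerLeft_eq_of_matrixCoeff_eq {A X V : C} {b : X ⟶ X ⊗ A} {φ ψ : A ⟶ V}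
    (h : matrixCoeff b ≫ φ = matrixCoeff b ≫ ψ) : b ≫ X ◁ φ = b ≫ X ◁ ψ := by
  rw [matrixCoeff_eq, tensorLeftHomEquiv_symm_whiskerLeft,
    tensorLeftHomEquiv_symm_whiskerLeft] at h
  exact (tensorLeftHomEquiv X X Xᘁ V).symm.injective h

/-- A dinatural family `Xᘁ ⊗ X ⟶ V` transposes to a natural family `X ⟶ X ⊗ V`. -/
theorem tensorLeftHomEquiv_natural_of_dinatural {V : C} {w : ∀ X : C, Xᘁ ⊗ X ⟶ V}
    (hw : ∀ {X Y : C} (f : X ⟶ Y), fᘁ ▷ X ≫ w X = Yᘁ ◁ f ≫ w Y) {X Y : C} (f : X ⟶ Y) :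
    f ≫ tensorLeftHomEquiv Y Y Yᘁ V (w Y) = tensorLeftHomEquiv X X Xᘁ V (w X) ≫ f ▷ V := by
  have h1 : f ≫ tensorLeftHomEquiv Y Y Yᘁ V (w Y) =
      tensorLeftHomEquiv X Y Yᘁ V (Yᘁ ◁ f ≫ w Y) := by
    rw [← Equiv.symm_apply_eq, tensorLeftHomEquiv_symm_naturality, Equiv.symm_apply_apply]
  rw [h1, ← hw]
  have h2 := coevaluation_comp_rightAdjointMate f
  simp only [tensorLeftHomEquiv, Equiv.coe_fn_mk, MonoidalCategory.whiskerLeft_comp,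
    Category.assoc]
  rw [← associator_naturality_middle_assoc, ← MonoidalCategory.comp_whiskerRight_assoc, h2,
    MonoidalCategory.comp_whiskerRight_assoc, associator_naturality_left_assoc, whisker_exchange]

/-- Cowedges with vertex `V` transpose to natural families `X ⟶ X ⊗ V`, which are represented by
morphisms `A ⟶ V`. -/
theorem IsRepresentable.isColimit_tautologicalCowedge [BraidedCategory C] {A : C}
    {β : 𝟭 C ⟶ 𝟭 C ⋙ tensorRight A} (hβ : IsRepresentable β) :
    Nonempty (IsColimit (tautologicalCowedge β)) := by
  have key : ∀ s : Cowedge (dualFunctor C ⋙ curriedTensor C), ∃ φ : A ⟶ s.pt, ∀ X : C,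
      matrixCoeff (taut β X) ≫ φ = s.π X := by
    intro s
    obtain ⟨w, hw⟩ : ∃ w : ∀ X : C, Xᘁ ⊗ X ⟶ s.pt, ∀ X, w X = s.π X :=
      ⟨fun X => s.π X, fun _ => rfl⟩
    have hw' : ∀ {X Y : C} (f : X ⟶ Y), fᘁ ▷ X ≫ w X = Yᘁ ◁ f ≫ w Y := fun f => by
      rw [hw, hw]
      exact Multicofork.condition s (Arrow.mk f)
    obtain ⟨φ, hφ⟩ := hβ.exists_hom (V := s.pt) (fun X => tensorLeftHomEquiv X X Xᘁ s.pt (w X))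
      (fun f => tensorLeftHomEquiv_natural_of_dinatural hw' f)
    refine ⟨φ, fun X => ?_⟩
    have h : taut β X ≫ X ◁ φ = _ := hφ X
    rw [matrixCoeff_eq, tensorLeftHomEquiv_symm_whiskerLeft, h, Equiv.symm_apply_apply, hw]
  choose desc hdesc using key
  refine ⟨Multicofork.IsColimit.mk _ desc (fun s X => hdesc s X) fun s m hm => ?_⟩
  refine hβ.hom_ext fun X => ?_
  exact whiskerLeft_eq_of_matrixCoeff_eq ((hm X).trans (hdesc s X).symm)

end Coend

/-! ### The tautological coaction of `A` on itself -/

section Adjoint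

variable {C : Type u} [Category.{v} C] [MonoidalCategory C] [BraidedCategory C] {A : C} [HopfObj A]

/-- The coaction of the second factor is recovered from a tensor product coaction by acting on the
first factor with the antipode. -/
theorem tensorCoact_antipode {X Y : C} {r : X ⟶ X ⊗ A} (s : Y ⟶ Y ⊗ A)
    (hc : r ≫ r ▷ A ≫ (α_ X A A).hom = r ≫ X ◁ Δ[A]) (hu : r ≫ X ◁ ε[A] = (ρ_ X).inv) :
    tensorCoact r s ⊗≫ r ▷ (Y ⊗ A) ⊗≫ X ◁ 𝒮[A] ▷ (Y ⊗ A) ⊗≫ X ◁ (β_ A Y).hom ▷ A ⊗≫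
      X ◁ Y ◁ μ[A] = X ◁ s := by
  calc _ = 𝟙 _ ⊗≫ X ◁ s ⊗≫ r ▷ (Y ⊗ A) ⊗≫
          (X ◁ ((α_ A Y A).inv ≫ (β_ A Y).hom ▷ A ≫ (α_ Y A A).hom ≫ Y ◁ μ[A]) ≫ r ▷ (Y ⊗ A)) ⊗≫
          X ◁ 𝒮[A] ▷ (Y ⊗ A) ⊗≫ X ◁ (β_ A Y).hom ▷ A ⊗≫ X ◁ Y ◁ μ[A] := by
        rw [tensorCoact, MonoidalCategory.tensorHom_def']; simp only [tensorμ]; monoidal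
    _ = 𝟙 _ ⊗≫ X ◁ s ⊗≫ (r ≫ r ▷ A ≫ (α_ X A A).hom) ▷ (Y ⊗ A) ⊗≫
          X ◁ (A ◁ ((α_ A Y A).inv ≫ (β_ A Y).hom ▷ A ≫ (α_ Y A A).hom ≫ Y ◁ μ[A]) ≫
            𝒮[A] ▷ (Y ⊗ A)) ⊗≫ X ◁ (β_ A Y).hom ▷ A ⊗≫ X ◁ Y ◁ μ[A] := by
        rw [whisker_exchange]; monoidal
    _ = 𝟙 _ ⊗≫ X ◁ s ⊗≫ (r ≫ X ◁ Δ[A]) ▷ (Y ⊗ A) ⊗≫ X ◁ 𝒮[A] ▷ (A ⊗ (Y ⊗ A)) ⊗≫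
          X ◁ A ◁ (β_ A Y).hom ▷ A ⊗≫ X ◁ ((A ⊗ Y) ◁ μ[A] ≫ (β_ A Y).hom ▷ A) ⊗≫
          X ◁ Y ◁ μ[A] := by
        rw [hc, whisker_exchange]; monoidal
    _ = 𝟙 _ ⊗≫ X ◁ s ⊗≫ (r ≫ X ◁ Δ[A]) ▷ (Y ⊗ A) ⊗≫ X ◁ 𝒮[A] ▷ (A ⊗ (Y ⊗ A)) ⊗≫
          X ◁ (β_ (A ⊗ A) Y).hom ▷ A ⊗≫ X ◁ Y ◁ ((α_ A A A).hom ≫ A ◁ μ[A] ≫ μ[A]) := by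
        rw [whisker_exchange, BraidedCategory.braiding_tensor_left_hom]; monoidal
    _ = 𝟙 _ ⊗≫ X ◁ s ⊗≫ (r ≫ X ◁ Δ[A]) ▷ (Y ⊗ A) ⊗≫ X ◁ 𝒮[A] ▷ (A ⊗ (Y ⊗ A)) ⊗≫
          X ◁ ((β_ (A ⊗ A) Y).hom ≫ Y ◁ μ[A]) ▷ A ⊗≫ X ◁ Y ◁ μ[A] := by
        rw [← MonObj.mul_assoc]; monoidal
    _ = 𝟙 _ ⊗≫ X ◁ s ⊗≫ (r ≫ X ◁ (Δ[A] ≫ 𝒮[A] ▷ A ≫ μ[A])) ▷ (Y ⊗ A) ⊗≫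
          X ◁ (β_ A Y).hom ▷ A ⊗≫ X ◁ Y ◁ μ[A] := by
        rw [← BraidedCategory.braiding_naturality_left]; monoidal
    _ = 𝟙 _ ⊗≫ X ◁ s ⊗≫ (r ≫ X ◁ ε[A]) ▷ (Y ⊗ A) ⊗≫
          X ◁ (η[A] ▷ Y ≫ (β_ A Y).hom) ▷ A ⊗≫ X ◁ Y ◁ μ[A] := by
        rw [HopfObj.antipode_left]; monoidal
    _ = 𝟙 _ ⊗≫ X ◁ s ⊗≫ X ◁ Y ◁ (η[A] ▷ A ≫ μ[A]) := by
        rw [hu, BraidedCategory.braiding_naturality_left, braiding_tensorUnit_left]; monoidal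
    _ = X ◁ s := by
        rw [MonObj.one_mul]; monoidal

/-- The tautological coaction of `A` on itself is the adjoint coaction. This is read off from the
naturality of `β` with respect to its own components `β_X : X ⟶ X ⊗ A`. -/
theorem IsCompatible.taut_self {β : 𝟭 C ⟶ 𝟭 C ⋙ tensorRight A} (hβ : IsRepresentable β)
    (h : IsCompatible β μ[A] η[A] Δ[A] ε[A]) : taut β A = adjointCoaction A := by
  refine hβ.hom_ext fun X => ?_
  change taut β X ≫ X ◁ taut β A = taut β X ≫ X ◁ adjointCoaction A
  have hn := taut_natural β (taut β X)
  rw [h.taut_tensor] at hn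
  have hc := h.taut_comul X
  generalize taut β A = s at hn ⊢
  calc taut β X ≫ X ◁ s
      = 𝟙 _ ⊗≫ (taut β X ≫ tensorCoact (taut β X) s) ⊗≫ taut β X ▷ (A ⊗ A) ⊗≫
          X ◁ 𝒮[A] ▷ (A ⊗ A) ⊗≫ X ◁ (β_ A A).hom ▷ A ⊗≫ X ◁ A ◁ μ[A] := by
        rw [← tensorCoact_antipode s hc (h.taut_counit X)]; monoidal
    _ = 𝟙 _ ⊗≫ (taut β X ≫ taut β X ▷ A ≫ (α_ X A A).hom) ⊗≫ taut β X ▷ (A ⊗ A) ⊗≫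
          X ◁ 𝒮[A] ▷ (A ⊗ A) ⊗≫ X ◁ (β_ A A).hom ▷ A ⊗≫ X ◁ A ◁ μ[A] := by
        rw [hn]; monoidal
    _ = 𝟙 _ ⊗≫ taut β X ⊗≫ (X ◁ Δ[A] ≫ taut β X ▷ (A ⊗ A)) ⊗≫
          X ◁ 𝒮[A] ▷ (A ⊗ A) ⊗≫ X ◁ (β_ A A).hom ▷ A ⊗≫ X ◁ A ◁ μ[A] := by
        rw [hc]; monoidal
    _ = 𝟙 _ ⊗≫ (taut β X ≫ taut β X ▷ A ≫ (α_ X A A).hom) ⊗≫ X ◁ (A ◁ Δ[A] ≫ 𝒮[A] ▷ (A ⊗ A)) ⊗≫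
          X ◁ (β_ A A).hom ▷ A ⊗≫ X ◁ A ◁ μ[A] := by
        rw [whisker_exchange]; monoidal
    _ = taut β X ≫ X ◁ adjointCoaction A := by
        rw [hc, whisker_exchange, adjointCoaction]; monoidal

end Adjoint

/-! ### Reconstruction from the comodules: the cross coproduct -/

section CrossCoproduct

variable {C : Type u} [Category.{v} C] [MonoidalCategory C] [BraidedCategory C] {A : C} [HopfObj A]
  {β : 𝟭 C ⟶ 𝟭 C ⋙ tensorRight A}

/-- Two successive coactions of `A ⊗ A` on a comodule `M` are a single one followed by the cross
coproduct: the naturality of `β` with respect to the coaction of `M` moves the second copy of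
`M.coact` past `β_M`, and this produces the coaction `β_A` on the coefficients of `M`. -/
theorem iter_comoduleCoact (h : IsCompatible β μ[A] η[A] Δ[A] ε[A]) (M : Comodule A) :
    iter (iter (taut β M.X) M.coact) (iter (taut β M.X) M.coact) =
      iter (taut β M.X) M.coact ≫ M.X ◁ crossComul A A (taut β A) := by
  have hn := taut_natural β M.coact
  rw [h.taut_tensor] at hn
  have hb := h.taut_comul M.X
  have hr := M.coact_coassoc
  generalize taut β A = s at hn ⊢
  generalize taut β M.X = b at hn hb ⊢
  generalize M.coact = r at hn hr ⊢
  generalize M.X = X at b r hn hb hr ⊢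
  calc iter (iter b r) (iter b r)
      = 𝟙 _ ⊗≫ r ⊗≫ (b ≫ r ▷ A) ▷ A ⊗≫ b ▷ (A ⊗ A ⊗ A) ⊗≫ 𝟙 _ := by
        simp only [iter]; monoidal
    _ = 𝟙 _ ⊗≫ (r ≫ r ▷ A ≫ (α_ X A A).hom) ⊗≫ X ◁ s ▷ A ⊗≫ b ▷ (A ⊗ A ⊗ A) ⊗≫
          (X ◁ (((α_ A A A).inv ≫ (β_ A A).hom ▷ A ≫ (α_ A A A).hom ≫ A ◁ μ[A]) ▷ A) ≫
            b ▷ ((A ⊗ A) ⊗ A)) ⊗≫ 𝟙 _ := by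
        rw [← hn, tensorCoact, MonoidalCategory.tensorHom_def']; simp only [tensorμ]; monoidal
    _ = 𝟙 _ ⊗≫ (r ≫ X ◁ Δ[A]) ⊗≫ X ◁ s ▷ A ⊗≫ (b ≫ b ▷ A ≫ (α_ X A A).hom) ▷ (A ⊗ A ⊗ A) ⊗≫
          X ◁ A ◁ (((α_ A A A).inv ≫ (β_ A A).hom ▷ A ≫ (α_ A A A).hom ≫ A ◁ μ[A]) ▷ A) ⊗≫
          𝟙 _ := by
        rw [whisker_exchange, hr]; monoidal
    _ = 𝟙 _ ⊗≫ r ⊗≫ (X ◁ (Δ[A] ≫ s ▷ A) ≫ b ▷ ((A ⊗ A) ⊗ A)) ⊗≫ X ◁ Δ[A] ▷ (A ⊗ A ⊗ A) ⊗≫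
          X ◁ A ◁ (((α_ A A A).inv ≫ (β_ A A).hom ▷ A ≫ (α_ A A A).hom ≫ A ◁ μ[A]) ▷ A) ⊗≫
          𝟙 _ := by
        rw [hb]; monoidal
    _ = 𝟙 _ ⊗≫ r ⊗≫ b ▷ A ⊗≫ X ◁ (A ◁ (Δ[A] ≫ s ▷ A) ≫ Δ[A] ▷ ((A ⊗ A) ⊗ A)) ⊗≫
          X ◁ A ◁ (((α_ A A A).inv ≫ (β_ A A).hom ▷ A ≫ (α_ A A A).hom ≫ A ◁ μ[A]) ▷ A) ⊗≫
          𝟙 _ := by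
        rw [whisker_exchange]; monoidal
    _ = iter b r ≫ X ◁ crossComul A A s := by
        rw [whisker_exchange, crossComul, MonoidalCategory.tensorHom_def, iter]
        simp only [tensorμ]; monoidal

/-- The structure maps of the cross coproduct are the ones that the coactions of `A ⊗ A` on
comodules prescribe. -/
theorem isCompatible_comoduleCoact (hβ : IsRepresentable β)
    (h : IsCompatible β μ[A] η[A] Δ[A] ε[A]) :
    IsCompatible (comoduleCoact β A) (braidedTensorMul A A) (tensorOne A A)
      (crossComul A A (adjointCoaction A)) (tensorCounit A A) where
  comul M := by
    change iter (iter (taut β M.X) M.coact) (iter (taut β M.X) M.coact) =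
      iter (taut β M.X) M.coact ≫ M.X ◁ crossComul A A (adjointCoaction A)
    rw [iter_comoduleCoact h, h.taut_self hβ]
  counit M := by
    change iter (taut β M.X) M.coact ≫ M.X ◁ tensorCounit A A = (ρ_ M.X).inv
    rw [tensorCounit, MonoidalCategory.whiskerLeft_comp, ← Category.assoc, ← iter_whiskerLeft,
      h.taut_counit, M.coact_counit, iter_rightUnitor_inv_left]
    simp
  mul M N := by
    change 𝟙 _ ≫ iter (taut β (M.X ⊗ N.X)) (tensorCoact M.coact N.coact) =
      (tens (iter (taut β M.X) M.coact) (iter (taut β N.X) N.coact) ≫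
        (M.X ⊗ N.X) ◁ braidedTensorMul A A) ≫ 𝟙 _ ▷ (A ⊗ A)
    rw [h.taut_tensor, tensorCoact_eq_tens, tensorCoact_eq_tens, iter_whiskerLeft, ← tens_iter,
      braidedTensorMul]
    simp only [MonoidalCategory.whiskerLeft_comp, Category.assoc, Category.id_comp,
      MonoidalCategory.id_whiskerRight, Category.comp_id]
  one := by
    change 𝟙 _ ≫ iter (taut β (𝟙_ C)) (unitCoact A) =
      ((λ_ (𝟙_ C)).inv ≫ 𝟙_ C ◁ tensorOne A A) ≫ 𝟙 _ ▷ (A ⊗ A)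
    rw [h.taut_unit, unitCoact, iter_whiskerLeft, tensorOne]
    have k3 : iter (λ_ (𝟙_ C)).inv (λ_ (𝟙_ C)).inv = (λ_ (𝟙_ C)).inv ≫ 𝟙_ C ◁ (λ_ (𝟙_ C)).inv := by
      simp [iter, unitors_inv_equal]
    rw [k3]
    simp only [MonoidalCategory.whiskerLeft_comp, Category.assoc, Category.id_comp,
      MonoidalCategory.id_whiskerRight, Category.comp_id]

end CrossCoproduct

section CrossCoproductAntipode

variable {C : Type u} [Category.{v} C] [MonoidalCategory C]

theorem kleisli_whiskerLeft {A P : C} [MonObj A] [MonObj P] (i : A ⟶ P) [IsMonHom i] {X Y Z : C}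
    (g : Y ⟶ Z ⊗ A) (f : X ⟶ Y ⊗ A) :
    kleisli (g ≫ Z ◁ i) (f ≫ Y ◁ i) = kleisli g f ≫ Z ◁ i := by
  simp only [kleisli, Category.assoc, MonoidalCategory.comp_whiskerRight]
  rw [whisker_exchange_assoc, ← MonoidalCategory.whiskerLeft_comp, IsMonHom.mul_hom,
    MonoidalCategory.tensorHom_def']
  simp

theorem kleisliId_whiskerLeft {A P : C} [MonObj A] [MonObj P] (i : A ⟶ P) [IsMonHom i] (X : C) :
    kleisliId A X ≫ X ◁ i = kleisliId P X := by
  simp only [kleisliId, Category.assoc]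
  rw [← MonoidalCategory.whiskerLeft_comp, IsMonHom.one_hom]

variable [BraidedCategory C] {A : C} [HopfObj A]

/-- A coaction is invertible for the Kleisli composition, the inverse being its composite with the
antipode. -/
theorem kleisli_antipode_left {X : C} {r : X ⟶ X ⊗ A}
    (hc : r ≫ r ▷ A ≫ (α_ X A A).hom = r ≫ X ◁ Δ[A]) (hu : r ≫ X ◁ ε[A] = (ρ_ X).inv) :
    kleisli (r ≫ X ◁ 𝒮[A]) r = kleisliId A X := by
  rw [kleisli_eq_iter, iter_whiskerLeft_left, iter, hc, Category.assoc, Category.assoc,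
    ← MonoidalCategory.whiskerLeft_comp, ← MonoidalCategory.whiskerLeft_comp,
    HopfObj.antipode_left, MonoidalCategory.whiskerLeft_comp, reassoc_of% hu, kleisliId]

theorem kleisli_antipode_right {X : C} {r : X ⟶ X ⊗ A}
    (hc : r ≫ r ▷ A ≫ (α_ X A A).hom = r ≫ X ◁ Δ[A]) (hu : r ≫ X ◁ ε[A] = (ρ_ X).inv) :
    kleisli r (r ≫ X ◁ 𝒮[A]) = kleisliId A X := by
  rw [kleisli_eq_iter, iter_whiskerLeft_right, iter, hc, Category.assoc, Category.assoc,
    ← MonoidalCategory.whiskerLeft_comp, ← MonoidalCategory.whiskerLeft_comp,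
    HopfObj.antipode_right, MonoidalCategory.whiskerLeft_comp, reassoc_of% hu, kleisliId]

/-- The iterate of two Kleisli invertible endomorphisms over `A` and `B` is Kleisli invertible over
`A ⊗ B`. -/
theorem exists_kleisli_inverse_iter {A B : C} [MonObj A] [MonObj B] {X : C} {b b' : X ⟶ X ⊗ A}
    {r r' : X ⟶ X ⊗ B} (hb : kleisli b' b = kleisliId A X) (hb' : kleisli b b' = kleisliId A X)
    (hr : kleisli r' r = kleisliId B X) (hr' : kleisli r r' = kleisliId B X) :
    ∃ t : X ⟶ X ⊗ (A ⊗ B), kleisli t (iter b r) = kleisliId (A ⊗ B) X ∧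
      kleisli (iter b r) t = kleisliId (A ⊗ B) X := by
  have hη (H : C) [MonObj H] : IsMonHom η[H] :=
    { mul_hom := by simp [unitors_equal] }
  -- Along the algebra morphisms `a ↦ a ⊗ 1` and `b ↦ 1 ⊗ b` the iterate becomes a Kleisli
  -- composite, since `(a ⊗ 1) (1 ⊗ b) = a ⊗ b`.
  obtain ⟨i, hi, hi'⟩ : ∃ i : A ⟶ A ⊗ B, IsMonHom i ∧ i = (ρ_ A).inv ≫ A ◁ η[B] :=
    ⟨_, inferInstance, rfl⟩
  obtain ⟨j, hj, hj'⟩ : ∃ j : B ⟶ A ⊗ B, IsMonHom j ∧ j = (λ_ B).inv ≫ η[A] ▷ B :=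
    ⟨_, inferInstance, rfl⟩
  have hij : (i ⊗ₘ j) ≫ μ[A ⊗ B] = 𝟙 _ := by
    have h1 : ((ρ_ A).inv ⊗ₘ (λ_ B).inv) ≫ tensorμ A (𝟙_ C) (𝟙_ C) B =
        ((ρ_ A).inv ⊗ₘ (λ_ B).inv) := by
      rw [tensorμ, braiding_tensorUnit_right]
      monoidal
    have h2 := tensorμ_natural (𝟙 A) η[B] η[A] (𝟙 B)
    rw [hi', hj', MonObj.tensorObj.mul_def, ← id_tensorHom, ← tensorHom_id,
      ← tensorHom_comp_tensorHom, Category.assoc, reassoc_of% h2, reassoc_of% h1]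
    simp only [tensorHom_comp_tensorHom, id_tensorHom, tensorHom_id, MonObj.mul_one,
      MonObj.one_mul, Iso.inv_hom_id, MonoidalCategory.id_whiskerRight]
  have h : iter b r = kleisli (b ≫ X ◁ i) (r ≫ X ◁ j) := by
    rw [kleisli_eq_iter, iter_whiskerLeft, Category.assoc, ← MonoidalCategory.whiskerLeft_comp, hij]
    simp
  refine ⟨kleisli (r' ≫ X ◁ j) (b' ≫ X ◁ i), ?_, ?_⟩
  · rw [h, kleisli_assoc, ← kleisli_assoc _ (b ≫ _), kleisli_whiskerLeft, hb,
      kleisliId_whiskerLeft, kleisli_id_left, kleisli_whiskerLeft, hr, kleisliId_whiskerLeft]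
  · rw [h, kleisli_assoc, ← kleisli_assoc _ (r' ≫ _), kleisli_whiskerLeft, hr',
      kleisliId_whiskerLeft, kleisli_id_left, kleisli_whiskerLeft, hb', kleisliId_whiskerLeft]

/-- If `(A ⊗ A, comoduleCoact β A)` represents, then the reconstructed braided group is the cross
coproduct by the adjoint coaction. -/
theorem exists_isReconstruction_comoduleCoact {β : 𝟭 C ⟶ 𝟭 C ⋙ tensorRight A}
    (hβ : IsRepresentable β) (hβ' : IsRepresentable (comoduleCoact β A))
    (h : IsCompatible β μ[A] η[A] Δ[A] ε[A]) :
    ∃ sq : HopfObj (A ⊗ A),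
      IsReconstruction (Comodule.forget A) (Hopf.mk (A ⊗ A) (hopf := sq)) (comoduleCoact β A) ∧
        IsCrossCoproduct (adjointCoaction A) sq := by
  have h' := isCompatible_comoduleCoact hβ h
  have hk (M : Comodule A) := exists_kleisli_inverse_iter
    (kleisli_antipode_left (h.taut_comul M.X) (h.taut_counit M.X))
    (kleisli_antipode_right (h.taut_comul M.X) (h.taut_counit M.X))
    (kleisli_antipode_left M.coact_coassoc M.coact_counit)
    (kleisli_antipode_right M.coact_coassoc M.coact_counit)
  choose σ hl hr using hk
  obtain ⟨sq, hsq⟩ := IsCompatible.exists_hopfObj (b := h'.bimonObj hβ') hβ' h' σ hl hr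
  refine ⟨sq, IsCompatible.isReconstruction (β := comoduleCoact β A) hβ' ?_, ?_⟩
  · rw [hsq]
    exact h'
  · constructor <;> rw [hsq] <;> rfl

end CrossCoproductAntipode

/-! ### Coactions on tensor products of families -/

section Families

variable {C : Type u} [Category.{v} C] [MonoidalCategory C] [BraidedCategory C]

/-- The braided interchange `⨂ᵢ (Xᵢ ⊗ Yᵢ) ≅ (⨂ᵢ Xᵢ) ⊗ (⨂ᵢ Yᵢ)`, which moves the `Yᵢ` to the right
and keeps their order. -/
def unshuffle : (n : ℕ) → (X Y : Fin n → C) →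
    (tensorFamily n (fun i => X i ⊗ Y i) ≅ tensorFamily n X ⊗ tensorFamily n Y)
  | 0, _, _ => (λ_ (𝟙_ C)).symm
  | n + 1, X, Y =>
    whiskerLeftIso (X 0 ⊗ Y 0) (unshuffle n (fun i => X i.succ) (fun i => Y i.succ)) ≪≫
      { hom := tensorμ (X 0) (Y 0) (tensorFamily n fun i => X i.succ)
          (tensorFamily n fun i => Y i.succ)
        inv := tensorδ (X 0) (Y 0) (tensorFamily n fun i => X i.succ)
          (tensorFamily n fun i => Y i.succ)
        hom_inv_id := tensorμ_tensorδ _ _ _ _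
        inv_hom_id := tensorδ_tensorμ _ _ _ _ }

theorem unshuffle_natural : ∀ (n : ℕ) {X Y X' Y' : Fin n → C} (f : ∀ i, X i ⟶ X' i)
    (g : ∀ i, Y i ⟶ Y' i), tensorFamilyMap n (fun i => f i ⊗ₘ g i) ≫ (unshuffle n X' Y').hom =
      (unshuffle n X Y).hom ≫ (tensorFamilyMap n f ⊗ₘ tensorFamilyMap n g)
  | 0, _, _, _, _, _, _ => by
    change 𝟙 (𝟙_ C) ≫ (λ_ (𝟙_ C)).inv = (λ_ (𝟙_ C)).inv ≫ (𝟙 (𝟙_ C) ⊗ₘ 𝟙 (𝟙_ C))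
    simp
  | n + 1, X, Y, X', Y', f, g => by
    have h := unshuffle_natural n (fun i => f i.succ) (fun i => g i.succ)
    have h1 := tensorμ_natural (f 0) (g 0) (tensorFamilyMap n fun i => f i.succ)
      (tensorFamilyMap n fun i => g i.succ)
    change ((f 0 ⊗ₘ g 0) ⊗ₘ tensorFamilyMap n fun i => f i.succ ⊗ₘ g i.succ) ≫
        (X' 0 ⊗ Y' 0) ◁ (unshuffle n (fun i => X' i.succ) fun i => Y' i.succ).hom ≫
          tensorμ _ _ _ _ =
      ((X 0 ⊗ Y 0) ◁ (unshuffle n (fun i => X i.succ) fun i => Y i.succ).hom ≫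
        tensorμ _ _ _ _) ≫ ((f 0 ⊗ₘ tensorFamilyMap n fun i => f i.succ) ⊗ₘ
          (g 0 ⊗ₘ tensorFamilyMap n fun i => g i.succ))
    rw [Category.assoc, ← h1, ← id_tensorHom, ← id_tensorHom, tensorHom_comp_tensorHom_assoc,
      tensorHom_comp_tensorHom_assoc, Category.id_comp, Category.comp_id, h]

/-- Apply `Xᵢ ⟶ Xᵢ ⊗ Pᵢ` to each factor of `⨂ᵢ Xᵢ` and move the `Pᵢ` to the right. -/
def coactFamily (n : ℕ) {X P : Fin n → C} (r : ∀ i, X i ⟶ X i ⊗ P i) :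
    tensorFamily n X ⟶ tensorFamily n X ⊗ tensorFamily n P :=
  tensorFamilyMap n r ≫ (unshuffle n X P).hom

theorem coactFamily_zero {X P : Fin 0 → C} (r : ∀ i, X i ⟶ X i ⊗ P i) :
    coactFamily 0 r = (λ_ (𝟙_ C)).inv := Category.id_comp _

theorem coactFamily_succ (n : ℕ) {X P : Fin (n + 1) → C} (r : ∀ i, X i ⟶ X i ⊗ P i) :
    coactFamily (n + 1) r = tens (r 0) (coactFamily n fun i => r i.succ) := by
  change (r 0 ⊗ₘ tensorFamilyMap n fun i => r i.succ) ≫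
      (X 0 ⊗ P 0) ◁ (unshuffle n (fun i => X i.succ) fun i => P i.succ).hom ≫
        tensorμ _ _ _ _ =
    (r 0 ⊗ₘ (tensorFamilyMap n fun i => r i.succ) ≫
      (unshuffle n (fun i => X i.succ) fun i => P i.succ).hom) ≫ tensorμ _ _ _ _
  rw [← id_tensorHom, tensorHom_comp_tensorHom_assoc, Category.comp_id]

theorem coactPowerApp_eq_coactFamily {D : Type u'} [Category.{v'} D] {F : D ⥤ C} {H : C}
    (β : F ⟶ F ⋙ tensorRight H) : ∀ (n : ℕ) (X : Fin n → D),
    coactPowerApp β n X = coactFamily n (fun i => coactAt β (X i))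
  | 0, X => (coactFamily_zero _).symm
  | n + 1, X => by
    rw [coactFamily_succ, ← coactPowerApp_eq_coactFamily β n]
    rfl

theorem coactFamily_natural (n : ℕ) {X Y P : Fin n → C} {r : ∀ i, X i ⟶ X i ⊗ P i}
    {s : ∀ i, Y i ⟶ Y i ⊗ P i} {f : ∀ i, X i ⟶ Y i} (h : ∀ i, f i ≫ s i = r i ≫ f i ▷ P i) :
    tensorFamilyMap n f ≫ coactFamily n s =
      coactFamily n r ≫ tensorFamilyMap n f ▷ tensorFamily n P := by
  have h1 := unshuffle_natural n f (fun i => 𝟙 (P i))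
  rw [tensorFamilyMap_id, tensorHom_id] at h1
  rw [coactFamily, coactFamily, Category.assoc, ← h1, ← Category.assoc, ← Category.assoc,
    ← tensorFamilyMap_comp, ← tensorFamilyMap_comp]
  simp only [h, tensorHom_id]

theorem coactFamily_iter : ∀ (n : ℕ) {X P Q : Fin n → C} (r : ∀ i, X i ⟶ X i ⊗ P i)
    (s : ∀ i, X i ⟶ X i ⊗ Q i),
    coactFamily n (fun i => iter (r i) (s i)) ≫ tensorFamily n X ◁ (unshuffle n P Q).hom =
      iter (coactFamily n r) (coactFamily n s)
  | 0, X, P, Q, r, s => by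
    rw [coactFamily_zero, coactFamily_zero, coactFamily_zero]
    change (λ_ (𝟙_ C)).inv ≫ 𝟙_ C ◁ (λ_ (𝟙_ C)).inv = iter (λ_ (𝟙_ C)).inv (λ_ (𝟙_ C)).inv
    simp [iter, unitors_inv_equal]
  | n + 1, X, P, Q, r, s => by
    have h := coactFamily_iter n (fun i => r i.succ) (fun i => s i.succ)
    have h1 := tens_whiskerLeft (iter (r 0) (s 0))
      (coactFamily n fun i => iter (r i.succ) (s i.succ)) (𝟙 _)
      (unshuffle n (fun i => P i.succ) (fun i => Q i.succ)).hom
    rw [MonoidalCategory.whiskerLeft_id, Category.comp_id, id_tensorHom, h] at h1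
    rw [coactFamily_succ, coactFamily_succ, coactFamily_succ]
    change tens (iter (r 0) (s 0)) (coactFamily n fun i => iter (r i.succ) (s i.succ)) ≫
      (X 0 ⊗ tensorFamily n fun i => X i.succ) ◁ ((P 0 ⊗ Q 0) ◁
        (unshuffle n (fun i => P i.succ) fun i => Q i.succ).hom ≫ tensorμ _ _ _ _) =
      iter (tens (r 0) (coactFamily n fun i => r i.succ))
        (tens (s 0) (coactFamily n fun i => s i.succ))
    rw [← tens_iter, h1, Category.assoc, ← MonoidalCategory.whiskerLeft_comp]

/-- If the `fᵢ` intertwine the inner coactions only, they can be moved between the two. -/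
theorem iter_coactFamily_natural (n : ℕ) {X Y P Q : Fin n → C} {r : ∀ i, X i ⟶ X i ⊗ P i}
    {r' : ∀ i, Y i ⟶ Y i ⊗ P i} (s : ∀ i, Y i ⟶ Y i ⊗ Q i) {f : ∀ i, Y i ⟶ X i}
    (h : ∀ i, f i ≫ r i = r' i ≫ f i ▷ P i) :
    iter (coactFamily n r') (coactFamily n s) ≫
      tensorFamilyMap n f ▷ (tensorFamily n P ⊗ tensorFamily n Q) =
    tensorFamilyMap n (fun i => s i ≫ f i ▷ Q i) ≫ (unshuffle n X Q).hom ≫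
      coactFamily n r ▷ tensorFamily n Q ≫ (α_ _ _ _).hom := by
  have h1 := coactFamily_natural n h
  have h2 := unshuffle_natural n f (fun i => 𝟙 (Q i))
  rw [tensorFamilyMap_id, tensorHom_id] at h2
  rw [tensorFamilyMap_comp, Category.assoc]
  simp only [tensorHom_id] at h2
  rw [reassoc_of% h2, ← MonoidalCategory.comp_whiskerRight_assoc, h1]
  simp [iter, coactFamily]

end Families

section RepresentableFamilies

variable {C : Type u} [Category.{v} C] [MonoidalCategory C] [BraidedCategory C]
variable {D : Type u'} [Category.{v'} D] {F : D ⥤ C} {H : C} {β : F ⟶ F ⋙ tensorRight H}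

theorem theta_app_eq (n : ℕ) {V : C} (φ : objPower H n ⟶ V) (X : Fin n → D) :
    (theta β n V φ).app X =
      coactFamily n (fun i => coactAt β (X i)) ≫ tensorFamily n (fun i => F.obj (X i)) ◁ φ := by
  rw [theta_app, coactPowerApp_eq_coactFamily]
  rfl

theorem IsRepresentable.hom_ext_family (hβ : IsRepresentable β) (n : ℕ) {V : C}
    {φ ψ : objPower H n ⟶ V} (h : ∀ X : Fin n → D,
      coactFamily n (fun i => coactAt β (X i)) ≫ tensorFamily n (fun i => F.obj (X i)) ◁ φ =
      coactFamily n (fun i => coactAt β (X i)) ≫ tensorFamily n (fun i => F.obj (X i)) ◁ ψ) :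
    φ = ψ := by
  refine (hβ n V).1 ?_
  ext X
  rw [theta_app_eq, theta_app_eq, h]

theorem IsRepresentable.exists_hom_family (hβ : IsRepresentable β) (n : ℕ) {V : C}
    (τ : ∀ X : Fin n → D, tensorFamily n (fun i => F.obj (X i)) ⟶
      tensorFamily n (fun i => F.obj (X i)) ⊗ V)
    (hτ : ∀ {X Y : Fin n → D} (f : ∀ i, X i ⟶ Y i),
      tensorFamilyMap n (fun i => F.map (f i)) ≫ τ Y =
        τ X ≫ tensorFamilyMap n (fun i => F.map (f i)) ▷ V) :
    ∃ φ : objPower H n ⟶ V, ∀ X,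
      coactFamily n (fun i => coactAt β (X i)) ≫ tensorFamily n (fun i => F.obj (X i)) ◁ φ =
        τ X := by
  obtain ⟨φ, hφ⟩ := (hβ n V).2 { app := τ, naturality := fun X Y f => hτ f }
  refine ⟨φ, fun X => ?_⟩
  rw [← theta_app_eq, hφ]

end RepresentableFamilies

section Transposition

variable {C : Type u} [Category.{v} C] [MonoidalCategory C]

/-- Transposing `Y` in the family represented by `φ : P ⊗ Y ⟶ V` gives the family represented by the
transpose of `φ`. -/
theorem tensorRightHomEquiv_whiskerLeft {X P Y D V : C} [ExactPairing Y D] (r : X ⟶ X ⊗ P)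
    (φ : P ⊗ Y ⟶ V) :
    tensorRightHomEquiv X Y D (X ⊗ V) (r ▷ Y ≫ (α_ X P Y).hom ≫ X ◁ φ) ≫ (α_ X V D).hom =
      r ≫ X ◁ tensorRightHomEquiv P Y D V φ := by
  simp only [tensorRightHomEquiv, Equiv.coe_fn_mk, Category.assoc]
  calc _ = 𝟙 _ ⊗≫ (X ◁ η_ Y D ≫ r ▷ (Y ⊗ D)) ⊗≫ X ◁ φ ▷ D ⊗≫ 𝟙 _ := by monoidal
    _ = _ := by rw [whisker_exchange]; monoidal

theorem tensorRightHomEquiv_natural {X X' Y D V : C} [ExactPairing Y D] {f : X ⟶ X'}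
    {s : X ⊗ Y ⟶ X ⊗ V} {s' : X' ⊗ Y ⟶ X' ⊗ V} (h : f ▷ Y ≫ s' = s ≫ f ▷ V) :
    f ≫ tensorRightHomEquiv X' Y D (X' ⊗ V) s' ≫ (α_ X' V D).hom =
      (tensorRightHomEquiv X Y D (X ⊗ V) s ≫ (α_ X V D).hom) ≫ f ▷ (V ⊗ D) := by
  simp only [tensorRightHomEquiv, Equiv.coe_fn_mk, Category.assoc]
  calc _ = 𝟙 _ ⊗≫ (f ▷ 𝟙_ C ≫ X' ◁ η_ Y D) ⊗≫ s' ▷ D ⊗≫ 𝟙 _ := by monoidal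
    _ = 𝟙 _ ⊗≫ X ◁ η_ Y D ⊗≫ (f ▷ Y ≫ s') ▷ D ⊗≫ 𝟙 _ := by rw [← whisker_exchange]; monoidal
    _ = _ := by rw [h]; monoidal

end Transposition

section Cofree

variable {C : Type u} [Category.{v} C] [MonoidalCategory C]

namespace Comodule

/-- The cofree comodule `X ⊗ B`. -/
@[simps]
def cofree (B : C) [ComonObj B] (X : C) : Comodule B where
  X := X ⊗ B
  coact := X ◁ Δ[B] ≫ (α_ X B B).inv
  coact_counit := by
    rw [Category.assoc, ← associator_inv_naturality_right,
      ← MonoidalCategory.whiskerLeft_comp_assoc, ComonObj.comul_counit]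
    simp
  coact_coassoc := by
    simp only [Category.assoc, MonoidalCategory.comp_whiskerRight]
    have h := congrArg (fun t => X ◁ t ≫ (α_ X B (B ⊗ B)).inv) (ComonObj.comul_assoc B)
    simp only [MonoidalCategory.whiskerLeft_comp, Category.assoc] at h
    rw [← associator_inv_naturality_right, h]
    monoidal

/-- The cofree comodule is functorial. -/
def cofreeMap (B : C) [ComonObj B] {X Y : C} (f : X ⟶ Y) : cofree B X ⟶ cofree B Y where
  hom := f ▷ B
  comm := by
    change (X ◁ Δ[B] ≫ (α_ X B B).inv) ≫ f ▷ B ▷ B = f ▷ B ≫ Y ◁ Δ[B] ≫ (α_ Y B B).inv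
    rw [← whisker_exchange_assoc]
    simp

/-- The coaction of a comodule, as a morphism to a cofree comodule. -/
def toCofree {B : C} [ComonObj B] (M : Comodule B) : M ⟶ cofree B M.X where
  hom := M.coact
  comm := by
    change M.coact ≫ M.coact ▷ B = M.coact ≫ M.X ◁ Δ[B] ≫ (α_ M.X B B).inv
    rw [← reassoc_of% M.coact_coassoc]
    simp

end Comodule
end Cofree

section RepresentableComodule

variable {C : Type u} [Category.{v} C] [MonoidalCategory C] [BraidedCategory C] {A B : C}
  [ComonObj B] {β : 𝟭 C ⟶ 𝟭 C ⋙ tensorRight A}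

/-- A morphism `Aⁿ ⊗ P ⟶ V` is determined by the natural family `⨂ᵢ Xᵢ ⊗ P ⟶ ⨂ᵢ Xᵢ ⊗ V` that it
induces: this is the injectivity in the representability condition for the object `V ⊗ P*`. -/
theorem IsRepresentable.hom_ext_tensor [RightRigidCategory C] (hβ : IsRepresentable β) (n : ℕ)
    {P V : C} {φ ψ : objPower A n ⊗ P ⟶ V} (h : ∀ X : Fin n → C,
      coactFamily n (fun i => taut β (X i)) ▷ P ≫ (α_ (tensorFamily n X) (objPower A n) P).hom ≫
        tensorFamily n X ◁ φ =
      coactFamily n (fun i => taut β (X i)) ▷ P ≫ (α_ (tensorFamily n X) (objPower A n) P).hom ≫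
        tensorFamily n X ◁ ψ) : φ = ψ := by
  refine (tensorRightHomEquiv _ P Pᘁ _).injective (hβ.hom_ext_family n fun X => ?_)
  change coactFamily n (fun i => taut β (X i)) ≫ tensorFamily n X ◁ _ =
    coactFamily n (fun i => taut β (X i)) ≫ tensorFamily n X ◁ _
  exact ((tensorRightHomEquiv_whiskerLeft (D := Pᘁ) _ φ).symm.trans
    (congrArg (fun t => tensorRightHomEquiv _ P Pᘁ _ t ≫ (α_ _ V Pᘁ).hom) (h X))).trans
    (tensorRightHomEquiv_whiskerLeft _ ψ)

/-- Every natural family `⨂ᵢ Xᵢ ⊗ P ⟶ ⨂ᵢ Xᵢ ⊗ V` is induced by a morphism `Aⁿ ⊗ P ⟶ V`: this is the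
surjectivity in the representability condition for the object `V ⊗ P*`. -/
theorem IsRepresentable.exists_hom_tensor [RightRigidCategory C] (hβ : IsRepresentable β) (n : ℕ)
    {P V : C} (σ : ∀ X : Fin n → C, tensorFamily n X ⊗ P ⟶ tensorFamily n X ⊗ V)
    (hσ : ∀ {X Y : Fin n → C} (f : ∀ i, X i ⟶ Y i),
      tensorFamilyMap n f ▷ P ≫ σ Y = σ X ≫ tensorFamilyMap n f ▷ V) :
    ∃ φ : objPower A n ⊗ P ⟶ V, ∀ X,
      coactFamily n (fun i => taut β (X i)) ▷ P ≫ (α_ (tensorFamily n X) (objPower A n) P).hom ≫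
        tensorFamily n X ◁ φ = σ X := by
  obtain ⟨χ, hχ⟩ := hβ.exists_hom_family n (V := V ⊗ Pᘁ)
    (fun X => tensorRightHomEquiv (tensorFamily n X) P Pᘁ (tensorFamily n X ⊗ V) (σ X) ≫
      (α_ (tensorFamily n X) V Pᘁ).hom) (fun f => tensorRightHomEquiv_natural (hσ f))
  refine ⟨(tensorRightHomEquiv _ P Pᘁ _).symm χ, fun X => ?_⟩
  refine (tensorRightHomEquiv _ P Pᘁ _).injective ?_
  rw [← cancel_mono (α_ (tensorFamily n X) V Pᘁ).hom]
  refine (tensorRightHomEquiv_whiskerLeft _ _).trans ?_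
  refine Eq.trans ?_ (hχ X)
  exact congrArg (fun t => coactFamily n (fun i => taut β (X i)) ≫ tensorFamily n X ◁ t)
    (Equiv.apply_symm_apply _ χ)

end RepresentableComodule

/-! ### Representability for the forgetful functor of comodules -/

section CofreeCounit

variable {C : Type u} [Category.{v} C] [MonoidalCategory C] {B : C} [ComonObj B]

namespace Comodule

/-- The counit `X ⊗ B ⟶ X` of the cofree comodule. -/
def cofreeCounit (B : C) [ComonObj B] (X : C) : X ⊗ B ⟶ X := X ◁ ε[B] ≫ (ρ_ X).hom

/-- The coaction is a section of the cofree counit; with `toCofree` this makes every natural family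
on comodules determined by its values on cofree ones. -/
theorem coact_cofreeCounit (M : Comodule B) : M.coact ≫ cofreeCounit B M.X = 𝟙 M.X := by
  rw [cofreeCounit, reassoc_of% M.coact_counit, Iso.inv_hom_id]

theorem cofree_coact_cofreeCounit (X : C) :
    (X ◁ Δ[B] ≫ (α_ X B B).inv) ≫ cofreeCounit B X ▷ B = 𝟙 (X ⊗ B) := by
  rw [cofreeCounit, MonoidalCategory.comp_whiskerRight, Category.assoc,
    ← associator_inv_naturality_middle_assoc, ← MonoidalCategory.whiskerLeft_comp_assoc,
    ComonObj.counit_comul]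
  simp

theorem cofreeCounit_natural {X Y : C} (f : X ⟶ Y) :
    f ▷ B ≫ cofreeCounit B Y = cofreeCounit B X ≫ f := by
  rw [cofreeCounit, cofreeCounit, ← whisker_exchange_assoc, rightUnitor_naturality, Category.assoc]

end Comodule

end CofreeCounit

section RepresentableComodule

variable {C : Type u} [Category.{v} C] [MonoidalCategory C] [BraidedCategory C] {A B : C}
  [ComonObj B] {β : 𝟭 C ⟶ 𝟭 C ⋙ tensorRight A}

/-- The iterated coaction of `A ⊗ B` on comodules `Mᵢ`, in terms of the iterated coactions of `A`
and of `B`. -/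
theorem theta_comoduleCoact_app (n : ℕ) {V : C}
    (φ : tensorFamily n (fun _ => A) ⊗ tensorFamily n (fun _ => B) ⟶ V)
    (M : Fin n → Comodule B) :
    (theta (comoduleCoact β B) n V ((unshuffle n (fun _ => A) fun _ => B).hom ≫ φ)).app M =
      iter (coactFamily n fun i => taut β (M i).X) (coactFamily n fun i => (M i).coact) ≫
        tensorFamily n (fun i => (M i).X) ◁ φ := by
  rw [theta_app_eq, ← coactFamily_iter, Category.assoc, ← MonoidalCategory.whiskerLeft_comp]
  rfl

/-- At cofree comodules, and followed by their counits, `theta` for `A ⊗ B` is `theta` for `A`, with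
the coefficients in `Bⁿ` carried along. -/
theorem theta_comoduleCoact_cofree (n : ℕ) {V : C}
    (φ : tensorFamily n (fun _ => A) ⊗ tensorFamily n (fun _ => B) ⟶ V) (X : Fin n → C) :
    (iter (coactFamily n fun i => taut β (X i ⊗ B))
      (coactFamily n fun i => X i ◁ Δ[B] ≫ (α_ (X i) B B).inv) ≫
        tensorFamily n (fun i => X i ⊗ B) ◁ φ) ≫
          tensorFamilyMap n (fun i => Comodule.cofreeCounit B (X i)) ▷ V =
      (unshuffle n X fun _ => B).hom ≫ coactFamily n (fun i => taut β (X i)) ▷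
        tensorFamily n (fun _ => B) ≫ (α_ _ _ _).hom ≫ tensorFamily n X ◁ φ := by
  rw [Category.assoc, whisker_exchange, ← Category.assoc,
    iter_coactFamily_natural n _ fun i => taut_natural β (Comodule.cofreeCounit B (X i))]
  simp only [Comodule.cofree_coact_cofreeCounit]
  rw [tensorFamilyMap_id, Category.id_comp]
  simp only [Category.assoc]

/-- If `A` represents for the identity functor, then `A ⊗ B` represents for the forgetful functor
of `B`-comodules. -/
theorem IsRepresentable.comoduleCoact [RightRigidCategory C] (hβ : IsRepresentable β) :
    IsRepresentable (comoduleCoact β B) := by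
  refine fun n V => ⟨fun φ ψ h => ?_, fun τ => ?_⟩
  · obtain ⟨φ, rfl⟩ : ∃ φ', φ = (unshuffle n (fun _ => A) fun _ => B).hom ≫ φ' :=
      ⟨_, (Iso.hom_inv_id_assoc _ φ).symm⟩
    obtain ⟨ψ, rfl⟩ : ∃ ψ', ψ = (unshuffle n (fun _ => A) fun _ => B).hom ≫ ψ' :=
      ⟨_, (Iso.hom_inv_id_assoc _ ψ).symm⟩
    congr 1
    refine hβ.hom_ext_tensor n fun X => ?_
    rw [← cancel_epi (unshuffle n X fun _ => B).hom]
    refine (theta_comoduleCoact_cofree n φ X).symm.trans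
      (Eq.trans ?_ (theta_comoduleCoact_cofree n ψ X))
    have k := congrArg (fun t => t.app fun i => Comodule.cofree B (X i)) h
    exact congrArg (· ≫ _) ((theta_comoduleCoact_app n φ _).symm.trans
      (k.trans (theta_comoduleCoact_app n ψ _)))
  · obtain ⟨T, hT⟩ : ∃ T : ∀ M : Fin n → Comodule B, tensorFamily n (fun i => (M i).X) ⟶
        tensorFamily n (fun i => (M i).X) ⊗ V, ∀ M, T M = τ.app M :=
      ⟨fun M => τ.app M, fun _ => rfl⟩
    have hnat : ∀ {M N : Fin n → Comodule B} (f : ∀ i, M i ⟶ N i),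
        tensorFamilyMap n (fun i => (f i).hom) ≫ T N =
          T M ≫ tensorFamilyMap n (fun i => (f i).hom) ▷ V := fun {M N} f => by
      rw [hT, hT]
      exact τ.naturality (X := M) (Y := N) f
    -- the transformation on cofree comodules, stripped of the last tensor factors
    let σ (X : Fin n → C) : tensorFamily n X ⊗ tensorFamily n (fun _ => B) ⟶
        tensorFamily n X ⊗ V :=
      (unshuffle n X fun _ => B).inv ≫ T (fun i => Comodule.cofree B (X i)) ≫
        tensorFamilyMap n (fun i => Comodule.cofreeCounit B (X i)) ▷ V
    have hσ : ∀ {X Y : Fin n → C} (f : ∀ i, X i ⟶ Y i),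
        tensorFamilyMap n f ▷ tensorFamily n (fun _ => B) ≫ σ Y =
          σ X ≫ tensorFamilyMap n f ▷ V := fun {X Y} f => by
      have h1 := unshuffle_natural n f (fun _ => 𝟙 B)
      rw [tensorFamilyMap_id, tensorHom_id] at h1
      simp only [tensorHom_id] at h1
      have h2 : tensorFamilyMap n (fun i => f i ▷ B) ≫ T (fun i => Comodule.cofree B (Y i)) =
          T (fun i => Comodule.cofree B (X i)) ≫ tensorFamilyMap n (fun i => f i ▷ B) ▷ V :=
        hnat fun i => Comodule.cofreeMap B (f i)
      have h3 : tensorFamilyMap n (fun i => f i ▷ B) ≫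
          tensorFamilyMap n (fun i => Comodule.cofreeCounit B (Y i)) =
          tensorFamilyMap n (fun i => Comodule.cofreeCounit B (X i)) ≫ tensorFamilyMap n f := by
        rw [← tensorFamilyMap_comp, ← tensorFamilyMap_comp]
        simp only [Comodule.cofreeCounit_natural]
      rw [← cancel_epi (unshuffle n X fun _ => B).hom]
      change (unshuffle n X fun _ => B).hom ≫ tensorFamilyMap n f ▷ tensorFamily n (fun _ => B) ≫
        (unshuffle n Y fun _ => B).inv ≫ T (fun i => Comodule.cofree B (Y i)) ≫
        tensorFamilyMap n (fun i => Comodule.cofreeCounit B (Y i)) ▷ V =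
        (unshuffle n X fun _ => B).hom ≫ ((unshuffle n X fun _ => B).inv ≫
          T (fun i => Comodule.cofree B (X i)) ≫
          tensorFamilyMap n (fun i => Comodule.cofreeCounit B (X i)) ▷ V) ≫
          tensorFamilyMap n f ▷ V
      rw [← reassoc_of% h1, Iso.hom_inv_id_assoc]
      simp only [Category.assoc]
      rw [Iso.hom_inv_id_assoc]
      refine (congrArg (· ≫ _) h2).trans ?_ |> (Category.assoc _ _ _).symm.trans
      refine (Category.assoc _ _ _).trans 
        ((congrArg (T (fun i => Comodule.cofree B (X i)) ≫ ·) ?_).trans (Category.assoc _ _ _).symm)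
      refine (MonoidalCategory.comp_whiskerRight _ _ _).symm.trans ?_
      refine (congrArg (· ▷ V) h3).trans ?_
      exact MonoidalCategory.comp_whiskerRight _ _ _
    obtain ⟨φ, hφ⟩ := hβ.exists_hom_tensor n σ hσ
    refine ⟨(unshuffle n (fun _ => A) fun _ => B).hom ≫ φ, ?_⟩
    ext M
    refine (theta_comoduleCoact_app n φ M).trans (Eq.trans ?_ (hT M))
    have h1 : coactFamily n (fun i => (M i).coact) ≫ σ (fun i => (M i).X) = T M := by
      have h2 : tensorFamilyMap n (fun i => (M i).coact) ≫
          T (fun i => Comodule.cofree B (M i).X) =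
          T M ≫ tensorFamilyMap n (fun i => (M i).coact) ▷ V :=
        hnat fun i => (M i).toCofree
      change (tensorFamilyMap n (fun i => (M i).coact) ≫
        (unshuffle n (fun i => (M i).X) fun _ => B).hom) ≫
        (unshuffle n (fun i => (M i).X) fun _ => B).inv ≫
        T (fun i => Comodule.cofree B (M i).X) ≫ _ = T M
      rw [Category.assoc, Iso.hom_inv_id_assoc]
      refine ((Category.assoc _ _ _).symm.trans (congrArg (· ≫ _) h2)).trans ?_
      refine (Category.assoc _ _ _).trans ?_
      refine (congrArg (T M ≫ ·) ?_).trans (Category.comp_id _)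
      refine (MonoidalCategory.comp_whiskerRight _ _ _).symm.trans ?_
      rw [← tensorFamilyMap_comp]
      simp only [Comodule.coact_cofreeCounit]
      rw [tensorFamilyMap_id, MonoidalCategory.id_whiskerRight]
    refine Eq.trans ?_ ((congrArg (coactFamily n (fun i => (M i).coact) ≫ ·)
      (hφ fun i => (M i).X)).trans h1)
    simp only [iter, Category.assoc]
    rfl

end RepresentableComodule

/-! ### The isomorphism between the cross coproduct and the cross product -/

section CrossIso

variable {C : Type u} [Category.{v} C] [MonoidalCategory C] [BraidedCategory C]
  (A : C) [HopfObj A]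

/-- The map `b ↦ b₃ ⊗ b₁ S(b₂) b₄`, with `b₁` and `S(b₂)` moved past `b₃`, is the coproduct. -/
theorem comul_adjointCoaction :
    Δ[A] ≫ A ◁ adjointCoaction A ≫ (α_ A A A).inv ≫ (β_ A A).hom ▷ A ≫ (α_ A A A).hom ≫
      A ◁ μ[A] = Δ[A] := by
  calc _ = 𝟙 _ ⊗≫ (Δ[A] ≫ A ◁ Δ[A]) ⊗≫ A ◁ 𝒮[A] ▷ A ⊗≫ A ◁ A ◁ Δ[A] ⊗≫ A ◁ (β_ A A).hom ▷ A ⊗≫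
          ((A ⊗ A) ◁ μ[A] ≫ (β_ A A).hom ▷ A) ⊗≫ A ◁ μ[A] := by
        rw [adjointCoaction]; monoidal
    _ = 𝟙 _ ⊗≫ Δ[A] ⊗≫ Δ[A] ▷ A ⊗≫ A ◁ 𝒮[A] ▷ A ⊗≫ A ◁ A ◁ Δ[A] ⊗≫ A ◁ (β_ A A).hom ▷ A ⊗≫
          (β_ A A).hom ▷ (A ⊗ A) ⊗≫ A ◁ ((α_ A A A).hom ≫ A ◁ μ[A] ≫ μ[A]) := by
        rw [whisker_exchange, ComonObj.comul_assoc]; monoidal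
    _ = 𝟙 _ ⊗≫ Δ[A] ⊗≫ Δ[A] ▷ A ⊗≫ A ◁ 𝒮[A] ▷ A ⊗≫ A ◁ A ◁ Δ[A] ⊗≫
          ((β_ (A ⊗ A) A).hom ≫ A ◁ μ[A]) ▷ A ⊗≫ A ◁ μ[A] := by
        rw [← MonObj.mul_assoc, BraidedCategory.braiding_tensor_left_hom]; monoidal
    _ = 𝟙 _ ⊗≫ Δ[A] ⊗≫ Δ[A] ▷ A ⊗≫ A ◁ 𝒮[A] ▷ A ⊗≫ ((A ⊗ A) ◁ Δ[A] ≫ μ[A] ▷ (A ⊗ A)) ⊗≫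
          (β_ A A).hom ▷ A ⊗≫ A ◁ μ[A] := by
        rw [← BraidedCategory.braiding_naturality_left]; monoidal
    _ = 𝟙 _ ⊗≫ Δ[A] ⊗≫ (Δ[A] ≫ A ◁ 𝒮[A] ≫ μ[A]) ▷ A ⊗≫ A ◁ Δ[A] ⊗≫
          (β_ A A).hom ▷ A ⊗≫ A ◁ μ[A] := by
        rw [whisker_exchange]; monoidal
    _ = 𝟙 _ ⊗≫ (Δ[A] ≫ ε[A] ▷ A) ⊗≫ (η[A] ▷ A ≫ A ◁ Δ[A]) ⊗≫
          (β_ A A).hom ▷ A ⊗≫ A ◁ μ[A] := by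
        rw [HopfObj.antipode_right]; monoidal
    _ = 𝟙 _ ⊗≫ Δ[A] ⊗≫ (η[A] ▷ A ≫ (β_ A A).hom) ▷ A ⊗≫ A ◁ μ[A] := by
        rw [← whisker_exchange, ComonObj.counit_comul]; monoidal
    _ = 𝟙 _ ⊗≫ Δ[A] ⊗≫ A ◁ (η[A] ▷ A ≫ μ[A]) := by
        rw [BraidedCategory.braiding_naturality_left, braiding_tensorUnit_left]; monoidal
    _ = Δ[A] := by rw [MonObj.one_mul]; monoidal

/-- The map `b ⊗ c ↦ b₁ c S(b₂) b₃`, with `b₂` and `b₃` moved past `c`, is the product. -/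
theorem adjointAction_mul :
    Δ[A] ▷ A ≫ (α_ A A A).hom ≫ A ◁ (β_ A A).hom ≫ (α_ A A A).inv ≫ adjointAction A ▷ A ≫ μ[A] =
      μ[A] := by
  calc _ = 𝟙 _ ⊗≫ Δ[A] ▷ A ⊗≫ (A ◁ (β_ A A).hom ≫ Δ[A] ▷ (A ⊗ A)) ⊗≫ A ◁ (β_ A A).hom ▷ A ⊗≫
          A ◁ A ◁ 𝒮[A] ▷ A ⊗≫ A ◁ μ[A] ▷ A ⊗≫ (μ[A] ▷ A ≫ μ[A]) := by
        rw [adjointAction]; monoidal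
    _ = 𝟙 _ ⊗≫ (Δ[A] ≫ Δ[A] ▷ A) ▷ A ⊗≫ A ◁ A ◁ (β_ A A).hom ⊗≫ A ◁ (β_ A A).hom ▷ A ⊗≫
          A ◁ A ◁ 𝒮[A] ▷ A ⊗≫ A ◁ μ[A] ▷ A ⊗≫ A ◁ μ[A] ⊗≫ μ[A] := by
        rw [whisker_exchange, MonObj.mul_assoc]; monoidal
    _ = 𝟙 _ ⊗≫ (Δ[A] ≫ Δ[A] ▷ A) ▷ A ⊗≫ A ◁ A ◁ (β_ A A).hom ⊗≫ A ◁ (β_ A A).hom ▷ A ⊗≫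
          A ◁ A ◁ 𝒮[A] ▷ A ⊗≫ A ◁ ((α_ A A A).hom ≫ A ◁ μ[A] ≫ μ[A]) ⊗≫ μ[A] := by
        rw [← MonObj.mul_assoc]; monoidal
    _ = 𝟙 _ ⊗≫ (Δ[A] ≫ Δ[A] ▷ A ≫ (α_ A A A).hom) ▷ A ⊗≫ A ◁ ((β_ (A ⊗ A) A).hom ≫
          A ◁ (𝒮[A] ▷ A ≫ μ[A])) ⊗≫ A ◁ μ[A] ⊗≫ μ[A] := by
        rw [BraidedCategory.braiding_tensor_left_hom]; monoidal
    _ = 𝟙 _ ⊗≫ Δ[A] ▷ A ⊗≫ A ◁ (Δ[A] ≫ 𝒮[A] ▷ A ≫ μ[A]) ▷ A ⊗≫ A ◁ (β_ A A).hom ⊗≫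
          A ◁ μ[A] ⊗≫ μ[A] := by
        rw [← BraidedCategory.braiding_naturality_left, ← ComonObj.comul_assoc]; monoidal
    _ = 𝟙 _ ⊗≫ (Δ[A] ≫ A ◁ ε[A]) ▷ A ⊗≫ A ◁ (η[A] ▷ A ≫ (β_ A A).hom) ⊗≫
          A ◁ μ[A] ⊗≫ μ[A] := by
        rw [HopfObj.antipode_left]; monoidal
    _ = 𝟙 _ ⊗≫ A ◁ (A ◁ η[A] ≫ μ[A]) ⊗≫ μ[A] := by
        rw [BraidedCategory.braiding_naturality_left, braiding_tensorUnit_left,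
          ComonObj.comul_counit]; monoidal
    _ = μ[A] := by rw [MonObj.mul_one]; monoidal

/-- The automorphism `a ⊗ b ↦ a b₁ ⊗ b₂` of `A ⊗ A`, with inverse `a ⊗ b ↦ a S(b₁) ⊗ b₂`. -/
@[simps]
def mulComulIso : A ⊗ A ≅ A ⊗ A where
  hom := A ◁ Δ[A] ≫ (α_ A A A).inv ≫ μ[A] ▷ A
  inv := A ◁ (Δ[A] ≫ 𝒮[A] ▷ A) ≫ (α_ A A A).inv ≫ μ[A] ▷ A
  hom_inv_id := by
    calc _ = 𝟙 _ ⊗≫ A ◁ Δ[A] ⊗≫ (μ[A] ▷ A ≫ A ◁ (Δ[A] ≫ 𝒮[A] ▷ A)) ⊗≫ μ[A] ▷ A := by monoidal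
      _ = 𝟙 _ ⊗≫ A ◁ (Δ[A] ≫ A ◁ Δ[A]) ⊗≫ A ◁ A ◁ 𝒮[A] ▷ A ⊗≫ (μ[A] ▷ A ≫ μ[A]) ▷ A := by
          rw [← whisker_exchange]; monoidal
      _ = 𝟙 _ ⊗≫ A ◁ Δ[A] ⊗≫ A ◁ (Δ[A] ≫ A ◁ 𝒮[A] ≫ μ[A]) ▷ A ⊗≫ μ[A] ▷ A := by
          rw [ComonObj.comul_assoc, MonObj.mul_assoc]; monoidal
      _ = 𝟙 _ ⊗≫ A ◁ (Δ[A] ≫ ε[A] ▷ A) ⊗≫ (A ◁ η[A] ≫ μ[A]) ▷ A := by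
          rw [HopfObj.antipode_right]; monoidal
      _ = 𝟙 _ := by rw [ComonObj.counit_comul, MonObj.mul_one]; monoidal
  inv_hom_id := by
    calc _ = 𝟙 _ ⊗≫ A ◁ (Δ[A] ≫ 𝒮[A] ▷ A) ⊗≫ (μ[A] ▷ A ≫ A ◁ Δ[A]) ⊗≫ μ[A] ▷ A := by monoidal
      _ = 𝟙 _ ⊗≫ A ◁ Δ[A] ⊗≫ A ◁ (𝒮[A] ▷ A ≫ A ◁ Δ[A]) ⊗≫ (μ[A] ▷ A ≫ μ[A]) ▷ A := by
          rw [← whisker_exchange]; monoidal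
      _ = 𝟙 _ ⊗≫ A ◁ (Δ[A] ≫ A ◁ Δ[A]) ⊗≫ A ◁ (𝒮[A] ▷ A ≫ μ[A]) ▷ A ⊗≫ μ[A] ▷ A := by
          rw [← whisker_exchange, MonObj.mul_assoc]; monoidal
      _ = 𝟙 _ ⊗≫ A ◁ Δ[A] ⊗≫ A ◁ (Δ[A] ≫ 𝒮[A] ▷ A ≫ μ[A]) ▷ A ⊗≫ μ[A] ▷ A := by
          rw [ComonObj.comul_assoc]; monoidal
      _ = 𝟙 _ ⊗≫ A ◁ (Δ[A] ≫ ε[A] ▷ A) ⊗≫ (A ◁ η[A] ≫ μ[A]) ▷ A := by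
          rw [HopfObj.antipode_left]; monoidal
      _ = 𝟙 _ := by rw [ComonObj.counit_comul, MonObj.mul_one]; monoidal

theorem tensorOne_mulComulIso : tensorOne A A ≫ (mulComulIso A).hom = tensorOne A A := by
  have h : η[A] ≫ Δ[A] = (λ_ (𝟙_ C)).inv ≫ (η[A] ⊗ₘ η[A]) := BimonObj.one_comul A
  calc _ = 𝟙 _ ⊗≫ η[A] ▷ 𝟙_ C ⊗≫ A ◁ (η[A] ≫ Δ[A]) ⊗≫ μ[A] ▷ A := by
        rw [tensorOne, MonoidalCategory.tensorHom_def, mulComulIso_hom]; monoidal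
    _ = 𝟙 _ ⊗≫ η[A] ▷ 𝟙_ C ⊗≫ A ◁ η[A] ▷ 𝟙_ C ⊗≫ ((A ⊗ A) ◁ η[A] ≫ μ[A] ▷ A) := by
        rw [h, MonoidalCategory.tensorHom_def]; monoidal
    _ = 𝟙 _ ⊗≫ η[A] ▷ 𝟙_ C ⊗≫ (A ◁ η[A] ≫ μ[A]) ▷ 𝟙_ C ⊗≫ A ◁ η[A] := by
        rw [whisker_exchange]; monoidal
    _ = _ := by
        rw [MonObj.mul_one, tensorOne, MonoidalCategory.tensorHom_def]; monoidal

theorem mulComulIso_tensorCounit : (mulComulIso A).hom ≫ tensorCounit A A = tensorCounit A A := by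
  have h : μ[A] ≫ ε[A] = (ε[A] ⊗ₘ ε[A]) ≫ (λ_ (𝟙_ C)).hom := BimonObj.mul_counit A
  calc _ = 𝟙 _ ⊗≫ A ◁ Δ[A] ⊗≫ (μ[A] ≫ ε[A]) ▷ A ⊗≫ ε[A] ⊗≫ 𝟙 _ := by
        rw [tensorCounit, MonoidalCategory.tensorHom_def, mulComulIso_hom]; monoidal
    _ = 𝟙 _ ⊗≫ (A ◁ (Δ[A] ≫ ε[A] ▷ A)) ⊗≫ ε[A] ▷ A ⊗≫ ε[A] ⊗≫ 𝟙 _ := by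
        rw [h, MonoidalCategory.tensorHom_def']; monoidal
    _ = _ := by
        rw [ComonObj.counit_comul, tensorCounit, MonoidalCategory.tensorHom_def]; monoidal

/-- `a ⊗ b ↦ a b₁ ⊗ b₂` intertwines the braided tensor product coalgebra with the cross coproduct
by the adjoint coaction. -/
theorem mulComulIso_crossComul :
    (mulComulIso A).hom ≫ crossComul A A (adjointCoaction A) =
      braidedTensorComul A A ≫ ((mulComulIso A).hom ⊗ₘ (mulComulIso A).hom) := by
  have h : μ[A] ≫ Δ[A] = (Δ[A] ⊗ₘ Δ[A]) ≫ tensorμ A A A A ≫ (μ[A] ⊗ₘ μ[A]) :=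
    BimonObj.mul_comul A
  have hK := comul_adjointCoaction A
  generalize adjointCoaction A = s at hK ⊢
  -- `k` sends `b ⊗ b'` to `s(b'₁)⁽⁰⁾ ⊗ b s(b'₁)⁽¹⁾ ⊗ b'₂`, with `b` moved past the first factor; by
  -- `hk'` it takes `b₁ ⊗ b₂` to `b₁ ⊗ b₂ ⊗ b₃` when `s` is the adjoint coaction.
  obtain ⟨k, hk⟩ : ∃ k : A ⊗ A ⟶ A ⊗ (A ⊗ A), k = 𝟙 _ ⊗≫ A ◁ (Δ[A] ≫ s ▷ A) ⊗≫
    (β_ A A).hom ▷ (A ⊗ A) ⊗≫ A ◁ μ[A] ▷ A ⊗≫ 𝟙 _ := ⟨_, rfl⟩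
  have hk' : Δ[A] ≫ k = Δ[A] ≫ Δ[A] ▷ A ≫ (α_ A A A).hom := by
    calc Δ[A] ≫ k = 𝟙 _ ⊗≫ (Δ[A] ≫ A ◁ Δ[A]) ⊗≫ A ◁ s ▷ A ⊗≫
          (β_ A A).hom ▷ (A ⊗ A) ⊗≫ A ◁ μ[A] ▷ A ⊗≫ 𝟙 _ := by rw [hk]; monoidal
      _ = 𝟙 _ ⊗≫ Δ[A] ⊗≫ (Δ[A] ≫ A ◁ s ≫ (α_ A A A).inv ≫ (β_ A A).hom ▷ A ≫ (α_ A A A).hom ≫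
            A ◁ μ[A]) ▷ A ⊗≫ 𝟙 _ := by rw [ComonObj.comul_assoc]; monoidal
      _ = _ := by rw [hK]; monoidal
  calc (mulComulIso A).hom ≫ crossComul A A s
      = 𝟙 _ ⊗≫ A ◁ Δ[A] ⊗≫ (μ[A] ≫ Δ[A]) ▷ A ⊗≫ (A ⊗ A) ◁ (Δ[A] ≫ s ▷ A) ⊗≫
          A ◁ (β_ A A).hom ▷ (A ⊗ A) ⊗≫ A ◁ A ◁ μ[A] ▷ A ⊗≫ 𝟙 _ := by
        rw [mulComulIso_hom, crossComul, MonoidalCategory.tensorHom_def]; simp only [tensorμ]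
        monoidal
    _ = 𝟙 _ ⊗≫ A ◁ (Δ[A] ≫ Δ[A] ▷ A) ⊗≫
          (Δ[A] ▷ A ⊗≫ A ◁ (β_ A A).hom ⊗≫ μ[A] ▷ A) ▷ (A ⊗ A) ⊗≫
          A ◁ (μ[A] ▷ A ≫ A ◁ (Δ[A] ≫ s ▷ A)) ⊗≫
          A ◁ (β_ A A).hom ▷ (A ⊗ A) ⊗≫ A ◁ A ◁ μ[A] ▷ A ⊗≫ 𝟙 _ := by
        rw [h, MonoidalCategory.tensorHom_def', MonoidalCategory.tensorHom_def]
        simp only [tensorμ]; monoidal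
    _ = 𝟙 _ ⊗≫ A ◁ (Δ[A] ≫ Δ[A] ▷ A) ⊗≫
          (Δ[A] ▷ A ⊗≫ A ◁ (β_ A A).hom ⊗≫ μ[A] ▷ A) ▷ (A ⊗ A) ⊗≫
          A ◁ A ◁ A ◁ (Δ[A] ≫ s ▷ A) ⊗≫
          A ◁ (μ[A] ▷ A ≫ (β_ A A).hom) ▷ (A ⊗ A) ⊗≫ A ◁ A ◁ μ[A] ▷ A ⊗≫ 𝟙 _ := by
        rw [← whisker_exchange μ[A]]; monoidal
    _ = 𝟙 _ ⊗≫ A ◁ (Δ[A] ≫ Δ[A] ▷ A) ⊗≫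
          (Δ[A] ▷ A ⊗≫ A ◁ (β_ A A).hom ⊗≫ μ[A] ▷ A) ▷ (A ⊗ A) ⊗≫
          A ◁ A ◁ A ◁ (Δ[A] ≫ s ▷ A) ⊗≫
          A ◁ (A ◁ (β_ A A).hom ⊗≫ (β_ A A).hom ▷ A) ▷ (A ⊗ A) ⊗≫
          A ◁ A ◁ (μ[A] ▷ A ≫ μ[A]) ▷ A ⊗≫ 𝟙 _ := by
        rw [BraidedCategory.braiding_naturality_left, BraidedCategory.braiding_tensor_left_hom]
        monoidal
    _ = 𝟙 _ ⊗≫ A ◁ (Δ[A] ≫ Δ[A] ▷ A) ⊗≫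
          (Δ[A] ▷ A ⊗≫ A ◁ (β_ A A).hom ⊗≫ μ[A] ▷ A) ▷ (A ⊗ A) ⊗≫
          A ◁ A ◁ A ◁ (Δ[A] ≫ s ▷ A) ⊗≫ A ◁ A ◁ (β_ A A).hom ▷ (A ⊗ A) ⊗≫
          A ◁ ((β_ A A).hom ▷ (A ⊗ A) ≫ (A ⊗ A) ◁ μ[A]) ▷ A ⊗≫
          A ◁ A ◁ μ[A] ▷ A ⊗≫ 𝟙 _ := by
        rw [MonObj.mul_assoc]; monoidal
    _ = 𝟙 _ ⊗≫ A ◁ (Δ[A] ≫ Δ[A] ▷ A) ⊗≫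
          ((Δ[A] ▷ A ⊗≫ A ◁ (β_ A A).hom ⊗≫ μ[A] ▷ A) ▷ (A ⊗ A) ≫ (A ⊗ A) ◁ k) ⊗≫
          A ◁ (β_ A A).hom ▷ (A ⊗ A) ⊗≫ A ◁ A ◁ μ[A] ▷ A ⊗≫ 𝟙 _ := by
        rw [← whisker_exchange (β_ A A).hom, hk]; monoidal
    _ = 𝟙 _ ⊗≫ A ◁ (Δ[A] ≫ Δ[A] ▷ A ≫ (α_ A A A).hom) ⊗≫ A ◁ A ◁ k ⊗≫
          (Δ[A] ▷ A ⊗≫ A ◁ (β_ A A).hom ⊗≫ μ[A] ▷ A) ▷ (A ⊗ (A ⊗ A)) ⊗≫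
          A ◁ (β_ A A).hom ▷ (A ⊗ A) ⊗≫ A ◁ A ◁ μ[A] ▷ A ⊗≫ 𝟙 _ := by
        rw [← whisker_exchange]; monoidal
    _ = 𝟙 _ ⊗≫ A ◁ Δ[A] ⊗≫ A ◁ A ◁ (Δ[A] ≫ k) ⊗≫
          (Δ[A] ▷ A ⊗≫ A ◁ (β_ A A).hom ⊗≫ μ[A] ▷ A) ▷ (A ⊗ (A ⊗ A)) ⊗≫
          A ◁ (β_ A A).hom ▷ (A ⊗ A) ⊗≫ A ◁ A ◁ μ[A] ▷ A ⊗≫ 𝟙 _ := by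
        rw [← ComonObj.comul_assoc]; monoidal
    _ = 𝟙 _ ⊗≫ A ◁ (Δ[A] ≫ A ◁ Δ[A]) ⊗≫ A ◁ A ◁ A ◁ Δ[A] ⊗≫
          (Δ[A] ▷ A ⊗≫ A ◁ (β_ A A).hom ⊗≫ μ[A] ▷ A) ▷ (A ⊗ (A ⊗ A)) ⊗≫
          A ◁ (β_ A A).hom ▷ (A ⊗ A) ⊗≫ A ◁ A ◁ μ[A] ▷ A ⊗≫ 𝟙 _ := by
        rw [hk', ← ComonObj.comul_assoc]; monoidal
    _ = 𝟙 _ ⊗≫ A ◁ Δ[A] ⊗≫ A ◁ Δ[A] ▷ A ⊗≫ A ◁ A ◁ A ◁ Δ[A] ⊗≫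
          (Δ[A] ▷ A ⊗≫ A ◁ (β_ A A).hom) ▷ (A ⊗ (A ⊗ A)) ⊗≫
          (μ[A] ▷ (A ⊗ A) ≫ A ◁ (β_ A A).hom) ▷ (A ⊗ A) ⊗≫ A ◁ A ◁ μ[A] ▷ A ⊗≫ 𝟙 _ := by
        rw [ComonObj.comul_assoc]; monoidal
    _ = 𝟙 _ ⊗≫ A ◁ Δ[A] ⊗≫ A ◁ Δ[A] ▷ A ⊗≫ ((A ⊗ (A ⊗ A)) ◁ Δ[A] ≫
          (Δ[A] ▷ (A ⊗ A) ⊗≫ A ◁ (β_ A A).hom ▷ A ⊗≫ A ◁ A ◁ (β_ A A).hom ⊗≫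
            μ[A] ▷ (A ⊗ A)) ▷ (A ⊗ A)) ⊗≫ A ◁ A ◁ μ[A] ▷ A ⊗≫ 𝟙 _ := by
        rw [← whisker_exchange μ[A]]; monoidal
    _ = 𝟙 _ ⊗≫ A ◁ Δ[A] ⊗≫ (A ◁ Δ[A] ≫ Δ[A] ▷ (A ⊗ A)) ▷ A ⊗≫
          A ◁ ((β_ A A).hom ▷ A ⊗≫ A ◁ (β_ A A).hom) ▷ A ⊗≫
          (μ[A] ▷ (A ⊗ A)) ▷ A ⊗≫ A ◁ A ◁ (A ◁ Δ[A] ⊗≫ μ[A] ▷ A) ⊗≫ 𝟙 _ := by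
        rw [whisker_exchange]; monoidal
    _ = 𝟙 _ ⊗≫ A ◁ Δ[A] ⊗≫ Δ[A] ▷ (A ⊗ A) ⊗≫
          A ◁ (A ◁ Δ[A] ≫ (β_ A (A ⊗ A)).hom) ▷ A ⊗≫
          (μ[A] ▷ (A ⊗ A)) ▷ A ⊗≫ A ◁ A ◁ (A ◁ Δ[A] ⊗≫ μ[A] ▷ A) ⊗≫ 𝟙 _ := by
        rw [whisker_exchange, BraidedCategory.braiding_tensor_right_hom]; monoidal
    _ = braidedTensorComul A A ≫ ((mulComulIso A).hom ⊗ₘ (mulComulIso A).hom) := by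
        rw [BraidedCategory.braiding_naturality_right, braidedTensorComul, mulComulIso_hom,
          MonoidalCategory.tensorHom_def', MonoidalCategory.tensorHom_def]
        simp only [tensorμ]; monoidal

/-- `a ⊗ b ↦ a b₁ ⊗ b₂` intertwines the cross product by the adjoint action with the braided tensor
product algebra. -/
theorem crossMul_mulComulIso :
    crossMul A A (adjointAction A) ≫ (mulComulIso A).hom =
      ((mulComulIso A).hom ⊗ₘ (mulComulIso A).hom) ≫ braidedTensorMul A A := by
  have h : μ[A] ≫ Δ[A] = (Δ[A] ⊗ₘ Δ[A]) ≫ tensorμ A A A A ≫ (μ[A] ⊗ₘ μ[A]) :=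
    BimonObj.mul_comul A
  have hL := adjointAction_mul A
  -- `(x y) (z w) = x ((y z) w)`
  have h4 : μ[A] ▷ (A ⊗ A) ≫ A ◁ μ[A] ≫ μ[A] =
      𝟙 _ ⊗≫ A ◁ (μ[A] ▷ A) ⊗≫ A ◁ μ[A] ⊗≫ μ[A] := by
    calc _ = 𝟙 _ ⊗≫ (A ⊗ A) ◁ μ[A] ⊗≫ (μ[A] ▷ A ≫ μ[A]) := by
          rw [← whisker_exchange_assoc]; monoidal
      _ = 𝟙 _ ⊗≫ A ◁ ((α_ A A A).hom ≫ A ◁ μ[A] ≫ μ[A]) ⊗≫ μ[A] := by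
          rw [MonObj.mul_assoc]; monoidal
      _ = _ := by rw [← MonObj.mul_assoc]; monoidal
  generalize adjointAction A = l at hL ⊢
  -- `t` sends `b ⊗ d` to `d₁ ⊗ b d₂`, with `b` moved past `d₁`. Both sides are brought to the form
  -- `a (b₁ c) d₁ ⊗ b₂ d₂`, the left one by `hL`.
  obtain ⟨t, ht⟩ : ∃ t : A ⊗ A ⟶ A ⊗ A, t = 𝟙 _ ⊗≫ A ◁ Δ[A] ⊗≫ (β_ A A).hom ▷ A ⊗≫ A ◁ μ[A] :=
    ⟨_, rfl⟩
  calc crossMul A A l ≫ (mulComulIso A).hom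
      = 𝟙 _ ⊗≫ A ◁ Δ[A] ▷ (A ⊗ A) ⊗≫ A ◁ A ◁ (β_ A A).hom ▷ A ⊗≫ (A ◁ l ≫ μ[A]) ▷ (A ⊗ A) ⊗≫
          A ◁ (μ[A] ≫ Δ[A]) ⊗≫ μ[A] ▷ A ⊗≫ 𝟙 _ := by
        rw [mulComulIso_hom, crossMul, MonoidalCategory.tensorHom_def]; simp only [tensorμ]
        monoidal
    _ = 𝟙 _ ⊗≫ A ◁ Δ[A] ▷ (A ⊗ A) ⊗≫ A ◁ A ◁ (β_ A A).hom ▷ A ⊗≫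
          ((A ◁ l ≫ μ[A]) ▷ (A ⊗ A) ≫ A ◁ (Δ[A] ▷ A ⊗≫ A ◁ t)) ⊗≫ (A ◁ μ[A] ≫ μ[A]) ▷ A ⊗≫
          𝟙 _ := by
        rw [h, ht, MonoidalCategory.tensorHom_def, MonoidalCategory.tensorHom_def' μ[A]]
        simp only [tensorμ]; monoidal
    _ = 𝟙 _ ⊗≫ A ◁ Δ[A] ▷ (A ⊗ A) ⊗≫ A ◁ A ◁ ((β_ A A).hom ≫ A ◁ Δ[A]) ▷ A ⊗≫
          A ◁ ((A ⊗ A) ⊗ A) ◁ t ⊗≫ A ◁ l ▷ (A ⊗ (A ⊗ A)) ⊗≫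
          (μ[A] ▷ (A ⊗ A) ≫ A ◁ μ[A] ≫ μ[A]) ▷ A ⊗≫ 𝟙 _ := by
        rw [← whisker_exchange]; monoidal
    _ = 𝟙 _ ⊗≫ A ◁ Δ[A] ▷ (A ⊗ A) ⊗≫ A ◁ A ◁ ((β_ A A).hom ≫ A ◁ Δ[A]) ▷ A ⊗≫
          A ◁ (((A ⊗ A) ⊗ A) ◁ t ≫ (l ▷ A ≫ μ[A]) ▷ (A ⊗ A)) ⊗≫
          (A ◁ μ[A] ≫ μ[A]) ▷ A ⊗≫ 𝟙 _ := by
        rw [h4]; monoidal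
    _ = 𝟙 _ ⊗≫ A ◁ (Δ[A] ≫ A ◁ Δ[A]) ▷ (A ⊗ A) ⊗≫
          A ◁ A ◁ (A ◁ (β_ A A).hom ⊗≫ (β_ A A).hom ▷ A) ▷ A ⊗≫
          A ◁ (l ▷ A ≫ μ[A]) ▷ (A ⊗ A) ⊗≫ A ◁ A ◁ t ⊗≫ (A ◁ μ[A] ≫ μ[A]) ▷ A ⊗≫ 𝟙 _ := by
        rw [whisker_exchange, ← BraidedCategory.braiding_naturality_left,
          BraidedCategory.braiding_tensor_left_hom]
        monoidal
    _ = 𝟙 _ ⊗≫ A ◁ Δ[A] ▷ (A ⊗ A) ⊗≫ A ◁ (Δ[A] ▷ (A ⊗ A) ≫ (A ⊗ A) ◁ (β_ A A).hom) ▷ A ⊗≫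
          A ◁ A ◁ (β_ A A).hom ▷ (A ⊗ A) ⊗≫
          A ◁ (l ▷ A ≫ μ[A]) ▷ (A ⊗ A) ⊗≫ A ◁ A ◁ t ⊗≫ (A ◁ μ[A] ≫ μ[A]) ▷ A ⊗≫ 𝟙 _ := by
        rw [ComonObj.comul_assoc]; monoidal
    _ = 𝟙 _ ⊗≫ A ◁ Δ[A] ▷ (A ⊗ A) ⊗≫ A ◁ A ◁ (β_ A A).hom ▷ A ⊗≫
          A ◁ (Δ[A] ▷ A ≫ (α_ A A A).hom ≫ A ◁ (β_ A A).hom ≫ (α_ A A A).inv ≫ l ▷ A ≫ μ[A]) ▷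
            (A ⊗ A) ⊗≫ A ◁ A ◁ t ⊗≫ (A ◁ μ[A] ≫ μ[A]) ▷ A ⊗≫ 𝟙 _ := by
        rw [← whisker_exchange]; monoidal
    _ = 𝟙 _ ⊗≫ A ◁ Δ[A] ▷ (A ⊗ A) ⊗≫ A ◁ A ◁ (β_ A A).hom ▷ A ⊗≫
          A ◁ (μ[A] ▷ (A ⊗ A) ≫ A ◁ t) ⊗≫ (A ◁ μ[A] ≫ μ[A]) ▷ A ⊗≫ 𝟙 _ := by
        rw [hL]; monoidal
    _ = 𝟙 _ ⊗≫ A ◁ Δ[A] ▷ (A ⊗ A) ⊗≫ A ◁ A ◁ (β_ A A).hom ▷ A ⊗≫ A ◁ A ◁ A ◁ t ⊗≫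
          (μ[A] ▷ (A ⊗ A) ≫ A ◁ μ[A] ≫ μ[A]) ▷ A ⊗≫ 𝟙 _ := by
        rw [← whisker_exchange, h4]; monoidal
    _ = 𝟙 _ ⊗≫ A ◁ Δ[A] ▷ (A ⊗ A) ⊗≫ (μ[A] ▷ (A ⊗ (A ⊗ A)) ≫
          A ◁ ((α_ A A A).inv ≫ (β_ A A).hom ▷ A ⊗≫ A ◁ t)) ⊗≫ (A ◁ μ[A] ≫ μ[A]) ▷ A ⊗≫ 𝟙 _ := by
        rw [← whisker_exchange]; monoidal
    _ = 𝟙 _ ⊗≫ A ◁ Δ[A] ▷ (A ⊗ A) ⊗≫ μ[A] ▷ (A ⊗ (A ⊗ A)) ⊗≫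
          A ◁ ((β_ A A).hom ▷ A ≫ (A ⊗ A) ◁ Δ[A]) ⊗≫ A ◁ A ◁ (β_ A A).hom ▷ A ⊗≫
          A ◁ ((A ⊗ A) ◁ μ[A] ≫ μ[A] ▷ A) ⊗≫ μ[A] ▷ A ⊗≫ 𝟙 _ := by
        rw [ht]; monoidal
    _ = 𝟙 _ ⊗≫ A ◁ Δ[A] ▷ (A ⊗ A) ⊗≫ μ[A] ▷ (A ⊗ (A ⊗ A)) ⊗≫ A ◁ A ◁ A ◁ Δ[A] ⊗≫
          A ◁ ((β_ A (A ⊗ A)).hom ≫ μ[A] ▷ A) ▷ A ⊗≫ A ◁ A ◁ μ[A] ⊗≫ μ[A] ▷ A ⊗≫ 𝟙 _ := by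
        rw [← whisker_exchange, whisker_exchange μ[A],
          BraidedCategory.braiding_tensor_right_hom]; monoidal
    _ = ((mulComulIso A).hom ⊗ₘ (mulComulIso A).hom) ≫ braidedTensorMul A A := by
        rw [← BraidedCategory.braiding_naturality_right, braidedTensorMul, mulComulIso_hom,
          MonoidalCategory.tensorHom_def, MonoidalCategory.tensorHom_def' μ[A]]
        simp only [tensorμ]; monoidal

end CrossIso

/-! ### Transport of Hopf algebra structures -/

section Transport

variable {C : Type u} [Category.{v} C] [MonoidalCategory C] [BraidedCategory C]

/-- Structure maps on `Q` that correspond to those of a Hopf algebra `P` under an isomorphism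
`e : Q ≅ P` make `Q` a Hopf algebra. -/
abbrev hopfObjOfIso {P Q : C} [HopfObj P] (e : Q ≅ P) {m : Q ⊗ Q ⟶ Q} {u : 𝟙_ C ⟶ Q}
    {d : Q ⟶ Q ⊗ Q} {c : Q ⟶ 𝟙_ C} (hm : m ≫ e.hom = (e.hom ⊗ₘ e.hom) ≫ μ[P])
    (hu : u ≫ e.hom = η[P]) (hd : e.hom ≫ Δ[P] = d ≫ (e.hom ⊗ₘ e.hom)) (hc : e.hom ≫ ε[P] = c) :
    HopfObj Q where
  mul := m
  one := u
  comul := d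
  counit := c
  antipode := e.hom ≫ 𝒮[P] ≫ e.inv
  one_mul := by
    rw [← cancel_mono e.hom, Category.assoc, hm, ← tensorHom_id, tensorHom_comp_tensorHom_assoc,
      hu, Category.id_comp, MonoidalCategory.tensorHom_def', Category.assoc, MonObj.one_mul,
      leftUnitor_naturality]
  mul_one := by
    rw [← cancel_mono e.hom, Category.assoc, hm, ← id_tensorHom, tensorHom_comp_tensorHom_assoc,
      hu, Category.id_comp, MonoidalCategory.tensorHom_def, Category.assoc, MonObj.mul_one,
      rightUnitor_naturality]
  mul_assoc := by
    have h1 : (m ▷ Q) ≫ (e.hom ⊗ₘ e.hom) = ((e.hom ⊗ₘ e.hom) ⊗ₘ e.hom) ≫ μ[P] ▷ P := by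
      rw [← tensorHom_id, ← tensorHom_id, tensorHom_comp_tensorHom, tensorHom_comp_tensorHom, hm,
        Category.id_comp, Category.comp_id]
    have h2 : (Q ◁ m) ≫ (e.hom ⊗ₘ e.hom) = (e.hom ⊗ₘ (e.hom ⊗ₘ e.hom)) ≫ P ◁ μ[P] := by
      rw [← id_tensorHom, ← id_tensorHom, tensorHom_comp_tensorHom, tensorHom_comp_tensorHom, hm,
        Category.id_comp, Category.comp_id]
    rw [← cancel_mono e.hom]
    simp only [Category.assoc]
    rw [hm, reassoc_of% h1, reassoc_of% h2, MonObj.mul_assoc, associator_naturality_assoc]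
  counit_comul := by
    rw [← cancel_mono (𝟙_ C ◁ e.hom), Category.assoc, ← hc, ← MonoidalCategory.tensorHom_def,
      ← leftUnitor_inv_naturality, ← ComonObj.counit_comul, reassoc_of% hd, ← tensorHom_id,
      tensorHom_comp_tensorHom, Category.comp_id]
  comul_counit := by
    rw [← cancel_mono (e.hom ▷ 𝟙_ C), Category.assoc, ← hc, ← MonoidalCategory.tensorHom_def',
      ← rightUnitor_inv_naturality, ← ComonObj.comul_counit, reassoc_of% hd, ← id_tensorHom,
      tensorHom_comp_tensorHom, Category.comp_id]
  comul_assoc := by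
    have h1 : (d ▷ Q) ≫ ((e.hom ⊗ₘ e.hom) ⊗ₘ e.hom) = (e.hom ⊗ₘ e.hom) ≫ Δ[P] ▷ P := by
      rw [← tensorHom_id, ← tensorHom_id, tensorHom_comp_tensorHom, tensorHom_comp_tensorHom, hd,
        Category.id_comp, Category.comp_id]
    have h2 : (Q ◁ d) ≫ (e.hom ⊗ₘ (e.hom ⊗ₘ e.hom)) = (e.hom ⊗ₘ e.hom) ≫ P ◁ Δ[P] := by
      rw [← id_tensorHom, ← id_tensorHom, tensorHom_comp_tensorHom, tensorHom_comp_tensorHom, hd,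
        Category.id_comp, Category.comp_id]
    rw [← cancel_mono (e.hom ⊗ₘ (e.hom ⊗ₘ e.hom))]
    simp only [Category.assoc]
    rw [h2, ← associator_naturality, reassoc_of% h1, ← reassoc_of% hd, ← reassoc_of% hd,
      ComonObj.comul_assoc]
  mul_comul := by
    rw [← cancel_mono (e.hom ⊗ₘ e.hom)]
    simp only [Category.assoc]
    rw [← hd, reassoc_of% hm, tensorHom_comp_tensorHom, hm, ← tensorHom_comp_tensorHom,
      ← tensorμ_natural_assoc, tensorHom_comp_tensorHom_assoc, ← hd, BimonObj.mul_comul,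
      tensorHom_comp_tensorHom_assoc]
  one_comul := by
    have h := BimonObj.one_comul P
    rw [MonObj.tensorObj.one_def] at h
    change u ≫ d = (λ_ (𝟙_ C)).inv ≫ (u ⊗ₘ u)
    rw [← cancel_mono (e.hom ⊗ₘ e.hom)]
    simp only [Category.assoc]
    rw [← hd, reassoc_of% hu, tensorHom_comp_tensorHom, h]
    simp only [hu]
  mul_counit := by
    have h : μ[P] ≫ ε[P] = (ε[P] ⊗ₘ ε[P]) ≫ (λ_ (𝟙_ C)).hom := BimonObj.mul_counit P
    change m ≫ c = (c ⊗ₘ c) ≫ (λ_ (𝟙_ C)).hom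
    rw [← hc, reassoc_of% hm, h, tensorHom_comp_tensorHom_assoc]
  one_counit := by rw [← hc, reassoc_of% hu, BimonObj.one_counit]
  antipode_left := by
    rw [← cancel_mono e.hom]
    simp only [Category.assoc]
    rw [hm, hu, ← hc, Category.assoc, ← HopfObj.antipode_left, reassoc_of% hd, ← tensorHom_id,
      ← tensorHom_id, tensorHom_comp_tensorHom_assoc, tensorHom_comp_tensorHom_assoc]
    simp
  antipode_right := by
    rw [← cancel_mono e.hom]
    simp only [Category.assoc]
    rw [hm, hu, ← hc, Category.assoc, ← HopfObj.antipode_right, reassoc_of% hd, ← id_tensorHom,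
      ← id_tensorHom, tensorHom_comp_tensorHom_assoc, tensorHom_comp_tensorHom_assoc]
    simp

/-- An isomorphism of the underlying objects that is multiplicative and comultiplicative is an
isomorphism of Hopf algebras. -/
theorem nonempty_hopf_iso {P Q : C} [HopfObj P] [HopfObj Q] (e : Q ≅ P)
    (hm : μ[Q] ≫ e.hom = (e.hom ⊗ₘ e.hom) ≫ μ[P])
    (hu : η[Q] ≫ e.hom = η[P]) (hd : e.hom ≫ Δ[P] = Δ[Q] ≫ (e.hom ⊗ₘ e.hom))
    (hc : e.hom ≫ ε[P] = ε[Q]) : Nonempty (Hopf.mk Q ≅ Hopf.mk P) := by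
  have : IsMonHom e.hom := ⟨hu, hm⟩
  let f : Bimon.mk'X Q ≅ Bimon.mk'X P := Mon.mkIso e hu hm
  let g : Bimon.mk' Q ≅ Bimon.mk' P := Comon.mkIso f (Mon.Hom.ext hc) (Mon.Hom.ext hd)
  exact ⟨(fullyFaithfulInducedFunctor Hopf.toBimon).preimageIso g⟩

end Transport

end BraidedReconstruction

open BraidedReconstruction in
theorem proposition2p4 {C : Type*} [Category* C] [MonoidalCategory C] [BraidedCategory C]
    [RightRigidCategory C] (A : C) (β : 𝟭 C ⟶ 𝟭 C ⋙ tensorRight A) (hβ : IsRepresentable β) :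
    ∃ hA : HopfObj A,
      -- `A = Aut(C)` is the braided group reconstructed from the identity functor
      IsReconstruction (𝟭 C) (Hopf.mk A) β ∧
      -- it is the coend of `X* ⊗ X`, and its tautological coaction on itself is the adjoint one
      Nonempty (IsColimit (tautologicalCowedge β)) ∧
      β.app A = adjointCoaction A ∧
      ∃ sq cp : HopfObj (A ⊗ A),
        -- the reconstruction from the forgetful functor is the cross coproduct
        IsReconstruction (Comodule.forget A) (Hopf.mk (A ⊗ A) (hopf := sq)) (comoduleCoact β A) ∧
        IsCrossCoproduct (adjointCoaction A) sq ∧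
        IsCrossProduct (adjointAction A) cp ∧
        Nonempty (Hopf.mk (A ⊗ A) (hopf := sq) ≅ Hopf.mk (A ⊗ A) (hopf := cp)) := by
  obtain ⟨hA, h⟩ := hβ.exists_hopfObj
  obtain ⟨sq, hrec, hsq⟩ :=
    exists_isReconstruction_comoduleCoact hβ (hβ.comoduleCoact (B := A)) h
  have hm : crossMul A A (adjointAction A) ≫ (mulComulIso A).hom =
      ((mulComulIso A).hom ⊗ₘ (mulComulIso A).hom) ≫ sq.mul := by
    rw [hsq.mul, crossMul_mulComulIso]
  have hu : tensorOne A A ≫ (mulComulIso A).hom = sq.one := by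
    rw [hsq.one, tensorOne_mulComulIso]
  have hd : (mulComulIso A).hom ≫ sq.comul =
      braidedTensorComul A A ≫ ((mulComulIso A).hom ⊗ₘ (mulComulIso A).hom) := by
    rw [hsq.comul, mulComulIso_crossComul]
  have hc : (mulComulIso A).hom ≫ sq.counit = tensorCounit A A := by
    rw [hsq.counit, mulComulIso_tensorCounit]
  let cp : HopfObj (A ⊗ A) := @hopfObjOfIso _ _ _ _ _ _ sq (mulComulIso A) _ _ _ _ hm hu hd hc
  obtain ⟨i⟩ := @nonempty_hopf_iso _ _ _ _ _ _ sq cp (mulComulIso A) hm hu hd hc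
  exact ⟨hA, h.isReconstruction hβ, hβ.isColimit_tautologicalCowedge, h.taut_self hβ, sq, cp, hrec,
    hsq, ⟨rfl, rfl, rfl, rfl⟩, ⟨i.symm⟩⟩
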